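/- Let $p,q\ge 1$, let $x_1,\dots,x_s$ be distinct points of $\mathbb{P}^1=\mathbb{CP}^1$, $D=x_1+\dots+x_s$, and let $\mathcal K$ be the canonical bundle of $\mathbb{P}^1$. A parabolic bundle $\mathcal E_\bullet$ of rank $n$ on $\mathbb P^1\setminus\{x_1,\dots,x_s\}$ is a holomorphic vector bundle $\mathcal E$ of rank $n$ on $\mathbb{P}^1$ with, at each $x_j$, a decreasing left-continuous filtration $(\mathcal E_{x_j,c})_{c\in\mathbb R}$ of the fibre $\mathcal E_{x_j}$ by subspaces, with $\mathcal E_{x_j,0}=\mathcal E_{x_j}$ and $\mathcal E_{x_j,1}=0$. Its type at $x_j$ is the nondecreasing $n$-tuple of the jumps $c\in[0,1)$ of the filtration, each repeated $\dim(\mathcal E_{x_j,c}/\bigcup_{b>c}\mathcal E_{x_j,b})$ times, and its parabolic degree $\deg(\mathcal E_\bullet)$ is $\deg\mathcal E$ plus the sum of all these weights over all $x_j$. Subbundles carry the induced filtrations. $\mathrm{Hom}(\mathcal E_\bullet,\mathcal F_\bullet)$ denotes the sheaf of homomorphisms $\mathcal E\to\mathcal F$ that at each $x_j$ map $\mathcal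 E_{x_j,c}$ into $\bigcup_{b>c}\mathcal F_{x_j,b}$ for all $c$. A parabolic $\mathrm{SU}(p,q)$ Higgs bundle $(\mathcal U_\bullet\oplus\mathcal V_\bullet,\gamma\oplus\delta)$ consists of parabolic bundles $\mathcal U_\bullet,\mathcal V_\bullet$ of ranks $p,q$ such that $\det(\mathcal U_\bullet)\otimes\det(\mathcal V_\bullet)$ is the trivial line bundle with trivial parabolic structure, and of sections $\gamma\in H^0(\mathcal K(D)\otimes\mathrm{Hom}(\mathcal U_\bullet,\mathcal V_\bullet))$, $\delta\in H^0(\mathcal K(D)\otimes\mathrm{Hom}(\mathcal V_\bullet,\mathcal U_\bullet))$. It is semistable if $\deg(\mathcal U'_\bullet\oplus\mathcal V'_\bullet)\le 0$ for all holomorphic subbundles $\mathcal U'\subset\mathcal U$, $\mathcal V'\subset\mathcal V$ with $\mathcal U'\oplus\mathcal V'$ invariant under $\gamma\oplus\delta$. It has type $(\alpha,\beta)$ if $\mathcal U_\bullet$ and $\mathcal V_\bullet$ have types $\alpha^j=(\alpha^j_1\le\dots\le\alpha^j_p)$ and $\beta^j=(\beta^j_1\le\dots\le\beta^j_q)$ at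 $x_j$ for all $j$. An $\mathrm{SU}(p,q)$-multiweight is a pair $(\alpha,\beta)$ with $0\le\alpha^j_1\le\dots\le\alpha^j_p<1$, $0\le\beta^j_1\le\dots\le\beta^j_q<1$ and $\sum_i\alpha^j_i+\sum_i\beta^j_i\in\mathbb N$ for all $j\in\{1,\dots,s\}$. **Proposition.** Let $(\alpha,\beta)$ be an $\mathrm{SU}(p,q)$-multiweight such that 1. $\alpha^j_p<\beta^j_1$ for all $j\in\{1,\dots,s\}$, 2. $\varepsilon:=\sum_{j=1}^s(\beta^j_q-\alpha^j_1)<2$. Let $(\mathcal U_\bullet\oplus\mathcal V_\bullet,\gamma\oplus\delta)$ be a semistable parabolic $\mathrm{SU}(p,q)$ Higgs bundle of type $(\alpha,\beta)$. If $\deg(\mathcal U_\bullet)-\deg(\mathcal V_\bullet)<2-\varepsilon$, then $\delta$ vanishes identically. -/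

import Mathlib

open Bundle Filter Module
open scoped Manifold ContDiff Topology OnePoint

/-! ### The Riemann sphere as a complex manifold -/

namespace RiemannSphere

/-- The inversion `z ↦ 1 / z` of the Riemann sphere `ℂ ∪ {∞}`. -/
noncomputable def inv (x : OnePoint ℂ) : OnePoint ℂ :=
  x.elim ((0 : ℂ) : OnePoint ℂ) (fun z => if z = 0 then (∞ : OnePoint ℂ) else ((z⁻¹ : ℂ) : OnePoint ℂ))

@[simp] theorem inv_infty : inv (∞ : OnePoint ℂ) = ((0 : ℂ) : OnePoint ℂ) := rfl

@[simp] theorem inv_zero : inv ((0 : ℂ) : OnePoint ℂ) = (∞ : OnePoint ℂ) := by simp [inv]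

theorem inv_coe {z : ℂ} (hz : z ≠ 0) : inv (z : OnePoint ℂ) = ((z⁻¹ : ℂ) : OnePoint ℂ) := by
  simp [inv, hz]

theorem inv_inv (x : OnePoint ℂ) : inv (inv x) = x := by
  induction x using OnePoint.rec with
  | infty => simp
  | coe z =>
    by_cases hz : z = 0
    · subst hz; simp
    · rw [inv_coe hz, inv_coe (inv_ne_zero hz), _root_.inv_inv]

theorem continuous_inv : Continuous inv := by
  rw [continuous_iff_continuousAt]
  intro x
  induction x using OnePoint.rec with
  | infty =>
    rw [OnePoint.continuousAt_infty', inv_infty, coclosedCompact_eq_cocompact]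
    have h : Tendsto (fun z : ℂ => ((z⁻¹ : ℂ) : OnePoint ℂ)) (cocompact ℂ)
        (𝓝 ((0 : ℂ) : OnePoint ℂ)) :=
      (OnePoint.continuous_coe.tendsto 0).comp (tendsto_inv₀_cobounded.mono_left
        Metric.cobounded_eq_cocompact.ge)
    refine h.congr' ?_
    have h0 : ∀ᶠ z : ℂ in cocompact ℂ, z ≠ 0 :=
      (isCompact_singleton (x := (0 : ℂ))).compl_mem_cocompact
    filter_upwards [h0] with z hz
    exact (inv_coe hz).symm
  | coe z =>
    rw [OnePoint.continuousAt_coe]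
    by_cases hz : z = 0
    · subst hz
      have h : Tendsto (inv ∘ ((↑) : ℂ → OnePoint ℂ)) (𝓝[≠] 0) (𝓝 (∞ : OnePoint ℂ)) := by
        have h1 : Tendsto (fun z : ℂ => ((z⁻¹ : ℂ) : OnePoint ℂ)) (𝓝[≠] 0)
            (𝓝 (∞ : OnePoint ℂ)) := by
          refine OnePoint.tendsto_coe_infty.comp ?_
          rw [coclosedCompact_eq_cocompact, ← Metric.cobounded_eq_cocompact]
          exact tendsto_inv₀_nhdsNE_zero
        refine h1.congr' ?_
        filter_upwards [self_mem_nhdsWithin] with z hz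
        exact (inv_coe hz).symm
      rw [continuousAt_iff_punctured_nhds]
      simpa using h
    · have h : ContinuousAt (fun z : ℂ => ((z⁻¹ : ℂ) : OnePoint ℂ)) z :=
        OnePoint.continuous_coe.continuousAt.comp (continuousAt_inv₀ hz)
      refine h.congr ?_
      filter_upwards [isOpen_ne.mem_nhds hz] with w hw
      exact (inv_coe hw).symm

/-- The inversion as a homeomorphism. -/
noncomputable def invHomeo : OnePoint ℂ ≃ₜ OnePoint ℂ where
  toFun := inv
  invFun := inv
  left_inv := inv_inv
  right_inv := inv_inv
  continuous_toFun := continuous_inv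
  continuous_invFun := continuous_inv

/-- The affine coordinate `z` on `ℂ ⊆ ℂ ∪ {∞}`. -/
noncomputable def affineChart : OpenPartialHomeomorph (OnePoint ℂ) ℂ :=
  (OnePoint.isOpenEmbedding_coe.toOpenPartialHomeomorph ((↑) : ℂ → OnePoint ℂ)).symm

/-- The coordinate `1 / z` on `(ℂ ∪ {∞}) \ {0}`. -/
noncomputable def inftyChart : OpenPartialHomeomorph (OnePoint ℂ) ℂ :=
  invHomeo.toOpenPartialHomeomorph.trans affineChart

theorem affineChart_source : affineChart.source = Set.range ((↑) : ℂ → OnePoint ℂ) := by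
  simp [affineChart]

theorem affineChart_symm_apply (z : ℂ) : affineChart.symm z = (z : OnePoint ℂ) := rfl

theorem affineChart_coe (z : ℂ) : affineChart (z : OnePoint ℂ) = z :=
  affineChart.right_inv (x := z) (by simp [affineChart])

theorem inftyChart_source : inftyChart.source = {((0 : ℂ) : OnePoint ℂ)}ᶜ := by
  ext x
  simp only [inftyChart, OpenPartialHomeomorph.trans_source, affineChart_source]
  induction x using OnePoint.rec with
  | infty => simp [invHomeo]
  | coe z =>
    by_cases hz : z = 0
    · subst hz; simp [invHomeo]
    · simp [invHomeo, hz, inv_coe hz]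

/-- The Riemann sphere with its two standard charts: `z` around the finite points and `1 / z`
around `∞`. -/
noncomputable instance : ChartedSpace ℂ (OnePoint ℂ) where
  atlas := {affineChart, inftyChart}
  chartAt x := x.elim inftyChart (fun _ => affineChart)
  mem_chart_source x := by
    induction x using OnePoint.rec with
    | infty => simp [inftyChart_source]
    | coe z => simp [affineChart_source]
  chart_mem_atlas x := by
    induction x using OnePoint.rec with
    | infty => simp
    | coe z => simp

theorem contDiffOn_aux {f : ℂ → ℂ} {s : Set ℂ} (h : ∀ z ∈ s, z ≠ 0 ∧ f z = z⁻¹) :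
    ContDiffOn ℂ ω f s :=
  ContDiffOn.congr (f := fun z => z⁻¹)
    (fun z hz => (contDiffAt_inv ℂ (h z hz).1).contDiffWithinAt) (fun z hz => (h z hz).2)

instance : IsManifold 𝓘(ℂ) ω (OnePoint ℂ) := by
  refine isManifold_of_contDiffOn _ _ _ ?_
  have key : ∀ e : OpenPartialHomeomorph (OnePoint ℂ) ℂ,
      ContDiffOn ℂ ω (e.symm.trans e : ℂ → ℂ) (e.symm.trans e).source := fun e =>
    contDiffOn_id.congr fun z hz => by
      simp only [OpenPartialHomeomorph.trans_source, Set.mem_inter_iff,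
        OpenPartialHomeomorph.symm_source] at hz
      simp [e.right_inv hz.1]
  rintro e e' (rfl | rfl) (rfl | rfl)
  · simpa using key affineChart
  · simp only [modelWithCornersSelf_coe, modelWithCornersSelf_coe_symm, Function.comp_id,
      Function.id_comp, Set.range_id, Set.inter_univ, Set.preimage_id]
    refine contDiffOn_aux fun z hz => ?_
    simp only [OpenPartialHomeomorph.trans_source, Set.mem_inter_iff, Set.mem_preimage,
      affineChart_symm_apply, inftyChart_source] at hz
    have hz0 : z ≠ 0 := by simpa using hz.2
    refine ⟨hz0, ?_⟩
    simp [inftyChart, affineChart_symm_apply, invHomeo, inv_coe hz0, affineChart_coe]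
  · simp only [modelWithCornersSelf_coe, modelWithCornersSelf_coe_symm, Function.comp_id,
      Function.id_comp, Set.range_id, Set.inter_univ, Set.preimage_id]
    refine contDiffOn_aux fun z hz => ?_
    have hs : inftyChart.symm z = inv (z : OnePoint ℂ) := by
      simp [inftyChart, affineChart_symm_apply, invHomeo]
    simp only [OpenPartialHomeomorph.trans_source, Set.mem_inter_iff, Set.mem_preimage,
      hs, affineChart_source] at hz
    have hz0 : z ≠ 0 := by
      rintro rfl
      simpa using hz.2
    refine ⟨hz0, ?_⟩
    simp [hs, inv_coe hz0, affineChart_coe]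
  · simpa using key inftyChart

end RiemannSphere

/-- The complex-valued function `f` on the Riemann sphere is meromorphic at `a`, of order `m`
there (in a local coordinate). -/
def HasOrderAt (f : OnePoint ℂ → ℂ) (a : OnePoint ℂ) (m : ℤ) : Prop :=
  MeromorphicAt (f ∘ (chartAt ℂ a).symm) (chartAt ℂ a a) ∧
    meromorphicOrderAt (f ∘ (chartAt ℂ a).symm) (chartAt ℂ a a) = m

/-! ### Holomorphic vector bundles -/

/-- Holomorphic vector bundles of rank `n` over the Riemann sphere. -/
structure HolVectorBundle (n : ℕ) where
  /-- The fibres. -/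
  Fib : OnePoint ℂ → Type
  [addCommGroup : ∀ x, AddCommGroup (Fib x)]
  [module : ∀ x, Module ℂ (Fib x)]
  [topFib : ∀ x, TopologicalSpace (Fib x)]
  [topTotal : TopologicalSpace (TotalSpace (Fin n → ℂ) Fib)]
  [fiberBundle : FiberBundle (Fin n → ℂ) Fib]
  [vectorBundle : VectorBundle ℂ (Fin n → ℂ) Fib]
  [holomorphic : ContMDiffVectorBundle ω (Fin n → ℂ) Fib 𝓘(ℂ)]

attribute [instance] HolVectorBundle.addCommGroup HolVectorBundle.module
  HolVectorBundle.topFib HolVectorBundle.topTotal HolVectorBundle.fiberBundle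
  HolVectorBundle.vectorBundle HolVectorBundle.holomorphic

/-- The vector field `X` is holomorphic near `a`. -/
def HolVectorFieldAt (X : ∀ x : OnePoint ℂ, TangentSpace 𝓘(ℂ) x) (a : OnePoint ℂ) : Prop :=
  ContMDiffAt 𝓘(ℂ) 𝓘(ℂ).tangent ω
    (fun x => (⟨x, X x⟩ : TangentBundle 𝓘(ℂ) (OnePoint ℂ))) a

namespace HolVectorBundle

variable {n : ℕ} (E : HolVectorBundle n)

/-- The section `s` of `E` is holomorphic near `a`. -/
def HolAt (s : ∀ x, E.Fib x) (a : OnePoint ℂ) : Prop :=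
  ContMDiffAt 𝓘(ℂ) (𝓘(ℂ).prod 𝓘(ℂ, Fin n → ℂ)) ω (fun x => TotalSpace.mk' (Fin n → ℂ) x (s x)) a

/-- `s 0, …, s (r - 1)` is a holomorphic frame, near `a`, of the family of subspaces `N x` of the
fibres of `E`. -/
def IsFrameAt (N : ∀ x, Submodule ℂ (E.Fib x)) {r : ℕ} (s : Fin r → ∀ x, E.Fib x)
    (a : OnePoint ℂ) : Prop :=
  (∀ i, E.HolAt (s i) a) ∧
    ∀ᶠ x in 𝓝 a, LinearIndependent ℂ (fun i => s i x) ∧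
      Submodule.span ℂ (Set.range fun i => s i x) = N x

/-- The subspaces `N x` of the fibres form a holomorphic subbundle of rank `r`. -/
def IsSubbundle (N : ∀ x, Submodule ℂ (E.Fib x)) (r : ℕ) : Prop :=
  ∀ a, ∃ s : Fin r → ∀ x, E.Fib x, E.IsFrameAt N s a

/-- `E` as a subbundle of itself. -/
def full : ∀ x, Submodule ℂ (E.Fib x) := fun _ => ⊤

/-- The rank `r` subbundle `N` has degree `d`: the dual of its determinant line bundle has a
nonzero meromorphic section `w` whose divisor `m` has degree `-d`. (A section of the dual of
`Λʳ N` assigns to `x` an alternating `r`-form on `N x`; we write it as the restriction of an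
alternating form on the fibre of `E`, only its values on `N x` are used.) -/
def HasDegree (N : ∀ x, Submodule ℂ (E.Fib x)) (r : ℕ) (d : ℤ) : Prop :=
  ∃ (w : ∀ x, E.Fib x [⋀^Fin r]→ₗ[ℂ] ℂ) (m : OnePoint ℂ →₀ ℤ),
    (∀ (a : OnePoint ℂ) (s : Fin r → ∀ x, E.Fib x), E.IsFrameAt N s a →
      HasOrderAt (fun x => w x (fun i => s i x)) a (m a)) ∧
    d = -(m.sum fun _ k => k)

/-- The degree of the rank `r` subbundle `N`. -/
noncomputable def degree (N : ∀ x, Submodule ℂ (E.Fib x)) (r : ℕ) : ℤ :=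
  Classical.epsilon (E.HasDegree N r)

end HolVectorBundle

/-! ### Parabolic structures -/

/-- A parabolic structure at a point, as a weighted flag in the fibre `M`: `fil c` is the space of
values at the point of the germs of weight at least `c`. -/
structure ParabolicStructure (M : Type*) [AddCommGroup M] [Module ℂ M] where
  /-- The decreasing filtration. -/
  fil : ℝ → Submodule ℂ M
  antitone : Antitone fil
  left_cont : ∀ c, ∃ e > 0, fil (c - e) = fil c
  fil_zero : fil 0 = ⊤
  fil_one : fil 1 = ⊥

namespace ParabolicStructure

variable {M : Type*} [AddCommGroup M] [Module ℂ M] (P : ParabolicStructure M)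

/-- The part of the filtration of weights greater than `c` (a directed union). -/
def filGT (c : ℝ) : Submodule ℂ M := ⨆ b : Set.Ioi c, P.fil b

/-- The multiplicity of the weight `c`, i.e. the dimension of the jump of the filtration at `c`. -/
noncomputable def mult (c : ℝ) : ℕ := finrank ℂ (P.fil c) - finrank ℂ (P.filGT c)

/-- The sum of the weights, counted with multiplicity. -/
noncomputable def weight : ℝ := ∑ᶠ c : ℝ, (P.mult c : ℝ) * c

/-- The parabolic type: the weights in increasing order, repeated according to multiplicity. -/
def HasType {n : ℕ} (α : Fin n → ℝ) : Prop :=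
  Monotone α ∧ ∀ c, P.mult c = (Finset.univ.filter fun i => α i = c).card

/-- The structure induced on a subspace. -/
def induced (N : Submodule ℂ M) : ParabolicStructure N where
  fil c := (P.fil c).comap N.subtype
  antitone _ _ h := Submodule.comap_mono (P.antitone h)
  left_cont c := by
    obtain ⟨e, he, h⟩ := P.left_cont c
    exact ⟨e, he, by rw [h]⟩
  fil_zero := by rw [P.fil_zero, Submodule.comap_top]
  fil_one := by rw [P.fil_one, Submodule.comap_bot, Submodule.ker_subtype]

end ParabolicStructure

/-- Parabolic bundles of rank `n` over the Riemann sphere punctured at the points `x j`. -/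
structure ParabolicBundle {s : ℕ} (x : Fin s → OnePoint ℂ) (n : ℕ) extends HolVectorBundle n where
  /-- The parabolic structure at the `j`-th puncture. -/
  par : ∀ j, ParabolicStructure (Fib (x j))

namespace ParabolicBundle

variable {s : ℕ} {x : Fin s → OnePoint ℂ} {m n : ℕ}

/-- The parabolic degree. -/
noncomputable def parDegree (E : ParabolicBundle x n) : ℝ :=
  E.degree E.full n + ∑ j, (E.par j).weight

/-- The parabolic degree of a rank `r` subbundle `N` with the induced parabolic structure. -/
noncomputable def parDegreeSub (E : ParabolicBundle x n) (N : ∀ y, Submodule ℂ (E.Fib y)) (r : ℕ) :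
    ℝ :=
  E.degree N r + ∑ j, ((E.par j).induced (N (x j))).weight

/-- Holomorphic sections of `K(D) ⊗ Hom(E, F)`, for parabolic bundles `E` and `F` and
(strongly) parabolic homomorphisms. Such a section is a holomorphic one-form
on the complement of the punctures with values in `Hom(E, F)`, i.e. it contracts with a
holomorphic vector field and a holomorphic section of `E` to a holomorphic section of `F`, such that
at a puncture, the contraction with a vector field that vanishes there extends holomorphically
(simple pole) and the value of the extension obeys the condition on the weights.
The value of `toFun` at a puncture is immaterial. -/
structure HiggsHom (E : ParabolicBundle x m) (F : ParabolicBundle x n) where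
  /-- The value of the one-form at a point. -/
  toFun : ∀ y, TangentSpace 𝓘(ℂ) y →ₗ[ℂ] E.Fib y →ₗ[ℂ] F.Fib y
  holomorphic : ∀ a ∉ Set.range x, ∀ X, HolVectorFieldAt X a → ∀ u, E.HolAt u a →
    F.HolAt (fun y => toFun y (X y) (u y)) a
  parabolic : ∀ j, ∀ X, HolVectorFieldAt X (x j) → X (x j) = 0 → ∀ u, E.HolAt u (x j) →
    ∃ v, F.HolAt v (x j) ∧ (∀ᶠ y in 𝓝[≠] x j, v y = toFun y (X y) (u y)) ∧
      ∀ c, u (x j) ∈ (E.par j).fil c → v (x j) ∈ (F.par j).filGT c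

/-- `det U ⊗ det V` is, as a parabolic line bundle, isomorphic to the trivial line bundle with
trivial parabolic structure: at each puncture the sum `k j` of all weights is an
integer, and the dual of `det U ⊗ det V` has a meromorphic section with divisor `∑ k j • x j`,
i.e. `det U ⊗ det V` twisted by that divisor is trivial. -/
def TrivialDet (U : ParabolicBundle x m) (V : ParabolicBundle x n) : Prop :=
  ∃ k : Fin s → ℤ, (∀ j, (k j : ℝ) = (U.par j).weight + (V.par j).weight) ∧
    ∃ w : ∀ y, U.Fib y [⋀^Fin m]→ₗ[ℂ] (V.Fib y [⋀^Fin n]→ₗ[ℂ] ℂ),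
      ∀ (a : OnePoint ℂ) (u : Fin m → ∀ y, U.Fib y) (v : Fin n → ∀ y, V.Fib y),
        U.IsFrameAt U.full u a → V.IsFrameAt V.full v a →
        HasOrderAt (fun y => w y (fun i => u i y) (fun i => v i y)) a
          (∑ j, Finsupp.single (x j) (k j) a)

end ParabolicBundle

/-! ### Parabolic `SU(p,q)` Higgs bundles -/

/-- Parabolic `SU(p,q)` Higgs bundles `(U ⊕ V, γ ⊕ δ)` over the Riemann sphere punctured at the
points `x j`. -/
structure SUHiggsBundle {s : ℕ} (x : Fin s → OnePoint ℂ) (p q : ℕ) where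
  U : ParabolicBundle x p
  V : ParabolicBundle x q
  γ : ParabolicBundle.HiggsHom U V
  δ : ParabolicBundle.HiggsHom V U
  trivialDet : ParabolicBundle.TrivialDet U V

namespace SUHiggsBundle

variable {s : ℕ} {x : Fin s → OnePoint ℂ} {p q : ℕ}

/-- The pair of subbundles `U'` of `U` and `V'` of `V` is invariant under the Higgs field. -/
def Invariant (H : SUHiggsBundle x p q) (U' : ∀ y, Submodule ℂ (H.U.Fib y))
    (V' : ∀ y, Submodule ℂ (H.V.Fib y)) : Prop :=
  ∀ y ∉ Set.range x, ∀ X : TangentSpace 𝓘(ℂ) y,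
    (∀ u ∈ U' y, H.γ.toFun y X u ∈ V' y) ∧ (∀ v ∈ V' y, H.δ.toFun y X v ∈ U' y)

/-- Semistability: invariant subbundles `U' ⊕ V'` have nonpositive parabolic degree. -/
def Semistable (H : SUHiggsBundle x p q) : Prop :=
  ∀ (U' : ∀ y, Submodule ℂ (H.U.Fib y)) (V' : ∀ y, Submodule ℂ (H.V.Fib y)) (r t : ℕ),
    H.U.IsSubbundle U' r → H.V.IsSubbundle V' t → H.Invariant U' V' →
    H.U.parDegreeSub U' r + H.V.parDegreeSub V' t ≤ 0

/-- `H` has parabolic type `(α, β)`. -/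
def HasType (H : SUHiggsBundle x p q) (α : Fin s → Fin p → ℝ) (β : Fin s → Fin q → ℝ) : Prop :=
  ∀ j, (H.U.par j).HasType (α j) ∧ (H.V.par j).HasType (β j)

end SUHiggsBundle

/-- `SU(p,q)`-multiweights. -/
structure IsMultiweight {s p q : ℕ} (α : Fin s → Fin p → ℝ) (β : Fin s → Fin q → ℝ) : Prop where
  monotone_left : ∀ j, Monotone (α j)
  monotone_right : ∀ j, Monotone (β j)
  mem_left : ∀ j i, α j i ∈ Set.Ico (0 : ℝ) 1
  mem_right : ∀ j i, β j i ∈ Set.Ico (0 : ℝ) 1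
  integral : ∀ j, ∃ k : ℕ, ∑ i, α j i + ∑ i, β j i = k

/-!
Suppose that `δ` does not vanish, and let `N ⊆ V` be the saturated kernel and `I ⊆ U` the saturated
image of `δ`, the latter of rank `r ≥ 1`. The pairs `(0, N)` and `(I, V)` are invariant, so
`pardeg N ≤ 0` and `pardeg I + pardeg V ≤ 0`. The residue of `δ` at a puncture maps the whole fibre
of `V` into the part of the fibre of `U` of weight greater than `β₁`, which is zero as `α_p ≤ β₁`;
hence `δ` has no poles, and its determinant `det (V / N) → det I ⊗ Kʳ` gives
`deg V - deg N ≤ deg I - 2r`. Bounding the weights of `V / N` by `β_q` and those of `I` by `α₁`, one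
gets `2 pardeg V ≤ -r (2 - ε)`. As `pardeg U + pardeg V = 0`, this says that
`pardeg U - pardeg V ≥ r (2 - ε) ≥ 2 - ε`.

That all subbundles have a degree means that every holomorphic line bundle on the sphere has a
meromorphic section. One is constructed by Cauchy's splitting of a holomorphic function on an
overlap into a difference: first for overlapping rectangles, which trivializes the bundle over
large squares, then for the annulus between the two standard charts. That the degree is unique
means that the orders of a meromorphic function add up to zero.
-/

/-! ### Splitting holomorphic functions across a segment -/

section Splitting

open Complex Set MeasureTheory

theorem exists_forall_mem_ball_le_norm_sub {K : Set ℂ} (hK : IsCompact K) {z : ℂ} (hz : z ∉ K) :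
    ∃ e > 0, ∀ k ∈ K, ∀ w ∈ Metric.ball z e, e ≤ ‖k - w‖ := by
  obtain ⟨e, he, hball⟩ := Metric.isOpen_iff.1 hK.isClosed.isOpen_compl z hz
  refine ⟨e / 2, half_pos he, fun k hk w hw => ?_⟩
  have hkz : e ≤ dist k z := not_lt.1 fun h => hball h hk
  rw [← dist_eq_norm]
  linarith [dist_triangle k w z, Metric.mem_ball.1 hw]

theorem differentiableAt_intervalIntegral_div_sub {φ γ : ℝ → ℂ} {a b : ℝ}
    (hφ : ContinuousOn φ (uIcc a b)) (hγ : ContinuousOn γ (uIcc a b)) {z : ℂ}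
    (hz : ∀ t ∈ uIcc a b, γ t ≠ z) :
    DifferentiableAt ℂ (fun w => ∫ t in a..b, φ t / (γ t - w)) z := by
  obtain ⟨e, he, hfar⟩ := exists_forall_mem_ball_le_norm_sub
    (isCompact_uIcc.image_of_continuousOn hγ) (z := z) (by rintro ⟨t, ht, h⟩; exact hz t ht h)
  have hlow : ∀ t ∈ uIcc a b, ∀ w ∈ Metric.ball z e, e ≤ ‖γ t - w‖ :=
    fun t ht w hw => hfar _ (mem_image_of_mem γ ht) w hw
  have hne : ∀ t ∈ uIcc a b, ∀ w ∈ Metric.ball z e, γ t - w ≠ 0 :=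
    fun t ht w hw => norm_pos_iff.1 (he.trans_le (hlow t ht w hw))
  obtain ⟨M, hM⟩ := isCompact_uIcc.exists_bound_of_continuousOn hφ
  have hint : ∀ n : ℕ, ∀ w ∈ Metric.ball z e,
      IntervalIntegrable (fun t => φ t / (γ t - w) ^ n) volume a b := fun n w hw =>
    ContinuousOn.intervalIntegrable <| hφ.div ((hγ.sub continuousOn_const).pow n)
      fun t ht => pow_ne_zero n (hne t ht w hw)
  have hint₁ : ∀ w ∈ Metric.ball z e,
      IntervalIntegrable (fun t => φ t / (γ t - w)) volume a b := by
    simpa only [pow_one] using hint 1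
  have hzb : z ∈ Metric.ball z e := Metric.mem_ball_self he
  refine (intervalIntegral.hasDerivAt_integral_of_dominated_loc_of_deriv_le
    (F' := fun w t => φ t / (γ t - w) ^ 2) (bound := fun _ => M / e ^ 2)
    (Metric.ball_mem_nhds z he) ?_ (hint₁ z hzb)
    (hint 2 z hzb).aestronglyMeasurable_restrict_uIoc ?_ intervalIntegrable_const
    ?_).2.differentiableAt
  · filter_upwards [Metric.ball_mem_nhds z he] with w hw
    exact (hint₁ w hw).aestronglyMeasurable_restrict_uIoc
  · refine Eventually.of_forall fun t ht w hw => ?_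
    have hφt := hM t (uIoc_subset_uIcc ht)
    have := hlow t (uIoc_subset_uIcc ht) w hw
    have : 0 ≤ M := (norm_nonneg _).trans hφt
    rw [norm_div, norm_pow]
    gcongr
  · refine Eventually.of_forall fun t ht w hw => ?_
    have h := ((hasDerivAt_id w).const_sub (γ t)).inv (hne t (uIoc_subset_uIcc ht) w hw)
    exact (h.const_mul (φ t)).congr_deriv (by simp [div_eq_mul_inv])

theorem log_mul_neg_I_of_pos {w : ℂ} (hre : 0 < w.re) (him : 0 < w.im) :
    log (w * -I) = log w - Real.pi / 2 * I := by
  have hw : w ≠ 0 := fun h => by simp [h] at hre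
  have harg : 0 ≤ arg w := arg_nonneg_iff.2 him.le
  have harg' : arg w ≠ 0 := fun h => him.ne' (arg_eq_zero_iff.1 h).2
  have := (log_mul_eq_add_log_iff hw (neg_ne_zero.2 I_ne_zero)).2 (by
    rw [arg_neg_I]
    constructor <;> linarith [Real.pi_pos, arg_le_pi w, harg.lt_of_ne' harg'])
  rw [this, log_neg_I]
  ring

/-- The factor `k` rotates the segment into the domain of the principal branch of `log`. -/
theorem integral_inv_line {k z : ℂ} (d p : ℂ) {a b : ℝ} (hk : k ≠ 0)
    (h : ∀ t ∈ uIcc a b, (p + t * d - z) * k ∈ slitPlane) :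
    d * ∫ t in a..b, 1 / (p + t * d - z) =
      log ((p + b * d - z) * k) - log ((p + a * d - z) * k) := by
  have hderiv : ∀ t ∈ uIcc a b, HasDerivAt (fun t : ℝ => log ((p + t * d - z) * k))
      (d / (p + t * d - z)) t := fun t ht => by
    have hline := (((ofRealCLM.hasDerivAt (x := t)).mul_const d).const_add p).sub_const z
    refine ((hline.mul_const k).clog_real (h t ht)).congr_deriv ?_
    simp [mul_div_mul_right _ _ hk]
  rw [← intervalIntegral.integral_eq_sub_of_hasDerivAt hderiv,
    ← intervalIntegral.integral_const_mul]
  · simp only [mul_one_div]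
  · refine (continuousOn_const.div (by fun_prop) fun t ht h0 => ?_).intervalIntegrable
    exact slitPlane_ne_zero (h t ht) (by rw [h0, zero_mul])

theorem wedgeIntegral_inv_sub_add_swap {z ζ w : ℂ} (hz : z.re < ζ.re ∧ z.im < ζ.im)
    (hw : ζ.re < w.re ∧ ζ.im < w.im) :
    wedgeIntegral z w (fun v => 1 / (v - ζ)) + wedgeIntegral w z (fun v => 1 / (v - ζ)) =
      2 * Real.pi * I := by
  obtain ⟨⟨_, _⟩, _, _⟩ := And.intro hz hw
  have bottom := integral_inv_line (k := I) (z := ζ) (a := z.re) (b := w.re) 1 (z.im * I) I_ne_zero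
    (fun t _ => by rw [mem_slitPlane_iff]; left; simp; linarith)
  have top := integral_inv_line (k := -I) (z := ζ) (a := w.re) (b := z.re) 1 (w.im * I)
    (neg_ne_zero.2 I_ne_zero) (fun t _ => by rw [mem_slitPlane_iff]; left; simp; linarith)
  have right := integral_inv_line (k := 1) (z := ζ) (a := z.im) (b := w.im) I w.re one_ne_zero
    (fun t _ => by rw [mem_slitPlane_iff]; left; simp; linarith)
  have left := integral_inv_line (k := -1) (z := ζ) (a := w.im) (b := z.im) I z.re
    (neg_ne_zero.2 one_ne_zero) (fun t _ => by rw [mem_slitPlane_iff]; left; simp; linarith)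
  -- the branches used on consecutive sides differ by `π / 2 * I` at their common corner
  have topRight := log_mul_neg_I_of_pos (w := w.re + w.im * I - ζ) (by simp; linarith)
    (by simp; linarith)
  have topLeft := log_mul_neg_I_of_pos (w := (z.re + w.im * I - ζ) * -I) (by simp; linarith)
    (by simp; linarith)
  have bottomLeft := log_mul_neg_I_of_pos (w := (z.re + z.im * I - ζ) * -1) (by simp; linarith)
    (by simp; linarith)
  have bottomRight := log_mul_neg_I_of_pos (w := (w.re + z.im * I - ζ) * I) (by simp; linarith)
    (by simp; linarith)
  simp only [mul_assoc, mul_neg, neg_mul, I_mul_I, mul_one, one_mul, neg_neg,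
    add_comm (_ * I) (ofReal _)] at bottom top right left topRight topLeft bottomLeft bottomRight
  simp only [wedgeIntegral, smul_eq_mul]
  linear_combination bottom + top + right + left - topRight - topLeft - bottomLeft - bottomRight

theorem wedgeIntegral_div_sub_eq_add {f : ℂ → ℂ} {z w ζ : ℂ}
    (hf : ContinuousOn (dslope f ζ) (Rectangle z w)) (hz : ζ.im ≠ z.im) (hw : ζ.re ≠ w.re) :
    wedgeIntegral z w (fun v => f v / (v - ζ)) =
      wedgeIntegral z w (dslope f ζ) + f ζ * wedgeIntegral z w (fun v => 1 / (v - ζ)) := by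
  have side : ∀ γ : ℝ → ℂ, Continuous γ → ∀ a b : ℝ, MapsTo γ (uIcc a b) (Rectangle z w) →
      (∀ t ∈ uIcc a b, γ t ≠ ζ) →
      (∫ t in a..b, f (γ t) / (γ t - ζ)) =
        (∫ t in a..b, dslope f ζ (γ t)) + f ζ * ∫ t in a..b, 1 / (γ t - ζ) := by
    intro γ hγ a b hmem hne
    have hne' : ∀ t ∈ uIcc a b, γ t - ζ ≠ 0 := fun t ht => sub_ne_zero.2 (hne t ht)
    have hdslope : IntervalIntegrable (fun t => dslope f ζ (γ t)) volume a b :=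
      (hf.comp hγ.continuousOn hmem).intervalIntegrable
    have hinv : IntervalIntegrable (fun t => f ζ * (1 / (γ t - ζ))) volume a b :=
      (continuousOn_const.mul (continuousOn_const.div (by fun_prop) hne')).intervalIntegrable
    rw [← intervalIntegral.integral_const_mul, ← intervalIntegral.integral_add hdslope hinv]
    refine intervalIntegral.integral_congr fun t ht => ?_
    have := hne' t ht
    simp only [dslope_of_ne _ (hne t ht), slope_def_field]
    field_simp
    ring
  have bottom := side (fun x => x + z.im * I) (by fun_prop) z.re w.re
    (fun t ht => by simpa [Rectangle, mem_reProdIm] using ht) (fun t _ h => by simp [← h] at hz)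
  have right := side (fun y => w.re + y * I) (by fun_prop) z.im w.im
    (fun t ht => by simpa [Rectangle, mem_reProdIm] using ht) (fun t _ h => by simp [← h] at hw)
  simp only [wedgeIntegral, smul_eq_mul]
  linear_combination bottom + I * right

theorem wedgeIntegral_div_sub_add_swap {f : ℂ → ℂ} {O : Set ℂ} (hO : IsOpen O)
    (hf : DifferentiableOn ℂ f O) {z w ζ : ℂ} (hsub : Rectangle z w ⊆ O)
    (hz : z.re < ζ.re ∧ z.im < ζ.im) (hw : ζ.re < w.re ∧ ζ.im < w.im) :
    wedgeIntegral z w (fun v => f v / (v - ζ)) + wedgeIntegral w z (fun v => f v / (v - ζ)) =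
      2 * Real.pi * I * f ζ := by
  have hζO : ζ ∈ O := hsub (by
    rw [Rectangle, mem_reProdIm, uIcc_of_le (hz.1.trans hw.1).le, uIcc_of_le (hz.2.trans hw.2).le]
    exact ⟨⟨hz.1.le, hw.1.le⟩, hz.2.le, hw.2.le⟩)
  have hds : DifferentiableOn ℂ (dslope f ζ) O :=
    (differentiableOn_dslope (hO.mem_nhds hζO)).2 hf
  have hcont : ContinuousOn (dslope f ζ) (Rectangle z w) := hds.continuousOn.mono hsub
  have hzero : wedgeIntegral z w (dslope f ζ) = -wedgeIntegral w z (dslope f ζ) :=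
    hds.isConservativeOn z w hsub
  rw [wedgeIntegral_div_sub_eq_add hcont hz.2.ne' hw.1.ne,
    wedgeIntegral_div_sub_eq_add (by rwa [Rectangle, uIcc_comm, uIcc_comm w.im]) hw.2.ne hz.1.ne']
  linear_combination hzero + f ζ * wedgeIntegral_inv_sub_add_swap hz hw

theorem differentiableAt_wedgeIntegral_div_sub {f : ℂ → ℂ} {z w ζ : ℂ}
    (hf : ContinuousOn f (Rectangle z w)) (hz : ζ.im ≠ z.im) (hw : ζ.re ≠ w.re) :
    DifferentiableAt ℂ (fun ζ => wedgeIntegral z w fun v => f v / (v - ζ)) ζ := by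
  refine (differentiableAt_intervalIntegral_div_sub ?_ (by fun_prop)
    (fun t _ h => by simp [← h] at hz)).add
    ((differentiableAt_intervalIntegral_div_sub ?_ (by fun_prop)
      fun t _ h => by simp [← h] at hw).const_smul I) <;>
  exact hf.comp (by fun_prop) fun t ht => by simpa [Rectangle, mem_reProdIm] using ht

theorem exists_add_split_rect {f : ℂ → ℂ} {O : Set ℂ} (hO : IsOpen O)
    (hf : DifferentiableOn ℂ f O) {z w : ℂ} (hsub : Rectangle z w ⊆ O) :
    ∃ f₁ f₂ : ℂ → ℂ, DifferentiableOn ℂ f₁ (Iio w.re ×ℂ Ioo z.im w.im) ∧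
      DifferentiableOn ℂ f₂ (Ioi z.re ×ℂ Ioo z.im w.im) ∧
      ∀ ζ ∈ Ioo z.re w.re ×ℂ Ioo z.im w.im, f ζ = f₁ ζ + f₂ ζ := by
  have hzw : ContinuousOn f (Rectangle z w) := hf.continuousOn.mono hsub
  have hwz : ContinuousOn f (Rectangle w z) := by rwa [Rectangle, uIcc_comm, uIcc_comm w.im]
  refine ⟨fun ζ => (2 * Real.pi * I)⁻¹ * wedgeIntegral z w fun v => f v / (v - ζ),
    fun ζ => (2 * Real.pi * I)⁻¹ * wedgeIntegral w z fun v => f v / (v - ζ),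
    fun ζ hζ => ?_, fun ζ hζ => ?_, fun ζ hζ => ?_⟩
  · exact ((differentiableAt_wedgeIntegral_div_sub hzw hζ.2.1.ne'
      (ne_of_lt hζ.1)).const_mul _).differentiableWithinAt
  · exact ((differentiableAt_wedgeIntegral_div_sub hwz hζ.2.2.ne
      (ne_of_gt hζ.1)).const_mul _).differentiableWithinAt
  · have hpi : (2 * Real.pi * I : ℂ) ≠ 0 := two_pi_I_ne_zero
    rw [← mul_add, eq_inv_mul_iff_mul_eq₀ hpi, ← wedgeIntegral_div_sub_add_swap hO hf hsub
      ⟨hζ.1.1, hζ.2.1⟩ ⟨hζ.1.2, hζ.2.2⟩]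

theorem exists_exp_eq_of_convex {O : Set ℂ} (hO : IsOpen O) (hconv : Convex ℝ O) {g : ℂ → ℂ}
    (hg : DifferentiableOn ℂ g O) (hg0 : ∀ z ∈ O, g z ≠ 0) :
    ∃ h : ℂ → ℂ, DifferentiableOn ℂ h O ∧ ∀ z ∈ O, g z = exp (h z) := by
  rcases O.eq_empty_or_nonempty with rfl | ⟨z₀, hz₀⟩
  · exact ⟨0, by simp, by simp⟩
  obtain ⟨h, hh⟩ := hconv.exists_forall_hasDerivWithinAt ((hg.deriv hO).div hg hg0)
  have hlog : ∀ z ∈ O, HasDerivAt h (deriv g z / g z) z := fun z hz =>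
    (hh z hz).hasDerivAt (hO.mem_nhds hz)
  have hquot : ∀ z ∈ O, HasDerivAt (fun z => g z * exp (-h z)) 0 z := fun z hz => by
    have hgz := (hg.differentiableAt (hO.mem_nhds hz)).hasDerivAt
    refine (hgz.mul (hlog z hz).neg.cexp).congr_deriv ?_
    have := hg0 z hz
    field_simp
    ring
  have hconst : ∀ z ∈ O, g z * exp (-h z) = g z₀ * exp (-h z₀) := fun z hz =>
    hO.is_const_of_deriv_eq_zero hconv.isPreconnected
      (fun w hw => (hquot w hw).differentiableAt.differentiableWithinAt)
      (fun w hw => (hquot w hw).deriv) hz hz₀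
  refine ⟨fun z => h z + (log (g z₀) - h z₀), fun z hz =>
    ((hlog z hz).differentiableAt.add_const _).differentiableWithinAt, fun z hz => ?_⟩
  rw [exp_add, sub_eq_add_neg, exp_add, exp_log (hg0 _ hz₀), ← hconst z hz, exp_neg]
  field_simp [exp_ne_zero (h z)]

theorem convex_reProdIm {s t : Set ℝ} (hs : Convex ℝ s) (ht : Convex ℝ t) : Convex ℝ (s ×ℂ t) :=
  (hs.linear_preimage reLm).inter (ht.linear_preimage imLm)

theorem exists_mul_split_rect {g : ℂ → ℂ} {O : Set ℂ} (hO : IsOpen O) (hconv : Convex ℝ O)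
    (hg : DifferentiableOn ℂ g O) (hg0 : ∀ z ∈ O, g z ≠ 0) {z w : ℂ} (hsub : Rectangle z w ⊆ O) :
    ∃ g₁ g₂ : ℂ → ℂ, DifferentiableOn ℂ g₁ (Iio w.re ×ℂ Ioo z.im w.im) ∧ (∀ ζ, g₁ ζ ≠ 0) ∧
      DifferentiableOn ℂ g₂ (Ioi z.re ×ℂ Ioo z.im w.im) ∧ (∀ ζ, g₂ ζ ≠ 0) ∧
      ∀ ζ ∈ Ioo z.re w.re ×ℂ Ioo z.im w.im, g ζ = g₁ ζ * g₂ ζ := by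
  obtain ⟨h, hh, hgh⟩ := exists_exp_eq_of_convex hO hconv hg hg0
  obtain ⟨f₁, f₂, h₁, h₂, hf⟩ := exists_add_split_rect hO hh hsub
  refine ⟨fun ζ => exp (f₁ ζ), fun ζ => exp (f₂ ζ), h₁.cexp, fun _ => exp_ne_zero _, h₂.cexp,
    fun _ => exp_ne_zero _, fun ζ hζ => ?_⟩
  have hζO : ζ ∈ O := hsub
    ⟨Icc_subset_uIcc (Ioo_subset_Icc_self hζ.1), Icc_subset_uIcc (Ioo_subset_Icc_self hζ.2)⟩
  rw [← exp_add, ← hf ζ hζ, hgh ζ hζO]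

end Splitting

/-! ### Global frames over rectangles -/

section Rectangles

open Complex Set

theorem rel_of_trans_of_local {R : ℝ → ℝ → Prop}
    (htrans : ∀ a b c, a ≤ b → b ≤ c → R a b → R b c → R a c)
    (hloc : ∀ t, ∃ e > 0, ∀ a b, t - e < a → a ≤ b → b < t + e → R a b) {a b : ℝ}
    (hab : a ≤ b) : R a b := by
  set S := {t | t ∈ Icc a b ∧ R a t}
  have haS : a ∈ S := by
    obtain ⟨e, he, h⟩ := hloc a
    exact ⟨⟨le_rfl, hab⟩, h a a (by linarith) le_rfl (by linarith)⟩
  have hbdd : BddAbove S := ⟨b, fun t ht => ht.1.2⟩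
  obtain ⟨e, he, h⟩ := hloc (sSup S)
  obtain ⟨t, ht, hlt⟩ := exists_lt_of_lt_csSup ⟨a, haS⟩ (show sSup S - e < sSup S by linarith)
  have htsup : t ≤ sSup S := le_csSup hbdd ht
  set u := min b (sSup S + e / 2)
  have htu : t ≤ u := le_min ht.1.2 (by linarith)
  have hRu : R a u := htrans _ _ _ ht.1.1 htu ht.2
    (h _ _ hlt htu ((min_le_right _ _).trans_lt (by linarith)))
  have huS : u ≤ sSup S := le_csSup hbdd ⟨⟨ht.1.1.trans htu, min_le_left _ _⟩, hRu⟩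
  rcases min_choice b (sSup S + e / 2) with hu | hu
  · rwa [← hu]
  · linarith [hu.symm.le.trans huS]

theorem Ioo_reProdIm_Ioo_subset {a b c d a' b' c' d' : ℝ} (ha : a' ≤ a) (hb : b ≤ b')
    (hc : c' ≤ c) (hd : d ≤ d') : Ioo a b ×ℂ Ioo c d ⊆ Ioo a' b' ×ℂ Ioo c' d' :=
  reProdIm_subset_iff.2 (prod_mono (Ioo_subset_Ioo ha hb) (Ioo_subset_Ioo hc hd))

/-- A class of local functions on the plane, given by a condition on germs, that is a torsor under
the multiplication by nowhere vanishing holomorphic functions: the local frames of a holomorphic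
line bundle, read in a coordinate in which frames of different charts can be compared. -/
structure IsFrameClass (Q : ℂ → (ℂ → ℂ) → Prop) : Prop where
  exists_local : ∀ z, ∃ f, ∀ᶠ w in 𝓝 z, Q w f
  div : ∀ {w f₁ f₂}, Q w f₁ → Q w f₂ → AnalyticAt ℂ (fun z => f₁ z / f₂ z) w ∧ f₁ w / f₂ w ≠ 0
  mul : ∀ {w f g}, Q w f → AnalyticAt ℂ g w → g w ≠ 0 → Q w (fun z => g z * f z)
  congr : ∀ {w f₁ f₂}, Q w f₁ → f₁ =ᶠ[𝓝 w] f₂ → Q w f₂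

namespace IsFrameClass

variable {Q : ℂ → (ℂ → ℂ) → Prop}

theorem glue (hQ : IsFrameClass Q) {O₁ O₂ : Set ℂ} (h₁ : IsOpen O₁) (h₂ : IsOpen O₂)
    {f₁ f₂ g₁ g₂ : ℂ → ℂ} (hf₁ : ∀ z ∈ O₁, Q z f₁) (hf₂ : ∀ z ∈ O₂, Q z f₂)
    (hg₁ : DifferentiableOn ℂ g₁ O₁) (hg₁' : ∀ z, g₁ z ≠ 0)
    (hg₂ : DifferentiableOn ℂ g₂ O₂) (hg₂' : ∀ z, g₂ z ≠ 0)
    (hg : ∀ z ∈ O₁ ∩ O₂, f₁ z / f₂ z = g₁ z * g₂ z) :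
    ∃ f, ∀ z ∈ O₁ ∪ O₂, Q z f := by
  classical
  refine ⟨O₁.piecewise (fun z => (g₁ z)⁻¹ * f₁ z) (fun z => g₂ z * f₂ z), fun z hz => ?_⟩
  by_cases hz₁ : z ∈ O₁
  · refine hQ.congr (hQ.mul (hf₁ z hz₁) ((hg₁.analyticAt (h₁.mem_nhds hz₁)).fun_inv (hg₁' z))
      (inv_ne_zero (hg₁' z))) ?_
    filter_upwards [h₁.mem_nhds hz₁] with w hw
    simp [hw]
  · have hz₂ : z ∈ O₂ := hz.resolve_left hz₁
    refine hQ.congr (hQ.mul (hf₂ z hz₂) (hg₂.analyticAt (h₂.mem_nhds hz₂)) (hg₂' z)) ?_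
    filter_upwards [h₂.mem_nhds hz₂] with w hw
    by_cases hw₁ : w ∈ O₁
    · have hf₂w : f₂ w ≠ 0 := fun h => (hQ.div (hf₁ w hw₁) (hf₂ w hw)).2 (by simp [h])
      rw [piecewise_eq_of_mem _ _ _ hw₁, (div_eq_iff hf₂w).1 (hg w ⟨hw₁, hw⟩), mul_assoc,
        inv_mul_cancel_left₀ (hg₁' w)]
    · simp [hw₁]

theorem rotate (hQ : IsFrameClass Q) :
    IsFrameClass fun w f => Q (I * w) fun z => f (-I * z) where
  exists_local z := by
    obtain ⟨f, hf⟩ := hQ.exists_local (I * z)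
    refine ⟨fun w => f (I * w), ?_⟩
    filter_upwards [(by fun_prop : Continuous fun w => I * w).tendsto z hf] with w hw
    simpa [← mul_assoc] using hw
  div {w f₁ f₂} h₁ h₂ := by
    obtain ⟨han, hne⟩ := hQ.div h₁ h₂
    have := han.fun_comp_of_eq (f := fun z => I * z) (by fun_prop) rfl
    simp only [← mul_assoc, neg_mul, I_mul_I, neg_neg, one_mul] at this hne
    exact ⟨this, hne⟩
  mul {w f g} hf hg hg0 := by
    have hw : -I * (I * w) = w := by simp [← mul_assoc]
    exact hQ.mul hf (hg.fun_comp_of_eq (by fun_prop) hw) (by rwa [hw])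
  congr {w f₁ f₂} h h12 := hQ.congr h <| by
    have hcont : Tendsto (fun z => -I * z) (𝓝 (I * w)) (𝓝 w) :=
      Continuous.tendsto' (by fun_prop) _ _ (by simp [← mul_assoc])
    exact hcont.eventually h12

/-- There is a frame near the closed rectangle `[a, b] × [c, d]`. -/
def GoodRect (Q : ℂ → (ℂ → ℂ) → Prop) (a b c d : ℝ) : Prop :=
  ∃ f, ∃ e > 0, ∀ z ∈ Ioo (a - e) (b + e) ×ℂ Ioo (c - e) (d + e), Q z f

theorem GoodRect.mono {a b c d a' b' c' d' : ℝ} (h : GoodRect Q a b c d) (ha : a ≤ a')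
    (hb : b' ≤ b) (hc : c ≤ c') (hd : d' ≤ d) : GoodRect Q a' b' c' d' := by
  obtain ⟨f, e, he, h⟩ := h
  exact ⟨f, e, he, fun z hz => h z (Ioo_reProdIm_Ioo_subset (by gcongr) (by gcongr) (by gcongr)
    (by gcongr) hz)⟩

theorem goodRect_rotate_iff {a b c d : ℝ} :
    GoodRect (fun w f => Q (I * w) fun z => f (-I * z)) c d (-b) (-a) ↔ GoodRect Q a b c d := by
  constructor
  · rintro ⟨f, e, he, h⟩
    refine ⟨fun z => f (-I * z), e, he, fun z hz => ?_⟩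
    simpa [← mul_assoc] using h (-I * z) (by
      simp only [mem_reProdIm, mem_Ioo, mul_re, mul_im, neg_re, neg_im, I_re, I_im] at hz ⊢
      constructor <;> constructor <;> linarith [hz.1.1, hz.1.2, hz.2.1, hz.2.2])
  · rintro ⟨f, e, he, h⟩
    refine ⟨fun z => f (I * z), e, he, fun z hz => ?_⟩
    simpa [← mul_assoc] using h (I * z) (by
      simp only [mem_reProdIm, mem_Ioo, mul_re, mul_im, I_re, I_im] at hz ⊢
      constructor <;> constructor <;> linarith [hz.1.1, hz.1.2, hz.2.1, hz.2.2])

theorem glue_horizontal (hQ : IsFrameClass Q) {a b b' c d : ℝ} (hab : a ≤ b) (hbb' : b ≤ b')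
    (hcd : c ≤ d) (h₁ : GoodRect Q a b c d) (h₂ : GoodRect Q b b' c d) :
    GoodRect Q a b' c d := by
  obtain ⟨f₁, e₁, he₁, h₁⟩ := h₁
  obtain ⟨f₂, e₂, he₂, h₂⟩ := h₂
  obtain ⟨e, he, hee₁, hee₂⟩ : ∃ e > 0, 2 * e ≤ e₁ ∧ 2 * e ≤ e₂ :=
    ⟨min e₁ e₂ / 2, by positivity, by linarith [min_le_left e₁ e₂],
      by linarith [min_le_right e₁ e₂]⟩
  set overlap := Ioo (b - 2 * e) (b + 2 * e) ×ℂ Ioo (c - 2 * e) (d + 2 * e)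
  have hdiv : ∀ z ∈ overlap, AnalyticAt ℂ (fun z => f₁ z / f₂ z) z ∧ f₁ z / f₂ z ≠ 0 :=
    fun z hz => hQ.div
      (h₁ z (Ioo_reProdIm_Ioo_subset (by linarith) (by linarith) (by linarith) (by linarith) hz))
      (h₂ z (Ioo_reProdIm_Ioo_subset (by linarith) (by linarith) (by linarith) (by linarith) hz))
  obtain ⟨g₁, g₂, hg₁, hg₁', hg₂, hg₂', hg⟩ := exists_mul_split_rect (O := overlap)
    (z := ⟨b - e, c - e⟩) (w := ⟨b + e, d + e⟩) (isOpen_Ioo.reProdIm isOpen_Ioo)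
    (convex_reProdIm (convex_Ioo _ _) (convex_Ioo _ _))
    (fun z hz => (hdiv z hz).1.differentiableAt.differentiableWithinAt) (fun z hz => (hdiv z hz).2)
    (by
      rw [Rectangle, uIcc_of_le (by linarith), uIcc_of_le (by linarith)]
      exact reProdIm_subset_iff.2 (prod_mono (Icc_subset_Ioo (by linarith) (by linarith))
        (Icc_subset_Ioo (by linarith) (by linarith))))
  obtain ⟨f, hf⟩ := hQ.glue (O₁ := Ioo (a - e) (b + e) ×ℂ Ioo (c - e) (d + e))
    (O₂ := Ioo (b - e) (b' + e) ×ℂ Ioo (c - e) (d + e)) (isOpen_Ioo.reProdIm isOpen_Ioo)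
    (isOpen_Ioo.reProdIm isOpen_Ioo)
    (fun z hz => h₁ z (Ioo_reProdIm_Ioo_subset (by linarith) (by linarith) (by linarith)
      (by linarith) hz))
    (fun z hz => h₂ z (Ioo_reProdIm_Ioo_subset (by linarith) (by linarith) (by linarith)
      (by linarith) hz))
    (hg₁.mono fun z hz => ⟨hz.1.2, hz.2⟩) hg₁' (hg₂.mono fun z hz => ⟨hz.1.1, hz.2⟩) hg₂'
    (fun z hz => hg z ⟨⟨hz.2.1.1, hz.1.1.2⟩, hz.1.2⟩)
  refine ⟨f, e, he, fun z hz => hf z ?_⟩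
  rcases lt_or_ge z.re (b + e) with h | h
  · exact Or.inl ⟨⟨hz.1.1, h⟩, hz.2⟩
  · exact Or.inr ⟨⟨lt_of_lt_of_le (by linarith) h, hz.1.2⟩, hz.2⟩

theorem glue_vertical (hQ : IsFrameClass Q) {a b c d d' : ℝ} (hab : a ≤ b) (hcd : c ≤ d)
    (hdd' : d ≤ d') (h₁ : GoodRect Q a b c d) (h₂ : GoodRect Q a b d d') :
    GoodRect Q a b c d' :=
  goodRect_rotate_iff.1 <| hQ.rotate.glue_horizontal hcd hdd' (neg_le_neg hab)
    (goodRect_rotate_iff.2 h₁) (goodRect_rotate_iff.2 h₂)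

theorem exists_goodRect_nhds (hQ : IsFrameClass Q) (x y : ℝ) :
    ∃ e > 0, GoodRect Q (x - e) (x + e) (y - e) (y + e) := by
  obtain ⟨f, hf⟩ := hQ.exists_local ⟨x, y⟩
  obtain ⟨e, he, h⟩ := Metric.eventually_nhds_iff.1 hf
  refine ⟨e / 4, by positivity, f, e / 4, by positivity, fun z hz => h ?_⟩
  have hre : |(z - ⟨x, y⟩).re| < e / 2 := by
    rw [sub_re, abs_lt]
    constructor <;> linarith [hz.1.1, hz.1.2]
  have him : |(z - ⟨x, y⟩).im| < e / 2 := by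
    rw [sub_im, abs_lt]
    constructor <;> linarith [hz.2.1, hz.2.2]
  rw [dist_eq_norm]
  linarith [norm_le_abs_re_add_abs_im (z - ⟨x, y⟩)]

theorem goodRect_of_le (hQ : IsFrameClass Q) {a b c d : ℝ} (hab : a ≤ b) (hcd : c ≤ d) :
    GoodRect Q a b c d := by
  have strip : ∀ x : ℝ, ∃ e > 0, GoodRect Q (x - e) (x + e) c d := fun x => by
    refine rel_of_trans_of_local (R := fun c d => ∃ e > 0, GoodRect Q (x - e) (x + e) c d)
      ?_ ?_ hcd
    · rintro c d d' hcd hdd' ⟨e₁, he₁, h₁⟩ ⟨e₂, he₂, h₂⟩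
      have hl := min_le_left e₁ e₂
      have hr := min_le_right e₁ e₂
      have hm : 0 < min e₁ e₂ := lt_min he₁ he₂
      exact ⟨min e₁ e₂, hm, hQ.glue_vertical (by linarith) hcd hdd'
        (h₁.mono (by linarith) (by linarith) le_rfl le_rfl)
        (h₂.mono (by linarith) (by linarith) le_rfl le_rfl)⟩
    · intro y
      obtain ⟨e, he, h⟩ := hQ.exists_goodRect_nhds x y
      exact ⟨e, he, fun a b ha _ hb => ⟨e, he, h.mono le_rfl le_rfl ha.le hb.le⟩⟩
  refine rel_of_trans_of_local (R := fun a b => GoodRect Q a b c d)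
    (fun a b b' hab hbb' => hQ.glue_horizontal hab hbb' hcd) (fun x => ?_) hab
  obtain ⟨e, he, h⟩ := strip x
  exact ⟨e, he, fun a b ha _ hb => h.mono ha.le hb.le le_rfl le_rfl⟩

theorem exists_on_ball (hQ : IsFrameClass Q) {r : ℝ} (hr : 0 ≤ r) :
    ∃ f, ∀ z ∈ Metric.ball (0 : ℂ) r, Q z f := by
  have hrr : -r ≤ r := by linarith
  obtain ⟨f, e, he, h⟩ := hQ.goodRect_of_le hrr hrr
  refine ⟨f, fun z hz => h z ?_⟩
  rw [mem_ball_zero_iff] at hz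
  have hre := abs_lt.1 ((abs_re_le_norm z).trans_lt hz)
  have him := abs_lt.1 ((abs_im_le_norm z).trans_lt hz)
  constructor <;> constructor <;> linarith [hre.1, hre.2, him.1, him.2]

end IsFrameClass

end Rectangles

/-! ### Holomorphic and meromorphic functions on the Riemann sphere -/

namespace RiemannSphere

theorem chartAt_coe (z : ℂ) : chartAt ℂ (z : OnePoint ℂ) = affineChart := rfl

theorem chartAt_infty : chartAt ℂ (∞ : OnePoint ℂ) = inftyChart := rfl

theorem inftyChart_symm_apply (z : ℂ) : inftyChart.symm z = inv (z : OnePoint ℂ) := by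
  simp [inftyChart, affineChart_symm_apply, invHomeo]

theorem inftyChart_infty : inftyChart ∞ = 0 := by
  simp [inftyChart, invHomeo, affineChart_coe]

theorem inftyChart_coe {z : ℂ} (hz : z ≠ 0) : inftyChart (z : OnePoint ℂ) = z⁻¹ := by
  simp [inftyChart, invHomeo, inv_coe hz, affineChart_coe]

theorem affineChart_target : affineChart.target = Set.univ := by
  simp [affineChart]

theorem chartAt_target (a : OnePoint ℂ) : (chartAt ℂ a).target = Set.univ := by
  induction a using OnePoint.rec with
  | infty => simp [chartAt_infty, inftyChart, affineChart_target]
  | coe => exact affineChart_target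

theorem chart_symm_mem_source (a : OnePoint ℂ) (w : ℂ) :
    (chartAt ℂ a).symm w ∈ (chartAt ℂ a).source :=
  (chartAt ℂ a).map_target (by simp [chartAt_target])

theorem chart_apply_symm (a : OnePoint ℂ) (w : ℂ) :
    chartAt ℂ a ((chartAt ℂ a).symm w) = w :=
  (chartAt ℂ a).right_inv (by simp [chartAt_target])

theorem chart_symm_self (a : OnePoint ℂ) : (chartAt ℂ a).symm (chartAt ℂ a a) = a :=
  (chartAt ℂ a).left_inv (mem_chart_source ℂ a)

theorem chart_symm_injective (a : OnePoint ℂ) : Function.Injective (chartAt ℂ a).symm :=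
  Function.LeftInverse.injective (chart_apply_symm a)

theorem map_chart_symm_nhds (a : OnePoint ℂ) (w : ℂ) :
    map (chartAt ℂ a).symm (𝓝 w) = 𝓝 ((chartAt ℂ a).symm w) :=
  (chartAt ℂ a).symm.map_nhds_eq (by simp [chartAt_target])

theorem map_chart_symm_nhdsNE (a : OnePoint ℂ) (w : ℂ) :
    map (chartAt ℂ a).symm (𝓝[≠] w) = 𝓝[≠] ((chartAt ℂ a).symm w) := by
  ext s
  rw [mem_map, mem_nhdsWithin_iff_eventually, mem_nhdsWithin_iff_eventually,
    ← map_chart_symm_nhds, eventually_map]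
  simp [(chart_symm_injective a).eq_iff]

theorem eventually_chart_symm_nhdsNE {a : OnePoint ℂ} {P : OnePoint ℂ → Prop} :
    (∀ᶠ w in 𝓝[≠] (chartAt ℂ a a), P ((chartAt ℂ a).symm w)) ↔ ∀ᶠ y in 𝓝[≠] a, P y := by
  rw [← eventually_map (P := P), map_chart_symm_nhdsNE, chart_symm_self]

end RiemannSphere

open RiemannSphere

/-- The function `f` on the Riemann sphere is holomorphic near `a`. -/
def Hol {F : Type*} [NormedAddCommGroup F] [NormedSpace ℂ F] (f : OnePoint ℂ → F)
    (a : OnePoint ℂ) : Prop :=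
  ContMDiffAt 𝓘(ℂ) 𝓘(ℂ, F) ω f a

section Hol

variable {F : Type*} [NormedAddCommGroup F] [NormedSpace ℂ F] {a : OnePoint ℂ}

theorem hol_chart_symm_iff [CompleteSpace F] {f : OnePoint ℂ → F} (a : OnePoint ℂ) (w : ℂ) :
    Hol f ((chartAt ℂ a).symm w) ↔ AnalyticAt ℂ (fun z => f ((chartAt ℂ a).symm z)) w := by
  rw [Hol, contMDiffAt_iff_source_of_mem_source (x := a) (chart_symm_mem_source a w)]
  simp only [extChartAt, modelWithCornersSelf_partialEquiv, PartialEquiv.trans_refl,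
    OpenPartialHomeomorph.toFun_eq_coe, OpenPartialHomeomorph.coe_toPartialEquiv_symm,
    modelWithCornersSelf_coe, Set.range_id, contMDiffWithinAt_univ, contMDiffAt_iff_contDiffAt,
    OpenPartialHomeomorph.extend, chart_apply_symm, Function.comp_def]
  exact ⟨fun h => h.analyticAt, fun h => h.contDiffAt⟩

theorem hol_iff [CompleteSpace F] {f : OnePoint ℂ → F} :
    Hol f a ↔ AnalyticAt ℂ (fun z => f ((chartAt ℂ a).symm z)) (chartAt ℂ a a) := by
  rw [← hol_chart_symm_iff, chart_symm_self]

theorem hol_comp_chart_iff [CompleteSpace F] {f : ℂ → F} {w : ℂ} :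
    Hol (fun y => f (chartAt ℂ a y)) ((chartAt ℂ a).symm w) ↔ AnalyticAt ℂ f w := by
  simp only [hol_chart_symm_iff, chart_apply_symm]

theorem hol_comp_chart [CompleteSpace F] {f : ℂ → F} (hf : AnalyticAt ℂ f (chartAt ℂ a a)) :
    Hol (fun y => f (chartAt ℂ a y)) a := by
  simpa only [chart_symm_self] using (hol_comp_chart_iff (a := a)).2 hf

theorem hol_coe_iff [CompleteSpace F] {f : OnePoint ℂ → F} {z : ℂ} :
    Hol f (z : OnePoint ℂ) ↔ AnalyticAt ℂ (fun w : ℂ => f (w : OnePoint ℂ)) z :=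
  hol_chart_symm_iff ((0 : ℂ) : OnePoint ℂ) z

theorem hol_inv_coe_iff [CompleteSpace F] {f : OnePoint ℂ → F} {z : ℂ} :
    Hol f (inv (z : OnePoint ℂ)) ↔ AnalyticAt ℂ (fun w : ℂ => f (inv (w : OnePoint ℂ))) z := by
  have := hol_chart_symm_iff (f := f) ∞ z
  simpa only [chartAt_infty, inftyChart_symm_apply] using this

theorem Hol.eventually [CompleteSpace F] {f : OnePoint ℂ → F} (h : Hol f a) :
    ∀ᶠ b in 𝓝 a, Hol f b :=
  (contMDiffAt_iff_contMDiffAt_nhds (by simp)).1 h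

theorem Hol.continuousAt {f : OnePoint ℂ → F} (h : Hol f a) : ContinuousAt f a :=
  ContMDiffAt.continuousAt h

theorem Hol.congr {f g : OnePoint ℂ → F} (h : Hol f a) (hfg : f =ᶠ[𝓝 a] g) : Hol g a :=
  ContMDiffAt.congr_of_eventuallyEq h hfg.symm

theorem Hol.eventually_ne {f : OnePoint ℂ → ℂ} (h : Hol f a) (h0 : f a ≠ 0) :
    ∀ᶠ b in 𝓝 a, f b ≠ 0 :=
  h.continuousAt.eventually_ne h0

theorem hol_const (c : F) : Hol (fun _ => c) a := contMDiffAt_const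

theorem Hol.linearMap {G : Type*} [NormedAddCommGroup G] [NormedSpace ℂ G]
    [FiniteDimensional ℂ F] {f : OnePoint ℂ → F} (h : Hol f a) (L : F →ₗ[ℂ] G) :
    Hol (fun y => L (f y)) a :=
  L.toContinuousLinearMap.contDiff.contMDiff.contMDiffAt.comp a h

theorem Hol.mul {f g : OnePoint ℂ → ℂ} (hf : Hol f a) (hg : Hol g a) :
    Hol (fun y => f y * g y) a := by
  rw [hol_iff] at *
  exact hf.fun_mul hg

theorem Hol.inv {f : OnePoint ℂ → ℂ} (hf : Hol f a) (h0 : f a ≠ 0) :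
    Hol (fun y => (f y)⁻¹) a := by
  rw [hol_iff] at *
  exact hf.fun_inv (by rwa [chart_symm_self])

theorem Hol.div {f g : OnePoint ℂ → ℂ} (hf : Hol f a) (hg : Hol g a) (h0 : g a ≠ 0) :
    Hol (fun y => f y / g y) a := by
  simp only [div_eq_mul_inv]
  exact hf.mul (hg.inv h0)

theorem Hol.sum {ι : Type*} {s : Finset ι} {f : ι → OnePoint ℂ → F} [CompleteSpace F]
    (h : ∀ i ∈ s, Hol (f i) a) : Hol (fun y => ∑ i ∈ s, f i y) a := by
  simp only [hol_iff] at *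
  exact Finset.analyticAt_fun_sum s h

theorem Hol.prod {ι : Type*} {s : Finset ι} {f : ι → OnePoint ℂ → ℂ}
    (h : ∀ i ∈ s, Hol (f i) a) : Hol (fun y => ∏ i ∈ s, f i y) a := by
  simp only [hol_iff] at *
  exact Finset.analyticAt_fun_prod s h

theorem hol_pi_iff {ι : Type*} [Fintype ι] {f : OnePoint ℂ → ι → ℂ} :
    Hol f a ↔ ∀ i, Hol (fun y => f y i) a := by
  simp only [hol_iff]
  exact analyticAt_pi_iff

theorem Hol.det {ι : Type*} [Fintype ι] [DecidableEq ι] {A : OnePoint ℂ → Matrix ι ι ℂ}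
    (h : ∀ i j, Hol (fun y => A y i j) a) : Hol (fun y => (A y).det) a := by
  simp only [Matrix.det_apply']
  exact Hol.sum fun σ _ => (hol_const _).mul (Hol.prod fun i _ => h _ _)

end Hol

namespace HasOrderAt

variable {f g : OnePoint ℂ → ℂ} {a : OnePoint ℂ} {m n : ℤ}

theorem congr (h : HasOrderAt f a m) (hfg : f =ᶠ[𝓝[≠] a] g) : HasOrderAt g a m := by
  have h' : f ∘ (chartAt ℂ a).symm =ᶠ[𝓝[≠] (chartAt ℂ a a)] g ∘ (chartAt ℂ a).symm :=
    eventually_chart_symm_nhdsNE.2 hfg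
  exact ⟨h.1.congr h', by rw [← meromorphicOrderAt_congr h', h.2]⟩

theorem mul (hf : HasOrderAt f a m) (hg : HasOrderAt g a n) :
    HasOrderAt (fun y => f y * g y) a (m + n) :=
  ⟨hf.1.mul hg.1, by
    rw [show (fun y => f y * g y) ∘ (chartAt ℂ a).symm =
      (f ∘ (chartAt ℂ a).symm) * (g ∘ (chartAt ℂ a).symm) from rfl,
      meromorphicOrderAt_mul hf.1 hg.1, hf.2, hg.2]; rfl⟩

theorem inv (hf : HasOrderAt f a m) : HasOrderAt (fun y => (f y)⁻¹) a (-m) :=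
  ⟨hf.1.inv, by
    rw [show (fun y => (f y)⁻¹) ∘ (chartAt ℂ a).symm = (f ∘ (chartAt ℂ a).symm)⁻¹ from rfl,
      meromorphicOrderAt_inv, hf.2]; rfl⟩

theorem div (hf : HasOrderAt f a m) (hg : HasOrderAt g a n) :
    HasOrderAt (fun y => f y / g y) a (m - n) := by
  simp only [div_eq_mul_inv, sub_eq_add_neg]
  exact hf.mul hg.inv

theorem of_hol (hf : Hol f a) (h0 : f a ≠ 0) : HasOrderAt f a 0 := by
  rw [hol_iff] at hf
  exact ⟨hf.meromorphicAt,
    hf.meromorphicNFAt.meromorphicOrderAt_eq_zero_iff.2 (by rwa [chart_symm_self])⟩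

theorem zpow (hf : HasOrderAt f a m) (k : ℤ) : HasOrderAt (fun y => f y ^ k) a (k * m) := by
  refine ⟨hf.1.zpow k, ?_⟩
  rw [show (fun y => f y ^ k) ∘ (chartAt ℂ a).symm = (f ∘ (chartAt ℂ a).symm) ^ k from rfl,
    meromorphicOrderAt_zpow hf.1, hf.2]
  rfl

theorem pow (hf : HasOrderAt f a m) (k : ℕ) : HasOrderAt (fun y => f y ^ k) a (k * m) := by
  simpa only [zpow_natCast] using hf.zpow k

theorem prod {ι : Type*} {s : Finset ι} {F : ι → OnePoint ℂ → ℂ} {k : ι → ℤ}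
    (h : ∀ i ∈ s, HasOrderAt (F i) a (k i)) :
    HasOrderAt (fun y => ∏ i ∈ s, F i y) a (∑ i ∈ s, k i) := by
  classical
  induction s using Finset.induction_on with
  | empty => simpa using of_hol (hol_const (1 : ℂ) (a := a)) one_ne_zero
  | insert i s hi ih =>
    simp only [Finset.prod_insert hi, Finset.sum_insert hi]
    exact (h i (by simp)).mul (ih fun j hj => h j (by simp [hj]))

theorem unique (hf : HasOrderAt f a m) (hf' : HasOrderAt f a n) : m = n := by
  exact_mod_cast hf.2.symm.trans hf'.2

theorem eventually_ne (hf : HasOrderAt f a m) : ∀ᶠ y in 𝓝[≠] a, f y ≠ 0 := by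
  rw [← eventually_chart_symm_nhdsNE]
  exact (meromorphicOrderAt_ne_top_iff_eventually_ne_zero hf.1).1 (by rw [hf.2]; simp)

theorem coe_iff {z : ℂ} : HasOrderAt f (z : OnePoint ℂ) m ↔
    MeromorphicAt (fun w : ℂ => f (w : OnePoint ℂ)) z ∧
      meromorphicOrderAt (fun w : ℂ => f (w : OnePoint ℂ)) z = m := by
  rw [HasOrderAt, chartAt_coe, affineChart_coe]
  rfl

theorem infty_iff : HasOrderAt f ∞ m ↔
    MeromorphicAt (fun w : ℂ => f (RiemannSphere.inv (w : OnePoint ℂ))) 0 ∧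
      meromorphicOrderAt (fun w : ℂ => f (RiemannSphere.inv (w : OnePoint ℂ))) 0 = m := by
  rw [HasOrderAt, chartAt_infty, inftyChart_infty]
  have : f ∘ inftyChart.symm = fun w : ℂ => f (RiemannSphere.inv (w : OnePoint ℂ)) := by
    ext w
    simp [inftyChart_symm_apply]
  rw [this]

theorem exists_nonneg_of_hol (hf : Hol f a) (h0 : ∀ᶠ y in 𝓝[≠] a, f y ≠ 0) :
    ∃ k : ℤ, 0 ≤ k ∧ HasOrderAt f a k := by
  rw [hol_iff] at hf
  obtain ⟨k, hk⟩ := WithTop.ne_top_iff_exists.1 <|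
    (meromorphicOrderAt_ne_top_iff_eventually_ne_zero hf.meromorphicAt).2
      (eventually_chart_symm_nhdsNE.2 h0)
  exact ⟨k, by exact_mod_cast hk ▸ hf.meromorphicOrderAt_nonneg, hf.meromorphicAt, hk.symm⟩

end HasOrderAt

/-! ### The divisor of a meromorphic function has degree zero -/

theorem order_eq_zero_of_entire {Φ : ℂ → ℂ} (hΦ : Differentiable ℂ Φ) (h0 : ∀ z, Φ z ≠ 0) {N : ℤ}
    (hN : 0 ≤ N) (hm : MeromorphicAt (fun t => Φ t⁻¹) 0)
    (ho : meromorphicOrderAt (fun t => Φ t⁻¹) 0 = N) : N = 0 := by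
  obtain ⟨c, hc⟩ := tendsto_nhds_of_meromorphicOrderAt_nonneg hm (by rw [ho]; exact_mod_cast hN)
  have hcocompact : Tendsto Φ (cocompact ℂ) (𝓝 c) := by
    have := hc.comp (tendsto_inv₀_cobounded' (α := ℂ))
    rw [Metric.cobounded_eq_cocompact] at this
    exact this.congr fun z => by simp
  have hc0 : c ≠ 0 := hΦ.apply_eq_of_tendsto_cocompact 0 hcocompact ▸ h0 0
  have := (tendsto_ne_zero_iff_meromorphicOrderAt_eq_zero hm).1 ⟨c, hc0, hc⟩
  rw [ho] at this
  exact_mod_cast this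

theorem order_infty_eq_zero_of_order_coe_eq_zero {f : OnePoint ℂ → ℂ} {N : ℤ} (hN : 0 ≤ N)
    (hcoe : ∀ z : ℂ, HasOrderAt f (z : OnePoint ℂ) 0) (hinf : HasOrderAt f ∞ N) : N = 0 := by
  set F : ℂ → ℂ := fun z => f (z : OnePoint ℂ)
  have hF : MeromorphicOn F Set.univ := fun z _ => (HasOrderAt.coe_iff.1 (hcoe z)).1
  set Φ := toMeromorphicNFOn F Set.univ
  have hNF : ∀ z, MeromorphicNFAt Φ z := fun z =>
    meromorphicNFOn_toMeromorphicNFOn F Set.univ (Set.mem_univ z)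
  have horder : ∀ z, meromorphicOrderAt Φ z = 0 := fun z => by
    rw [meromorphicOrderAt_toMeromorphicNFOn hF (Set.mem_univ z)]
    exact_mod_cast (HasOrderAt.coe_iff.1 (hcoe z)).2
  have hΦ : ∀ z, AnalyticAt ℂ F z → Φ z = F z := fun z hz => by
    simp only [Φ, toMeromorphicNFOn_eq_toMeromorphicNFAt hF (Set.mem_univ z),
      toMeromorphicNFAt_eq_self.2 hz.meromorphicNFAt]
  obtain ⟨hinf_mero, hinf_order⟩ := HasOrderAt.infty_iff.1 hinf
  have hcongr : (fun w : ℂ => f (RiemannSphere.inv (w : OnePoint ℂ))) =ᶠ[𝓝[≠] 0]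
      fun t => Φ t⁻¹ := by
    filter_upwards [hinf_mero.eventually_analyticAt, self_mem_nhdsWithin] with t ht ht0
    have hol : Hol f (RiemannSphere.inv (t : OnePoint ℂ)) := hol_inv_coe_iff.2 ht
    rw [inv_coe ht0] at hol ⊢
    exact (hΦ _ (hol_coe_iff.1 hol)).symm
  refine order_eq_zero_of_entire (Φ := Φ) ?_ ?_ hN (hinf_mero.congr hcongr) ?_
  · exact fun z => ((hNF z).meromorphicOrderAt_nonneg_iff_analyticAt.1
      (horder z).ge).differentiableAt
  · exact fun z => (hNF z).meromorphicOrderAt_eq_zero_iff.1 (horder z)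
  · rw [← meromorphicOrderAt_congr hcongr, hinf_order]

/-- The meromorphic function `z - w` on the Riemann sphere, with the junk value `0` at `∞`. -/
noncomputable def linearCoord (w : ℂ) (y : OnePoint ℂ) : ℂ := y.elim 0 fun z => z - w

theorem hasOrderAt_linearCoord_coe (w z : ℂ) :
    HasOrderAt (linearCoord w) (z : OnePoint ℂ) (if z = w then 1 else 0) := by
  split_ifs with h
  · subst h
    refine HasOrderAt.coe_iff.2 ⟨?_, ?_⟩
    · exact (by fun_prop : AnalyticAt ℂ (fun x : ℂ => x - z) z).meromorphicAt
    · exact meromorphicOrderAt_id_sub_const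
  · refine HasOrderAt.of_hol (hol_coe_iff.2 ?_) (sub_ne_zero.2 h)
    exact (by fun_prop : AnalyticAt ℂ (fun x : ℂ => x - w) z)

theorem inv_linearCoord_zero_inv_coe (t : ℂ) :
    (linearCoord 0 (RiemannSphere.inv (t : OnePoint ℂ)))⁻¹ = t := by
  by_cases ht : t = 0
  · simp [ht, linearCoord]
  · simp [inv_coe ht, linearCoord]

theorem hasOrderAt_linearCoord_zero_infty : HasOrderAt (linearCoord 0) ∞ (-1) := by
  have : HasOrderAt (fun y => (linearCoord 0 y)⁻¹) ∞ 1 := by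
    rw [HasOrderAt.infty_iff]
    simp only [inv_linearCoord_zero_inv_coe]
    exact ⟨analyticAt_id.meromorphicAt, meromorphicOrderAt_id⟩
  simpa using this.inv

theorem hasOrderAt_linearCoord_infty (w : ℂ) : HasOrderAt (linearCoord w) ∞ (-1) := by
  have hunit : HasOrderAt (fun y => 1 - w * (linearCoord 0 y)⁻¹) ∞ 0 := by
    refine HasOrderAt.of_hol ?_ (by simp [linearCoord])
    rw [show (∞ : OnePoint ℂ) = RiemannSphere.inv ((0 : ℂ) : OnePoint ℂ) by simp, hol_inv_coe_iff]
    simp only [inv_linearCoord_zero_inv_coe]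
    fun_prop
  have hne : ∀ᶠ y in 𝓝[≠] (∞ : OnePoint ℂ), y ≠ ((0 : ℂ) : OnePoint ℂ) ∧ y ≠ (∞ : OnePoint ℂ) :=
    (eventually_nhdsWithin_of_eventually_nhds (isOpen_ne.mem_nhds (by simp))).and
      eventually_mem_nhdsWithin
  refine (hasOrderAt_linearCoord_zero_infty.mul hunit).congr ?_
  filter_upwards [hne] with y hy
  induction y using OnePoint.rec with
  | infty => exact absurd rfl hy.2
  | coe z =>
    have hz : z ≠ 0 := by simpa using hy.1
    simp only [linearCoord, OnePoint.elim_some]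
    field_simp
    ring

theorem sum_eq_infty_add_sum_coe (m : OnePoint ℂ →₀ ℤ) :
    (m.sum fun _ k => k) =
      m ∞ + ∑ w ∈ m.support.preimage OnePoint.some OnePoint.coe_injective.injOn,
        m (w : OnePoint ℂ) := by
  classical
  set T : Finset ℂ := m.support.preimage OnePoint.some OnePoint.coe_injective.injOn
  have hsub : m.support ⊆
      insert (∞ : OnePoint ℂ) (T.map ⟨((↑) : ℂ → OnePoint ℂ), OnePoint.coe_injective⟩) := by
    intro y hy
    induction y using OnePoint.rec with
    | infty => simp
    | coe z => simpa [T] using hy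
  rw [Finsupp.sum_of_support_subset m hsub _ (by simp), Finset.sum_insert (by simp),
    Finset.sum_map]
  rfl

theorem sum_order_eq_zero {f : OnePoint ℂ → ℂ} {m : OnePoint ℂ →₀ ℤ}
    (h : ∀ a, HasOrderAt f a (m a)) : (m.sum fun _ k => k) = 0 := by
  classical
  set T : Finset ℂ := m.support.preimage OnePoint.some OnePoint.coe_injective.injOn
  -- `R` is the rational function cancelling all zeros and poles of `f` outside `∞`.
  set R : OnePoint ℂ → ℂ := fun y => ∏ w ∈ T, linearCoord w y ^ (-m (w : OnePoint ℂ))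
  have hcoe : ∀ z : ℂ, HasOrderAt (fun y => f y * R y) (z : OnePoint ℂ) 0 := fun z => by
    have := (h z).mul (HasOrderAt.prod (s := T) fun w _ =>
      (hasOrderAt_linearCoord_coe w z).zpow (-m (w : OnePoint ℂ)))
    convert this using 1
    simp only [mul_ite, mul_one, mul_zero, Finset.sum_ite_eq]
    split_ifs with hz
    · ring
    · have : m (z : OnePoint ℂ) = 0 := by simpa [T] using hz
      simp [this]
  have hinf : HasOrderAt (fun y => f y * R y) ∞ (m.sum fun _ k => k) := by
    have := (h ∞).mul (HasOrderAt.prod (s := T) fun w _ =>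
      (hasOrderAt_linearCoord_infty w).zpow (-m (w : OnePoint ℂ)))
    convert this using 1
    rw [sum_eq_infty_add_sum_coe]
    simp [T]
  rcases le_total 0 (m.sum fun _ k => k) with hN | hN
  · exact order_infty_eq_zero_of_order_coe_eq_zero hN hcoe hinf
  · have := order_infty_eq_zero_of_order_coe_eq_zero (neg_nonneg.2 hN)
      (fun z => by simpa using (hcoe z).inv) hinf.inv
    exact neg_eq_zero.1 this

/-! ### Laurent splitting on an annulus -/

section Annulus

open Complex Set

theorem circleIntegral_dslope {u : ℂ → ℂ} {c z : ℂ} {R : ℝ} (hR : 0 ≤ R)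
    (hu : ContinuousOn u (Metric.sphere c R)) (hz : z ∉ Metric.sphere c R) :
    (∮ w in C(c, R), dslope u z w) =
      (∮ w in C(c, R), (w - z)⁻¹ * u w) - u z * ∮ w in C(c, R), (w - z)⁻¹ := by
  have hne : ∀ w ∈ Metric.sphere c R, w ≠ z := fun w hw h => hz (h ▸ hw)
  have hinv : ContinuousOn (fun w : ℂ => (w - z)⁻¹) (Metric.sphere c R) :=
    (continuousOn_id.sub continuousOn_const).inv₀ fun w hw => sub_ne_zero.2 (hne w hw)
  rw [← circleIntegral.integral_const_mul, ← circleIntegral.integral_sub]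
  · refine circleIntegral.integral_congr hR fun w hw => ?_
    simp only [dslope_of_ne _ (hne w hw), slope_def_field]
    ring
  · exact (hinv.mul hu).circleIntegrable hR
  · exact (continuousOn_const.mul hinv).circleIntegrable hR

theorem circleIntegral_sub_inv_of_notMem_closedBall {c z : ℂ} {R : ℝ} (hR : 0 ≤ R)
    (hz : z ∉ Metric.closedBall c R) : (∮ w in C(c, R), (w - z)⁻¹) = 0 := by
  have hne : ∀ w ∈ Metric.closedBall c R, w - z ≠ 0 := fun w hw h => hz (sub_eq_zero.1 h ▸ hw)
  refine circleIntegral_eq_zero_of_differentiable_on_off_countable hR countable_empty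
    ((continuousOn_id.sub continuousOn_const).inv₀ hne) fun w hw => ?_
  exact (differentiableAt_id.sub_const z).inv (hne w (Metric.ball_subset_closedBall hw.1))

theorem circleIntegral_sub_inv_mul_sub {u : ℂ → ℂ} {r R : ℝ} (hr : 0 < r)
    (hu : ∀ z : ℂ, r ≤ ‖z‖ → ‖z‖ ≤ R → DifferentiableAt ℂ u z) {z : ℂ} (hrz : r < ‖z‖)
    (hzR : ‖z‖ < R) :
    (∮ w in C(0, R), (w - z)⁻¹ * u w) - (∮ w in C(0, r), (w - z)⁻¹ * u w) =
      2 * Real.pi * I * u z := by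
  have hclosed : ∀ w ∈ Metric.closedBall (0 : ℂ) R \ Metric.ball 0 r, DifferentiableAt ℂ u w :=
    fun w hw => hu w (by simpa using hw.2) (by simpa using hw.1)
  have hcauchy := circleIntegral_eq_of_differentiable_on_annulus_off_countable (c := 0)
    (f := dslope u z) hr (hrz.trans hzR).le (countable_singleton z)
    (fun w hw => by
      rcases eq_or_ne w z with rfl | h
      · exact (continuousAt_dslope_same.2 (hu w hrz.le hzR.le)).continuousWithinAt
      · exact ((continuousAt_dslope_of_ne h).2 (hclosed w hw).continuousAt).continuousWithinAt)
    fun w hw => (differentiableAt_dslope_of_ne hw.2).2 <|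
      hclosed w ⟨Metric.ball_subset_closedBall hw.1.1,
        fun h => hw.1.2 (Metric.ball_subset_closedBall h)⟩
  have hcont : ∀ ρ : ℝ, r ≤ ρ → ρ ≤ R → ContinuousOn u (Metric.sphere 0 ρ) := fun ρ h₁ h₂ w hw => by
    rw [mem_sphere_zero_iff_norm] at hw
    exact (hu w (hw ▸ h₁) (hw ▸ h₂)).continuousAt.continuousWithinAt
  have hrR := hrz.trans hzR
  rw [circleIntegral_dslope (hr.trans hrR).le (hcont R hrR.le le_rfl) (by simpa using hzR.ne),
    circleIntegral_dslope hr.le (hcont r le_rfl hrR.le) (by simpa using hrz.ne'),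
    circleIntegral.integral_sub_inv_of_mem_ball (by simpa using hzR),
    circleIntegral_sub_inv_of_notMem_closedBall hr.le (by simpa using hrz)] at hcauchy
  linear_combination hcauchy

theorem circleIntegral_sub_inv_mul_eq (u : ℂ → ℂ) {r : ℝ} (hr : 0 < r) {z : ℂ} (hz : r < ‖z‖) :
    (∮ w in C(0, r), (w - z)⁻¹ * u w) =
      -(z⁻¹ * ∫ θ in (0 : ℝ)..2 * Real.pi,
        (I * u (circleMap 0 r θ)) / ((circleMap 0 r θ)⁻¹ - z⁻¹)) := by
  rw [circleIntegral, ← intervalIntegral.integral_const_mul, ← intervalIntegral.integral_neg]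
  refine intervalIntegral.integral_congr fun θ _ => ?_
  have hz0 : z ≠ 0 := norm_pos_iff.1 (hr.trans hz)
  have hc : circleMap 0 r θ ≠ 0 := circleMap_ne_center hr.ne'
  have hcz : circleMap 0 r θ - z ≠ 0 := fun h => by
    rw [← sub_eq_zero.1 h, norm_circleMap_zero, abs_of_pos hr] at hz
    exact hz.false
  have hzc : z - circleMap 0 r θ ≠ 0 := fun h => hcz (by linear_combination -h)
  have hinv : (circleMap 0 r θ)⁻¹ - z⁻¹ = (z - circleMap 0 r θ) / (z * circleMap 0 r θ) := by
    field_simp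
  simp only [deriv_circleMap, smul_eq_mul, hinv]
  field_simp
  ring

theorem exists_add_split_annulus {u : ℂ → ℂ} {r R : ℝ} (hr : 0 < r) (hrR : r < R)
    (hu : ∀ z : ℂ, r ≤ ‖z‖ → ‖z‖ ≤ R → DifferentiableAt ℂ u z) :
    ∃ u₁ κ : ℂ → ℂ, DifferentiableOn ℂ u₁ (Metric.ball 0 R) ∧
      DifferentiableOn ℂ κ (Metric.ball 0 r⁻¹) ∧
      ∀ z : ℂ, r < ‖z‖ → ‖z‖ < R → u z = u₁ z + z⁻¹ * κ z⁻¹ := by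
  have hne : ∀ θ, circleMap 0 r θ ≠ 0 := fun θ => circleMap_ne_center hr.ne'
  have hcont : ∀ ρ : ℝ, r ≤ ρ → ρ ≤ R → ContinuousOn u (Metric.sphere 0 ρ) := fun ρ h₁ h₂ w hw => by
    rw [mem_sphere_zero_iff_norm] at hw
    exact (hu w (hw ▸ h₁) (hw ▸ h₂)).continuousAt.continuousWithinAt
  refine ⟨fun w => (2 * Real.pi * I : ℂ)⁻¹ • ∮ z in C(0, R), (z - w)⁻¹ • u z,
    fun t => (2 * Real.pi * I : ℂ)⁻¹ * ∫ θ in (0 : ℝ)..2 * Real.pi,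
      (I * u (circleMap 0 r θ)) / ((circleMap 0 r θ)⁻¹ - t), ?_, fun t ht => ?_,
    fun z hrz hzR => ?_⟩
  · lift R to NNReal using (hr.trans hrR).le
    have := (hasFPowerSeriesOn_cauchy_integral ((hcont R hrR.le le_rfl).circleIntegrable R.2)
      (by exact_mod_cast hr.trans hrR)).differentiableOn
    rwa [Metric.eball_coe] at this
  · rw [mem_ball_zero_iff] at ht
    refine (DifferentiableAt.const_mul (differentiableAt_intervalIntegral_div_sub ?_ ?_ ?_)
      _).differentiableWithinAt
    · exact continuousOn_const.mul ((hcont r le_rfl hrR.le).comp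
        (continuous_circleMap 0 r).continuousOn fun θ _ => circleMap_mem_sphere _ hr.le _)
    · exact ((continuous_circleMap 0 r).inv₀ hne).continuousOn
    · intro θ _ h
      rw [← h, norm_inv, norm_circleMap_zero, abs_of_pos hr] at ht
      exact ht.false
  · have h2πI : (2 * Real.pi * I : ℂ) ≠ 0 := two_pi_I_ne_zero
    have hcauchy := circleIntegral_sub_inv_mul_sub hr hu hrz hzR
    rw [circleIntegral_sub_inv_mul_eq u hr hrz] at hcauchy
    refine mul_left_cancel₀ h2πI ?_
    rw [← hcauchy]
    simp only [smul_eq_mul]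
    field_simp
    ring

theorem exists_eq_mul_zpow_of_hasDerivAt {φ : ℂ → ℂ} {k : ℂ} {r R : ℝ} (hr : 0 < r) (hrR : r < R)
    (hφ : ∀ z : ℂ, r < ‖z‖ → ‖z‖ < R → HasDerivAt φ (k / z * φ z) z)
    (hφ0 : ∀ z : ℂ, r < ‖z‖ → ‖z‖ < R → φ z ≠ 0) :
    ∃ (n : ℤ) (c : ℂ), c ≠ 0 ∧ ∀ z : ℂ, r < ‖z‖ → ‖z‖ < R → φ z = c * z ^ n := by
  set S : Set ℂ := Ioo (Real.log r) (Real.log R) ×ℂ univ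
  have hSopen : IsOpen S := isOpen_Ioo.reProdIm isOpen_univ
  have hSconv : Convex ℝ S := convex_reProdIm (convex_Ioo _ _) convex_univ
  have hexp : ∀ s ∈ S, r < ‖exp s‖ ∧ ‖exp s‖ < R := fun s hs => by
    rw [norm_exp]
    exact ⟨(Real.log_lt_iff_lt_exp hr).1 hs.1.1, (Real.lt_log_iff_exp_lt (hr.trans hrR)).1 hs.1.2⟩
  have hlog : ∀ z : ℂ, r < ‖z‖ → ‖z‖ < R → log z ∈ S := fun z hrz hzR =>
    ⟨by simpa only [mem_preimage, log_re] using
      ⟨Real.log_lt_log hr hrz, Real.log_lt_log (hr.trans hrz) hzR⟩, mem_univ _⟩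
  have hderiv : ∀ s ∈ S, HasDerivAt (fun s => φ (exp s) * exp (-(k * s))) 0 s := fun s hs => by
    have hφexp := (hφ (exp s) (hexp s hs).1 (hexp s hs).2).comp s (hasDerivAt_exp s)
    have hexpk : HasDerivAt (fun s => exp (-(k * s))) (exp (-(k * s)) * -(k * 1)) s :=
      ((hasDerivAt_id s).const_mul k).neg.cexp
    refine (hφexp.mul hexpk).congr_deriv ?_
    have := exp_ne_zero s
    simp only [Function.comp]
    field_simp
    ring
  obtain ⟨c, hc⟩ : ∃ c, ∀ s ∈ S, φ (exp s) * exp (-(k * s)) = c :=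
    hSopen.exists_is_const_of_deriv_eq_zero hSconv.isPreconnected
      (fun s hs => (hderiv s hs).differentiableAt.differentiableWithinAt)
      fun s hs => (hderiv s hs).deriv
  obtain ⟨x, hrx, hxR⟩ := exists_between (Real.log_lt_log hr hrR)
  have hxS : (x : ℂ) ∈ S := ⟨⟨hrx, hxR⟩, mem_univ _⟩
  have hc0 : c ≠ 0 := hc x hxS ▸
    mul_ne_zero (hφ0 _ (hexp _ hxS).1 (hexp _ hxS).2) (exp_ne_zero _)
  obtain ⟨n, hn⟩ : ∃ n : ℤ, k = n := by
    have hperiod := hc (x + 2 * Real.pi * I) ⟨by simpa using ⟨hrx, hxR⟩, mem_univ _⟩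
    rw [exp_periodic, mul_add, neg_add, exp_add, ← mul_assoc, hc x hxS, mul_eq_left₀ hc0,
      exp_eq_one_iff] at hperiod
    obtain ⟨n, hn⟩ := hperiod
    refine ⟨-n, mul_right_cancel₀ two_pi_I_ne_zero ?_⟩
    push_cast
    linear_combination -hn
  refine ⟨n, c, hc0, fun z hrz hzR => ?_⟩
  have hz0 : z ≠ 0 := norm_pos_iff.1 (hr.trans hrz)
  have := hc _ (hlog z hrz hzR)
  rwa [exp_log hz0, hn, exp_neg, exp_int_mul, exp_log hz0,
    mul_inv_eq_iff_eq_mul₀ (zpow_ne_zero n hz0)] at this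

theorem exists_hasDerivAt_split_annulus {u : ℂ → ℂ} {r R : ℝ} (hr : 0 < r) (hrR : r < R)
    (hu : ∀ z : ℂ, r ≤ ‖z‖ → ‖z‖ ≤ R → DifferentiableAt ℂ u z) :
    ∃ (k : ℂ) (h₁ h₂ : ℂ → ℂ), DifferentiableOn ℂ h₁ (Metric.ball 0 R) ∧
      DifferentiableOn ℂ h₂ (Metric.ball 0 r⁻¹) ∧
      ∀ z : ℂ, r < ‖z‖ → ‖z‖ < R →
        HasDerivAt (fun z => h₁ z + h₂ z⁻¹) (u z - k / z) z := by
  obtain ⟨u₁, κ, hu₁, hκ, hsplit⟩ := exists_add_split_annulus hr hrR hu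
  have hdslope : DifferentiableOn ℂ (fun t => -dslope κ 0 t) (Metric.ball 0 r⁻¹) :=
    ((differentiableOn_dslope (Metric.ball_mem_nhds _ (inv_pos.2 hr))).2 hκ).neg
  obtain ⟨h₁, hh₁⟩ := (convex_ball (0 : ℂ) R).exists_forall_hasDerivWithinAt hu₁
  obtain ⟨h₂, hh₂⟩ := (convex_ball (0 : ℂ) r⁻¹).exists_forall_hasDerivWithinAt hdslope
  refine ⟨κ 0, h₁, h₂, fun z hz => (hh₁ z hz).differentiableWithinAt,
    fun z hz => (hh₂ z hz).differentiableWithinAt, fun z hrz hzR => ?_⟩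
  have hz0 : z ≠ 0 := norm_pos_iff.1 (hr.trans hrz)
  have hz : z ∈ Metric.ball (0 : ℂ) R := by simpa using hzR
  have hzinv : z⁻¹ ∈ Metric.ball (0 : ℂ) r⁻¹ := by
    rw [mem_ball_zero_iff, norm_inv]
    exact inv_strictAnti₀ hr hrz
  have hd₁ := (hh₁ z hz).hasDerivAt (Metric.isOpen_ball.mem_nhds hz)
  have hd₂ := (hh₂ z⁻¹ hzinv).hasDerivAt (Metric.isOpen_ball.mem_nhds hzinv)
  refine (hd₁.add (hd₂.comp z (hasDerivAt_inv hz0))).congr_deriv ?_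
  rw [hsplit z hrz hzR, dslope_of_ne _ (inv_ne_zero hz0), slope_def_field]
  field_simp
  ring

theorem exists_mul_split_annulus {G : ℂ → ℂ} {r R : ℝ} (hr : 0 < r) (hrR : r < R)
    (hG : ∀ z : ℂ, r ≤ ‖z‖ → ‖z‖ ≤ R → AnalyticAt ℂ G z)
    (hG0 : ∀ z : ℂ, r ≤ ‖z‖ → ‖z‖ ≤ R → G z ≠ 0) :
    ∃ (n : ℤ) (A B : ℂ → ℂ), DifferentiableOn ℂ A (Metric.ball 0 R) ∧ (∀ z, A z ≠ 0) ∧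
      DifferentiableOn ℂ B (Metric.ball 0 r⁻¹) ∧ (∀ z, B z ≠ 0) ∧
      ∀ z : ℂ, r < ‖z‖ → ‖z‖ < R → G z = z ^ n * A z * B z⁻¹ := by
  obtain ⟨k, h₁, h₂, hh₁, hh₂, hderiv⟩ := exists_hasDerivAt_split_annulus
    (u := fun z => deriv G z / G z) hr hrR fun z hrz hzR =>
      (hG z hrz hzR).deriv.differentiableAt.div (hG z hrz hzR).differentiableAt (hG0 z hrz hzR)
  -- The exponential removes everything but the residue `k` from the logarithmic derivative.
  set φ : ℂ → ℂ := fun z => G z * exp (-(h₁ z + h₂ z⁻¹)) with hφ_def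
  have hφ : ∀ z : ℂ, r < ‖z‖ → ‖z‖ < R → HasDerivAt φ (k / z * φ z) z := fun z hrz hzR => by
    refine ((hG z hrz.le hzR.le).differentiableAt.hasDerivAt.mul
      (hderiv z hrz hzR).neg.cexp).congr_deriv ?_
    have hGz := hG0 z hrz.le hzR.le
    simp only [φ, Pi.neg_apply]
    field_simp
    ring
  obtain ⟨n, c, hc, hφc⟩ := exists_eq_mul_zpow_of_hasDerivAt hr hrR hφ
    fun z hrz hzR => mul_ne_zero (hG0 z hrz.le hzR.le) (exp_ne_zero _)
  refine ⟨n, fun z => c * exp (h₁ z), fun z => exp (h₂ z), hh₁.cexp.const_mul c,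
    fun z => mul_ne_zero hc (exp_ne_zero _), hh₂.cexp, fun z => exp_ne_zero _,
    fun z hrz hzR => ?_⟩
  calc G z = φ z * exp (h₁ z + h₂ z⁻¹) := by
        rw [hφ_def, mul_assoc, ← exp_add, neg_add_cancel, exp_zero, mul_one]
    _ = z ^ n * (c * exp (h₁ z)) * exp (h₂ z⁻¹) := by rw [hφc z hrz hzR, exp_add]; ring

end Annulus

/-! ### Meromorphic sections of line bundles on the Riemann sphere -/

section LineBundle

/-- The quotients `g a / g b` are transition functions of a holomorphic line bundle on the Riemann
sphere; the value `g a y` is meant to be that of a nonvanishing local section near `a`. -/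
structure IsTransitionFamily (g : OnePoint ℂ → OnePoint ℂ → ℂ) : Prop where
  ne_zero : ∀ a, g a a ≠ 0
  eventually_hol : ∀ a, ∀ᶠ b in 𝓝 a, g a b ≠ 0 ∧ Hol (fun y => g a y / g b y) b

/-- `f` is a frame near `a` of the line bundle given by `g`, by way of its multiples of the local
sections `g b`. -/
def IsLineFrame (g : OnePoint ℂ → OnePoint ℂ → ℂ) (f : OnePoint ℂ → ℂ) (a : OnePoint ℂ) : Prop :=
  Hol (fun y => f y * g a y) a ∧ f a ≠ 0

variable {g : OnePoint ℂ → OnePoint ℂ → ℂ} {f f₁ f₂ k : OnePoint ℂ → ℂ} {a : OnePoint ℂ}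

theorem IsTransitionFamily.eventually_ne (hg : IsTransitionFamily g) (a : OnePoint ℂ) :
    ∀ᶠ y in 𝓝 a, g a y ≠ 0 :=
  (hg.eventually_hol a).mono fun _ hb => hb.1

namespace IsLineFrame

theorem div (hg : IsTransitionFamily g) (h₁ : IsLineFrame g f₁ a) (h₂ : IsLineFrame g f₂ a) :
    Hol (fun y => f₁ y / f₂ y) a ∧ f₁ a / f₂ a ≠ 0 := by
  refine ⟨(h₁.1.div h₂.1 (mul_ne_zero h₂.2 (hg.ne_zero a))).congr ?_, div_ne_zero h₁.2 h₂.2⟩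
  filter_upwards [hg.eventually_ne a] with y hy
  rw [mul_div_mul_right _ _ hy]

theorem mul (hf : IsLineFrame g f a) (hk : Hol k a) (hk0 : k a ≠ 0) :
    IsLineFrame g (fun y => k y * f y) a :=
  ⟨by simpa only [mul_assoc] using hk.mul hf.1, mul_ne_zero hk0 hf.2⟩

theorem congr (hf : IsLineFrame g f₁ a) (h : f₁ =ᶠ[𝓝 a] f₂) : IsLineFrame g f₂ a :=
  ⟨hf.1.congr (h.mono fun y hy => congrArg (· * g a y) hy), h.self_of_nhds ▸ hf.2⟩

theorem hasOrderAt (hf : IsLineFrame g f a) (hg : IsTransitionFamily g) :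
    HasOrderAt (fun y => f y * g a y) a 0 :=
  .of_hol hf.1 (mul_ne_zero hf.2 (hg.ne_zero a))

end IsLineFrame

theorem IsTransitionFamily.isFrameClass (hg : IsTransitionFamily g) (p : OnePoint ℂ) :
    IsFrameClass fun z f => IsLineFrame g (fun y => f (chartAt ℂ p y)) ((chartAt ℂ p).symm z) where
  exists_local z := by
    set a := (chartAt ℂ p).symm z
    refine ⟨fun w => (g a ((chartAt ℂ p).symm w))⁻¹, ?_⟩
    have hloc := hg.eventually_hol a
    rw [← map_chart_symm_nhds, eventually_map] at hloc
    filter_upwards [hloc] with w hw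
    refine ⟨(hw.2.inv (div_ne_zero hw.1 (hg.ne_zero _))).congr ?_,
      inv_ne_zero (by rw [chart_apply_symm]; exact hw.1)⟩
    filter_upwards [(chartAt ℂ p).open_source.mem_nhds (chart_symm_mem_source p w)] with y hy
    rw [(chartAt ℂ p).left_inv hy, inv_div, div_eq_inv_mul]
  div h₁ h₂ := by
    obtain ⟨hol, hne⟩ := h₁.div hg h₂
    simp only [chart_apply_symm] at hne
    exact ⟨hol_comp_chart_iff.1 hol, hne⟩
  mul hf hk hk0 := hf.mul (hol_comp_chart_iff.2 hk) (by rwa [chart_apply_symm])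
  congr {w _ _} hf h := by
    refine hf.congr ?_
    have hcont := (chartAt ℂ p).continuousAt (chart_symm_mem_source p w)
    rw [ContinuousAt, chart_apply_symm] at hcont
    exact hcont.eventually h

theorem IsTransitionFamily.exists_isLineFrame_chart_ball (hg : IsTransitionFamily g)
    (p : OnePoint ℂ) {r : ℝ} (hr : 0 ≤ r) :
    ∃ f, ∀ z ∈ Metric.ball (0 : ℂ) r, IsLineFrame g f ((chartAt ℂ p).symm z) :=
  let ⟨_, hf⟩ := (hg.isFrameClass p).exists_on_ball hr
  ⟨_, hf⟩

theorem hol_comp_affineChart {A : ℂ → ℂ} {s : Set ℂ} (hs : IsOpen s) (hA : DifferentiableOn ℂ A s)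
    {z : ℂ} (hz : z ∈ s) : Hol (fun y => A (affineChart y)) (z : OnePoint ℂ) :=
  hol_comp_chart_iff (a := ((0 : ℂ) : OnePoint ℂ)).2 (hA.analyticAt (hs.mem_nhds hz))

theorem hol_comp_inftyChart {B : ℂ → ℂ} {s : Set ℂ} (hs : IsOpen s) (hB : DifferentiableOn ℂ B s)
    {t : ℂ} (ht : t ∈ s) : Hol (fun y => B (inftyChart y)) (inv (t : OnePoint ℂ)) :=
  inftyChart_symm_apply t ▸ hol_comp_chart_iff (a := ∞).2 (hB.analyticAt (hs.mem_nhds ht))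

theorem inv_coe_inv {z : ℂ} (hz : z ≠ 0) : inv ((z⁻¹ : ℂ) : OnePoint ℂ) = z := by
  rw [inv_coe (inv_ne_zero hz), _root_.inv_inv]

theorem IsTransitionFamily.exists_isLineFrame_zpow (hg : IsTransitionFamily g) :
    ∃ (n : ℤ) (P Q : OnePoint ℂ → ℂ), (∀ z : ℂ, ‖z‖ < 2 → IsLineFrame g P z) ∧
      (∀ t : ℂ, ‖t‖ < 2 → IsLineFrame g Q (inv (t : OnePoint ℂ))) ∧
      ∀ z : ℂ, 2⁻¹ < ‖z‖ → ‖z‖ < 2 → P z = z ^ n * Q z := by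
  obtain ⟨f₁, hf₁⟩ := hg.exists_isLineFrame_chart_ball ((0 : ℂ) : OnePoint ℂ) (r := 3)
    (by norm_num)
  obtain ⟨f₂, hf₂⟩ := hg.exists_isLineFrame_chart_ball ∞ (r := 3) (by norm_num)
  simp only [chartAt_coe, affineChart_symm_apply, mem_ball_zero_iff] at hf₁
  simp only [chartAt_infty, inftyChart_symm_apply, mem_ball_zero_iff] at hf₂
  have hratio : ∀ z : ℂ, 2⁻¹ ≤ ‖z‖ → ‖z‖ ≤ 2 →
      Hol (fun y => f₁ y / f₂ y) z ∧ f₁ z / f₂ z ≠ 0 := fun z h₁ h₂ => by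
    refine (hf₁ z (by linarith)).div hg ?_
    have hz0 : z ≠ 0 := norm_pos_iff.1 (by linarith)
    rw [← inv_coe_inv hz0]
    refine hf₂ _ ?_
    rw [norm_inv, inv_lt_comm₀ (by linarith) (by norm_num)]
    linarith
  obtain ⟨n, A, B, hA, hA0, hB, hB0, hAB⟩ := exists_mul_split_annulus (r := 2⁻¹) (R := 2)
    (by norm_num) (by norm_num) (fun z h₁ h₂ => hol_coe_iff.1 (hratio z h₁ h₂).1)
    fun z h₁ h₂ => (hratio z h₁ h₂).2
  rw [_root_.inv_inv] at hB
  refine ⟨n, fun y => (A (affineChart y))⁻¹ * f₁ y, fun y => B (inftyChart y) * f₂ y,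
    fun z hz => ?_, fun t ht => ?_, fun z h₁ h₂ => ?_⟩
  · exact (hf₁ z (by linarith)).mul
      ((hol_comp_affineChart Metric.isOpen_ball hA (by simpa using hz)).inv (hA0 _))
      (inv_ne_zero (hA0 _))
  · exact (hf₂ t (by linarith)).mul
      (hol_comp_inftyChart Metric.isOpen_ball hB (by simpa using ht)) (hB0 _)
  · have hf₂0 : f₂ z ≠ 0 := (div_ne_zero_iff.1 (hratio z h₁.le h₂.le).2).2
    have hsplit := hAB z h₁ h₂
    rw [div_eq_iff hf₂0] at hsplit
    have hz0 : z ≠ 0 := norm_pos_iff.1 ((by norm_num : (0 : ℝ) < 2⁻¹).trans h₁)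
    simp only [inftyChart_coe hz0, affineChart_coe, hsplit]
    field_simp [hA0 z]

theorem IsTransitionFamily.exists_meromorphic_section (hg : IsTransitionFamily g) :
    ∃ (c : OnePoint ℂ → ℂ) (m : OnePoint ℂ →₀ ℤ),
      ∀ a, HasOrderAt (fun y => c y * g a y) a (m a) := by
  classical
  obtain ⟨n, P, Q, hP, hQ, hPQ⟩ := hg.exists_isLineFrame_zpow
  set U : Set (OnePoint ℂ) := {y | ∃ z : ℂ, y = z ∧ ‖z‖ < 2}
  set c : OnePoint ℂ → ℂ := fun y => if y ∈ U then P y else linearCoord 0 y ^ n * Q y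
  have hcP : ∀ z : ℂ, ‖z‖ < 2 → c z = P z := fun z hz => if_pos ⟨z, rfl, hz⟩
  have hcQ : ∀ z : ℂ, 2⁻¹ < ‖z‖ → c z = linearCoord 0 z ^ n * Q z := fun z hz => by
    by_cases hz2 : ‖z‖ < 2
    · rw [hcP z hz2, hPQ z hz hz2, linearCoord, OnePoint.elim_some, sub_zero]
    · exact if_neg fun ⟨w, hw, hw2⟩ => hz2 (OnePoint.coe_injective hw ▸ hw2)
  refine ⟨c, Finsupp.single ∞ (-n), fun a => ?_⟩
  induction a using OnePoint.rec with
  | coe z =>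
    rw [Finsupp.single_eq_of_ne (by simp)]
    by_cases hz : ‖z‖ < 2
    · refine IsLineFrame.hasOrderAt ((hP z hz).congr ?_) hg
      rw [EventuallyEq, OnePoint.nhds_coe_eq, eventually_map]
      filter_upwards [(isOpen_lt continuous_norm continuous_const).mem_nhds hz] with w hw
      exact (hcP w hw).symm
    · have hz1 : 2⁻¹ < ‖z‖ := lt_of_lt_of_le (by norm_num) (not_lt.1 hz)
      have hz0 : z ≠ 0 := norm_pos_iff.1 (by linarith)
      have hQz := hQ z⁻¹ (by rw [norm_inv, inv_lt_comm₀ (by linarith) (by norm_num)]; exact hz1)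
      rw [inv_coe_inv hz0] at hQz
      have hzpow : Hol (fun y => linearCoord 0 y ^ n) (z : OnePoint ℂ) := hol_coe_iff.2 <| by
        simpa [linearCoord] using analyticAt_id.fun_zpow hz0 (n := n)
      refine IsLineFrame.hasOrderAt ((hQz.mul hzpow ?_).congr ?_) hg
      · exact zpow_ne_zero _ (by simpa [linearCoord] using hz0)
      · rw [EventuallyEq, OnePoint.nhds_coe_eq, eventually_map]
        filter_upwards [(isOpen_lt continuous_const continuous_norm).mem_nhds hz1] with w hw
        exact (hcQ w hw).symm
  | infty =>
    have hQinf := hQ 0 (by simp)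
    rw [RiemannSphere.inv_zero] at hQinf
    have horder := ((hasOrderAt_linearCoord_infty 0).zpow n).mul (hQinf.hasOrderAt hg)
    rw [mul_neg_one, add_zero] at horder
    rw [Finsupp.single_eq_same]
    refine horder.congr ?_
    rw [EventuallyEq, OnePoint.nhdsNE_infty_eq, eventually_map, coclosedCompact_eq_cocompact]
    filter_upwards [(isCompact_closedBall (0 : ℂ) 2⁻¹).compl_mem_cocompact] with z hz
    rw [hcQ z (by simpa using hz), mul_assoc]

end LineBundle

/-! ### Local frames and the existence of degrees -/

namespace HolVectorBundle

variable {n : ℕ} (E : HolVectorBundle n)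

/-- The open set over which the preferred trivialization at `a` is defined. -/
def base (a : OnePoint ℂ) : Set (OnePoint ℂ) := (trivializationAt (Fin n → ℂ) E.Fib a).baseSet

/-- The coordinates of a vector in the preferred trivialization at `a`; they are `0` over points
outside `E.base a`. -/
noncomputable def coord (a y : OnePoint ℂ) : E.Fib y →ₗ[ℂ] (Fin n → ℂ) :=
  (trivializationAt (Fin n → ℂ) E.Fib a).linearMapAt ℂ y

/-- The vector with given coordinates in the preferred trivialization at `a`; it is `0` over points
outside `E.base a`. -/
noncomputable def lift (a y : OnePoint ℂ) : (Fin n → ℂ) →ₗ[ℂ] E.Fib y :=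
  (trivializationAt (Fin n → ℂ) E.Fib a).symmₗ ℂ y

theorem base_mem_nhds_of_mem {a b : OnePoint ℂ} (hb : b ∈ E.base a) : E.base a ∈ 𝓝 b :=
  (trivializationAt (Fin n → ℂ) E.Fib a).open_baseSet.mem_nhds hb

theorem mem_base_self (a : OnePoint ℂ) : a ∈ E.base a := FiberBundle.mem_baseSet_trivializationAt' a

theorem base_mem_nhds (a : OnePoint ℂ) : E.base a ∈ 𝓝 a :=
  E.base_mem_nhds_of_mem (E.mem_base_self a)

variable {E}

theorem coord_lift {a y : OnePoint ℂ} (hy : y ∈ E.base a) (v : Fin n → ℂ) :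
    E.coord a y (E.lift a y v) = v :=
  (trivializationAt (Fin n → ℂ) E.Fib a).linearMapAt_symmₗ hy v

theorem lift_coord {a y : OnePoint ℂ} (hy : y ∈ E.base a) (v : E.Fib y) :
    E.lift a y (E.coord a y v) = v :=
  (trivializationAt (Fin n → ℂ) E.Fib a).symmₗ_linearMapAt hy v

/-- `coord` as a linear equivalence. -/
noncomputable def coordEquiv {a y : OnePoint ℂ} (hy : y ∈ E.base a) :
    E.Fib y ≃ₗ[ℂ] (Fin n → ℂ) :=
  LinearEquiv.ofLinearMap (E.coord a y) (E.lift a y) (LinearMap.ext (coord_lift hy))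
    (LinearMap.ext (lift_coord hy))

instance (y : OnePoint ℂ) : FiniteDimensional ℂ (E.Fib y) :=
  (coordEquiv (E.mem_base_self y)).symm.finiteDimensional

theorem finrank_fib (y : OnePoint ℂ) : finrank ℂ (E.Fib y) = n := by
  rw [(coordEquiv (E.mem_base_self y)).finrank_eq, finrank_fin_fun]

theorem holAt_iff {a b : OnePoint ℂ} (hb : b ∈ E.base a) {s : ∀ x, E.Fib x} :
    E.HolAt s b ↔ Hol (fun y => E.coord a y (s y)) b := by
  rw [HolAt, (trivializationAt (Fin n → ℂ) E.Fib a).contMDiffAt_section_iff hb]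
  refine Filter.EventuallyEq.contMDiffAt_iff ?_
  filter_upwards [E.base_mem_nhds_of_mem hb] with y hy
  rw [coord, Trivialization.coe_linearMapAt_of_mem _ hy]

theorem holAt_lift {a b : OnePoint ℂ} (hb : b ∈ E.base a) {f : OnePoint ℂ → Fin n → ℂ}
    (hf : Hol f b) : E.HolAt (fun y => E.lift a y (f y)) b := by
  rw [holAt_iff hb]
  refine hf.congr ?_
  filter_upwards [E.base_mem_nhds_of_mem hb] with y hy
  rw [coord_lift hy]

theorem HolAt.eventually {a : OnePoint ℂ} {s : ∀ x, E.Fib x} (hs : E.HolAt s a) :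
    ∀ᶠ b in 𝓝 a, E.HolAt s b := by
  rw [holAt_iff (E.mem_base_self a)] at hs
  filter_upwards [hs.eventually, E.base_mem_nhds a] with b hb hb'
  rwa [holAt_iff hb']

theorem IsFrameAt.eventually {N : ∀ x, Submodule ℂ (E.Fib x)} {r : ℕ} {s : Fin r → ∀ x, E.Fib x}
    {a : OnePoint ℂ} (hs : E.IsFrameAt N s a) : ∀ᶠ b in 𝓝 a, E.IsFrameAt N s b := by
  filter_upwards [eventually_all.2 fun i => (hs.1 i).eventually, hs.2.eventually_nhds] with b h₁ h₂
  exact ⟨h₁, h₂⟩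

end HolVectorBundle

theorem exists_alternatingMap_eq_mul_of_span_eq {K M : Type*} [Field K] [AddCommGroup M]
    [Module K M] {r : ℕ} {s s' : Fin r → M} (hs : LinearIndependent K s)
    (hs' : LinearIndependent K s')
    (h : Submodule.span K (Set.range s') = Submodule.span K (Set.range s)) :
    ∃ D : K, D ≠ 0 ∧ ∀ w : M [⋀^Fin r]→ₗ[K] K, w s' = D * w s := by
  set b := Basis.span hs
  set b' := (Basis.span hs').map (LinearEquiv.ofEq _ _ h)
  have hb : (fun i => (Submodule.span K (Set.range s)).subtype (b i)) = s := by
    ext i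
    simp [b, Basis.span_apply]
  have hb' : (fun i => (Submodule.span K (Set.range s)).subtype (b' i)) = s' := by
    ext i
    simp [b', Basis.span_apply]
  refine ⟨b.det b', (b.isUnit_det b').ne_zero, fun w => ?_⟩
  have hdet := (w.compLinearMap (Submodule.subtype _)).eq_smul_basis_det b
  have := congrArg (fun f => f b') hdet
  simp only [AlternatingMap.compLinearMap_apply, AlternatingMap.smul_apply, smul_eq_mul] at this
  rwa [hb, hb', mul_comm] at this

namespace HolVectorBundle

variable {n r : ℕ} {E : HolVectorBundle n} {N : ∀ x, Submodule ℂ (E.Fib x)} {a : OnePoint ℂ}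
  {s s' : Fin r → ∀ x, E.Fib x}

theorem IsFrameAt.exists_form_eq_mul (hs : E.IsFrameAt N s a) (hs' : E.IsFrameAt N s' a) :
    ∃ D : ℂ, D ≠ 0 ∧ ∀ w : E.Fib a [⋀^Fin r]→ₗ[ℂ] ℂ,
      w (fun i => s' i a) = D * w (fun i => s i a) :=
  exists_alternatingMap_eq_mul_of_span_eq hs.2.self_of_nhds.1 hs'.2.self_of_nhds.1
    (hs'.2.self_of_nhds.2.trans hs.2.self_of_nhds.2.symm)

/-- `η` is a holomorphic family of `r`-forms near `a` that restricts to a volume form on the fibre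
of the rank-`r` subbundle `N` at `a`. -/
structure IsVolumeFormAt (N : ∀ x, Submodule ℂ (E.Fib x)) (η : ∀ y, E.Fib y [⋀^Fin r]→ₗ[ℂ] ℂ)
    (a : OnePoint ℂ) : Prop where
  ne_zero : ∀ {s : Fin r → ∀ x, E.Fib x}, E.IsFrameAt N s a → η a (fun i => s i a) ≠ 0
  hol : ∀ {s : Fin r → ∀ x, E.Fib x}, (∀ i, E.HolAt (s i) a) → Hol (fun y => η y fun i => s i y) a

theorem IsFrameAt.exists_isVolumeFormAt (hs : E.IsFrameAt N s a) :
    ∃ η : ∀ y, E.Fib y [⋀^Fin r]→ₗ[ℂ] ℂ, IsVolumeFormAt N η a := by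
  have hli : LinearIndependent ℂ fun i => E.coord a a (s i a) :=
    hs.2.self_of_nhds.1.map' _ (LinearMap.ker_eq_bot.2 (coordEquiv (E.mem_base_self a)).injective)
  obtain ⟨L, hL⟩ := LinearMap.exists_leftInverse_of_injective
    (Fintype.linearCombination ℂ fun i => E.coord a a (s i a))
    (LinearMap.ker_eq_bot.2 hli.fintypeLinearCombination_injective)
  have hLs : (fun i => (L ∘ₗ E.coord a a) (s i a)) = Pi.basisFun ℂ (Fin r) := by
    ext i : 1
    have := LinearMap.congr_fun hL (Pi.single i 1)
    simpa [Fintype.linearCombination_apply_single] using this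
  refine ⟨fun y => (Pi.basisFun ℂ (Fin r)).det.compLinearMap (L ∘ₗ E.coord a y),
    fun {s'} hs' => ?_, fun {t} ht => ?_⟩
  · obtain ⟨D, hD, hsD⟩ := hs.exists_form_eq_mul hs'
    rw [hsD]
    refine mul_ne_zero hD ?_
    rw [AlternatingMap.compLinearMap_apply, hLs, Basis.det_self]
    exact one_ne_zero
  · simp only [AlternatingMap.compLinearMap_apply, Basis.det_apply]
    exact Hol.det fun i j => ((holAt_iff (E.mem_base_self a)).1 (ht j)).linearMap
      (LinearMap.proj i ∘ₗ L)

theorem IsVolumeFormAt.eventually_eq_div_mul {η : ∀ y, E.Fib y [⋀^Fin r]→ₗ[ℂ] ℂ}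
    (hη : IsVolumeFormAt N η a) (hs : E.IsFrameAt N s a) (hs' : E.IsFrameAt N s' a) :
    ∀ᶠ y in 𝓝 a, ∀ w : E.Fib y [⋀^Fin r]→ₗ[ℂ] ℂ, w (fun i => s' i y) =
      η y (fun i => s' i y) / η y (fun i => s i y) * w (fun i => s i y) := by
  filter_upwards [hs.eventually, hs'.eventually, (hη.hol hs.1).eventually_ne (hη.ne_zero hs)]
    with y hsy hsy' hne w
  obtain ⟨D, -, hD⟩ := hsy.exists_form_eq_mul hsy'
  rw [hD, hD, mul_div_assoc, div_self hne, mul_one]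

theorem IsSubbundle.exists_hasDegree (hN : E.IsSubbundle N r) : ∃ d, E.HasDegree N r d := by
  choose S hS using hN
  choose η hη using fun a => (hS a).exists_isVolumeFormAt
  have hg : IsTransitionFamily fun b y => η y y (fun i => S b i y) := by
    refine ⟨fun a => (hη a).ne_zero (hS a), fun a => ?_⟩
    filter_upwards [(hS a).eventually] with b hb
    refine ⟨(hη b).ne_zero hb, (((hη b).hol hb.1).div ((hη b).hol (hS b).1)
      ((hη b).ne_zero (hS b))).congr ?_⟩
    filter_upwards [(hη b).eventually_eq_div_mul (hS b) hb, (hS b).eventually] with y hy hy'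
    rw [hy (η y y), mul_div_assoc, div_self ((hη y).ne_zero hy'), mul_one]
  obtain ⟨c, m, hcm⟩ := hg.exists_meromorphic_section
  refine ⟨_, fun y => c y • η y y, m, fun a s hs => ?_, rfl⟩
  have horder := (hcm a).mul (HasOrderAt.of_hol
    (((hη a).hol hs.1).div ((hη a).hol (hS a).1) ((hη a).ne_zero (hS a)))
    (div_ne_zero ((hη a).ne_zero hs) ((hη a).ne_zero (hS a))))
  rw [add_zero] at horder
  refine horder.congr (eventually_nhdsWithin_of_eventually_nhds ?_)
  filter_upwards [(hη a).eventually_eq_div_mul (hS a) hs] with y hy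
  rw [AlternatingMap.smul_apply, smul_eq_mul, hy (η y y)]
  ring

theorem IsSubbundle.hasDegree (hN : E.IsSubbundle N r) : E.HasDegree N r (E.degree N r) :=
  Classical.epsilon_spec hN.exists_hasDegree

end HolVectorBundle

/-! ### The normal form of a matrix of holomorphic functions -/

theorem exists_basis_smithNormalForm {R M N m n : Type*} [CommRing R] [IsDomain R]
    [IsPrincipalIdealRing R] [AddCommGroup M] [Module R M] [AddCommGroup N] [Module R N]
    [Finite m] [Finite n] (φ : N →ₗ[R] M) (b : Basis n R N) (c : Basis m R M) :
    ∃ (r t : ℕ) (σ : Fin r ⊕ Fin t ≃ n) (f : Fin r ↪ m) (b' : Basis n R N) (c' : Basis m R M)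
      (d : Fin r → R), (∀ i, d i ≠ 0) ∧ (∀ i, φ (b' (σ (Sum.inl i))) = d i • c' (f i)) ∧
      ∀ j, φ (b' (σ (Sum.inr j))) = 0 := by
  obtain ⟨r, c', bR, f, d, snf⟩ := (LinearMap.range φ).smithNormalForm c
  have : Module.Free R N := .of_basis b
  have : Module.Finite R N := .of_basis b
  let bK := Module.finBasis R (LinearMap.ker φ)
  let bQ := bR.map φ.quotKerEquivRange.symm
  let e := bK.sumQuot bQ
  let σ := (e.reindex (Equiv.sumComm _ _)).indexEquiv b
  refine ⟨r, _, σ, f, e.reindex ((Equiv.sumComm _ _).trans σ), c', d, fun i hi => ?_, fun i => ?_,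
    fun j => ?_⟩
  · have h := snf i
    rw [hi, zero_smul] at h
    exact bR.ne_zero i (Subtype.ext h)
  · have h : (LinearMap.ker φ).mkQ (e (Sum.inr i)) = bQ i := Basis.sumQuot_inr bK bQ i
    have h' := congrArg (fun x => (φ.quotKerEquivRange x : M)) h
    simpa [bQ, snf] using h'
  · have h : φ (e (Sum.inl j)) = 0 := by
      rw [Basis.sumQuot_inl]
      exact (bK j).2
    simpa using h

theorem exists_smithNormalForm_matrix {R m n : Type*} [CommRing R] [IsDomain R]
    [IsPrincipalIdealRing R] [Fintype m] [DecidableEq m] [Fintype n] [DecidableEq n]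
    (A : Matrix m n R) :
    ∃ (r t : ℕ) (σ : Fin r ⊕ Fin t ≃ n) (f : Fin r ↪ m) (P P' : Matrix n n R)
      (Q Q' : Matrix m m R) (d : Fin r → R), P' * P = 1 ∧ Q' * Q = 1 ∧
      (∀ i, d i ≠ 0) ∧ (∀ i k, (A * P) k (σ (Sum.inl i)) = d i * Q k (f i)) ∧
      ∀ j k, (A * P) k (σ (Sum.inr j)) = 0 := by
  obtain ⟨r, t, σ, f, bN, bM, d, hd, hinl, hinr⟩ := exists_basis_smithNormalForm A.toLin' 
    (Pi.basisFun R n) (Pi.basisFun R m)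
  have hmul (i k) : (A * (Pi.basisFun R n).toMatrix bN) k i = A.toLin' (bN i) k := by
    simp [Matrix.mul_apply, Matrix.toLin'_apply, Matrix.mulVec, dotProduct, Basis.toMatrix_apply]
  refine ⟨r, t, σ, f, (Pi.basisFun R n).toMatrix bN, bN.toMatrix (Pi.basisFun R n),
    (Pi.basisFun R m).toMatrix bM, bM.toMatrix (Pi.basisFun R m), d,
    Basis.toMatrix_mul_toMatrix_flip _ _, Basis.toMatrix_mul_toMatrix_flip _ _, hd,
    fun i k => ?_, fun j k => ?_⟩
  · simp [hmul, hinl, Basis.toMatrix_apply]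
  · simp [hmul, hinr]

/-- The ring of germs of holomorphic functions at a point of the plane. -/
def analyticGerm (z₀ : ℂ) : Subring (Germ (𝓝 z₀) ℂ) where
  carrier := {φ | ∃ f : ℂ → ℂ, AnalyticAt ℂ f z₀ ∧ (f : Germ (𝓝 z₀) ℂ) = φ}
  mul_mem' := by
    rintro _ _ ⟨f, hf, rfl⟩ ⟨g, hg, rfl⟩
    exact ⟨f * g, hf.mul hg, rfl⟩
  one_mem' := ⟨1, analyticAt_const, rfl⟩
  add_mem' := by
    rintro _ _ ⟨f, hf, rfl⟩ ⟨g, hg, rfl⟩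
    exact ⟨f + g, hf.add hg, rfl⟩
  zero_mem' := ⟨0, analyticAt_const, rfl⟩
  neg_mem' := by
    rintro _ ⟨f, hf, rfl⟩
    exact ⟨-f, hf.neg, rfl⟩

namespace analyticGerm

variable {z₀ : ℂ}

/-- The germ of an analytic function. -/
noncomputable def mk (f : ℂ → ℂ) (hf : AnalyticAt ℂ f z₀) : analyticGerm z₀ := ⟨f, f, hf, rfl⟩

/-- A representative of a germ. -/
noncomputable def rep (x : analyticGerm z₀) : ℂ → ℂ := x.2.choose

theorem analyticAt_rep (x : analyticGerm z₀) : AnalyticAt ℂ (rep x) z₀ := x.2.choose_spec.1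

theorem coe_rep (x : analyticGerm z₀) : (rep x : Germ (𝓝 z₀) ℂ) = x := x.2.choose_spec.2

theorem rep_eventuallyEq_iff {x : analyticGerm z₀} {f : ℂ → ℂ} :
    rep x =ᶠ[𝓝 z₀] f ↔ (x : Germ (𝓝 z₀) ℂ) = f := by
  rw [← Germ.coe_eq, coe_rep]

theorem rep_mk {f : ℂ → ℂ} (hf : AnalyticAt ℂ f z₀) : rep (mk f hf) =ᶠ[𝓝 z₀] f :=
  rep_eventuallyEq_iff.2 rfl

theorem rep_zero : rep (0 : analyticGerm z₀) =ᶠ[𝓝 z₀] 0 := rep_eventuallyEq_iff.2 rfl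

theorem rep_one : rep (1 : analyticGerm z₀) =ᶠ[𝓝 z₀] 1 := rep_eventuallyEq_iff.2 rfl

theorem rep_mul (x y : analyticGerm z₀) : rep (x * y) =ᶠ[𝓝 z₀] rep x * rep y := by
  rw [rep_eventuallyEq_iff, Germ.coe_mul, coe_rep, coe_rep, Subring.coe_mul]

theorem rep_sum {ι : Type*} (s : Finset ι) (x : ι → analyticGerm z₀) :
    rep (∑ i ∈ s, x i) =ᶠ[𝓝 z₀] ∑ i ∈ s, rep (x i) := by
  rw [rep_eventuallyEq_iff]
  have h := map_sum (Germ.coeRingHom (𝓝 z₀)) (fun i => rep (x i)) s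
  simp only [Germ.coe_coeRingHom, coe_rep] at h
  rw [h]
  push_cast
  rfl

theorem eq_zero_iff {x : analyticGerm z₀} : x = 0 ↔ ∀ᶠ z in 𝓝 z₀, rep x z = 0 :=
  Subtype.ext_iff.trans (rep_eventuallyEq_iff (f := 0)).symm

theorem ne_zero_iff {x : analyticGerm z₀} : x ≠ 0 ↔ ∀ᶠ z in 𝓝[≠] z₀, rep x z ≠ 0 := by
  rw [Ne, eq_zero_iff]
  refine ⟨(analyticAt_rep x).eventually_eq_zero_or_eventually_ne_zero.resolve_left,
    fun hne hzero => ?_⟩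
  obtain ⟨z, hz, hz'⟩ := (hne.and (hzero.filter_mono nhdsWithin_le_nhds)).exists
  exact hz hz'

instance : IsDomain (analyticGerm z₀) := by
  have : NoZeroDivisors (analyticGerm z₀) := ⟨fun {x y} hxy => by
    by_contra! h
    have hmul : ∀ᶠ z in 𝓝 z₀, rep x z * rep y z = 0 :=
      (rep_mul x y).symm.trans (hxy ▸ rep_zero)
    obtain ⟨z, hz, hx, hy⟩ := ((hmul.filter_mono nhdsWithin_le_nhds).and
      ((ne_zero_iff.1 h.1).and (ne_zero_iff.1 h.2))).exists
    exact mul_ne_zero hx hy hz⟩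
  exact NoZeroDivisors.to_isDomain _

variable (z₀) in
/-- The germ of `z - z₀`. -/
noncomputable def uniformizer : analyticGerm z₀ := mk (fun z => z - z₀) (by fun_prop)

theorem exists_associated_uniformizer_pow {x : analyticGerm z₀} (hx : x ≠ 0) :
    ∃ n : ℕ, Associated (uniformizer z₀ ^ n) x := by
  obtain ⟨n, g, hg, hg0, hxg⟩ := (analyticAt_rep x).exists_eventuallyEq_pow_smul_nonzero_iff.2
    fun h => hx (eq_zero_iff.2 h)
  have hu : mk g hg * mk (fun z => (g z)⁻¹) (hg.fun_inv hg0) = 1 := by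
    refine Subtype.ext (Germ.coe_eq.2 ?_)
    filter_upwards [hg.continuousAt.eventually_ne hg0] with z hz
    exact mul_inv_cancel₀ hz
  refine ⟨n, ⟨mk g hg, mk _ _, hu, by rw [mul_comm, hu]⟩,
    Subtype.ext ((rep_eventuallyEq_iff.1 ?_).symm)⟩
  filter_upwards [hxg] with z hz
  simp [hz]

instance : IsPrincipalIdealRing (analyticGerm z₀) where
  principal I := by
    classical
    by_cases hI : ∃ n, uniformizer z₀ ^ n ∈ I
    · refine ⟨uniformizer z₀ ^ Nat.find hI, le_antisymm (fun x hx => ?_)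
        ((Ideal.span_singleton_le_iff_mem I).2 (Nat.find_spec hI))⟩
      by_cases hx0 : x = 0
      · rw [hx0]
        exact Submodule.zero_mem _
      · obtain ⟨m, hm⟩ := exists_associated_uniformizer_pow hx0
        have hfind : Nat.find hI ≤ m := Nat.find_min' hI (I.mem_of_dvd hm.dvd' hx)
        exact Ideal.mem_span_singleton.2 ((pow_dvd_pow _ hfind).trans hm.dvd)
    · refine ⟨0, ?_⟩
      rw [Submodule.span_zero_singleton, eq_bot_iff]
      intro x hx
      by_contra hx0
      obtain ⟨m, hm⟩ := exists_associated_uniformizer_pow hx0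
      exact hI ⟨m, I.mem_of_dvd hm.dvd' hx⟩

/-- The pointwise values of a matrix of germs, through chosen representatives. -/
noncomputable def evalMatrix {m n : Type*} (A : Matrix m n (analyticGerm z₀)) (z : ℂ) :
    Matrix m n ℂ :=
  A.map fun x => rep x z

variable {l m n : Type*}

theorem eventually_evalMatrix_eq [Finite m] [Finite n] {A : Matrix m n (analyticGerm z₀)}
    {B : ℂ → Matrix m n ℂ} (h : ∀ i j, rep (A i j) =ᶠ[𝓝 z₀] fun z => B z i j) :
    ∀ᶠ z in 𝓝 z₀, evalMatrix A z = B z := by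
  filter_upwards [eventually_all.2 fun i => eventually_all.2 (h i)] with z hz
  ext i j
  exact hz i j

theorem eventually_evalMatrix_mul [Finite l] [Fintype m] [Finite n]
    (A : Matrix l m (analyticGerm z₀)) (B : Matrix m n (analyticGerm z₀)) :
    ∀ᶠ z in 𝓝 z₀, evalMatrix (A * B) z = evalMatrix A z * evalMatrix B z := by
  refine eventually_evalMatrix_eq fun i j => (rep_sum _ _).trans ?_
  filter_upwards [eventually_all.2 fun k => rep_mul (A i k) (B k j)] with z hz
  simp [Matrix.mul_apply, evalMatrix, hz]

theorem eventually_evalMatrix_one [Finite n] [DecidableEq n] :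
    ∀ᶠ z in 𝓝 z₀, evalMatrix (1 : Matrix n n (analyticGerm z₀)) z = 1 := by
  refine eventually_evalMatrix_eq fun i j => ?_
  rcases eq_or_ne i j with rfl | hij
  · simp only [Matrix.one_apply_eq]
    exact rep_one
  · simp only [Matrix.one_apply_ne hij]
    exact rep_zero

theorem eventually_evalMatrix_mul_eq_one [Fintype n] [DecidableEq n]
    {A B : Matrix n n (analyticGerm z₀)} (h : A * B = 1) :
    ∀ᶠ z in 𝓝 z₀, evalMatrix A z * evalMatrix B z = 1 := by
  filter_upwards [eventually_evalMatrix_mul A B, eventually_evalMatrix_one (n := n)] with z hAB h1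
  rw [← hAB, h, h1]

end analyticGerm

open analyticGerm in
theorem exists_analytic_smithNormalForm {m n : Type*} [Fintype m] [DecidableEq m] [Fintype n]
    [DecidableEq n] {z₀ : ℂ} {A : ℂ → Matrix m n ℂ}
    (hA : ∀ i j, AnalyticAt ℂ (fun z => A z i j) z₀) :
    ∃ (r t : ℕ) (σ : Fin r ⊕ Fin t ≃ n) (f : Fin r ↪ m) (P P' : ℂ → Matrix n n ℂ)
      (Q Q' : ℂ → Matrix m m ℂ) (d : Fin r → ℂ → ℂ),
      (∀ i j, AnalyticAt ℂ (fun z => P z i j) z₀) ∧ (∀ i j, AnalyticAt ℂ (fun z => Q z i j) z₀) ∧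
      (∀ i, AnalyticAt ℂ (d i) z₀) ∧ (∀ᶠ z in 𝓝 z₀, P' z * P z = 1) ∧
      (∀ᶠ z in 𝓝 z₀, Q' z * Q z = 1) ∧ (∀ i, ∀ᶠ z in 𝓝[≠] z₀, d i z ≠ 0) ∧
      (∀ᶠ z in 𝓝 z₀, ∀ i k, (A z * P z) k (σ (Sum.inl i)) = d i z * Q z k (f i)) ∧
      ∀ᶠ z in 𝓝 z₀, ∀ j k, (A z * P z) k (σ (Sum.inr j)) = 0 := by
  set Â : Matrix m n (analyticGerm z₀) := fun i j => mk _ (hA i j)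
  obtain ⟨r, t, σ, f, P, P', Q, Q', d, hP, hQ, hd, hinl, hinr⟩ := exists_smithNormalForm_matrix Â
  have hAP : ∀ᶠ z in 𝓝 z₀, evalMatrix (Â * P) z = A z * evalMatrix P z := by
    filter_upwards [eventually_evalMatrix_mul Â P,
      eventually_evalMatrix_eq fun i j => rep_mk (hA i j)] with z hmul hz
    rw [hmul, hz]
  refine ⟨r, t, σ, f, evalMatrix P, evalMatrix P', evalMatrix Q, evalMatrix Q', fun i => rep (d i),
    fun i j => analyticAt_rep _, fun i j => analyticAt_rep _, fun i => analyticAt_rep _,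
    eventually_evalMatrix_mul_eq_one hP, eventually_evalMatrix_mul_eq_one hQ,
    fun i => ne_zero_iff.1 (hd i), ?_, ?_⟩
  · filter_upwards [hAP, eventually_all.2 fun i => eventually_all.2 fun k =>
      rep_mul (d i) (Q k (f i))] with z hz hmul i k
    rw [← hz, evalMatrix, Matrix.map_apply, hinl, hmul i k]
    rfl
  · filter_upwards [hAP, rep_zero (z₀ := z₀)] with z hz hzero j k
    rw [← hz, evalMatrix, Matrix.map_apply, hinr, hzero]
    rfl

/-! ### Weights of parabolic structures -/

namespace ParabolicStructure

variable {M : Type*} [AddCommGroup M] [Module ℂ M] (P : ParabolicStructure M)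

/-- The `i`-th weight in decreasing order, counted from `0` and with multiplicity, for
`i < finrank ℂ M`. -/
noncomputable def jump (i : ℕ) : ℝ := sSup {c | i < finrank ℂ (P.fil c)}

theorem fil_le_filGT {b c : ℝ} (h : c < b) : P.fil b ≤ P.filGT c :=
  le_iSup (fun b : Set.Ioi c => P.fil b) ⟨b, h⟩

theorem bddAbove_lt_finrank_fil (i : ℕ) : BddAbove {c | i < finrank ℂ (P.fil c)} := by
  refine ⟨1, fun c (hc : i < finrank ℂ (P.fil c)) => ?_⟩
  by_contra! h
  have hbot : P.fil c = ⊥ := le_bot_iff.1 (P.fil_one ▸ P.antitone h.le)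
  rw [hbot, finrank_bot] at hc
  exact Nat.not_lt_zero i hc

variable [FiniteDimensional ℂ M]

theorem exists_filGT_eq_fil (c : ℝ) : ∃ b > c, P.filGT c = P.fil b := by
  obtain ⟨_, ⟨b, hb, rfl⟩, hmax⟩ := set_has_maximal_iff_noetherian.2 (inferInstance :
    IsNoetherian ℂ M) (P.fil '' Set.Ioi c) (Set.nonempty_Ioi.image _)
  refine ⟨b, hb, le_antisymm (iSup_le fun b' => ?_) (P.fil_le_filGT hb)⟩
  rcases le_total b b' with h | h
  · exact P.antitone h
  · exact ((P.antitone h).eq_of_not_lt (hmax _ ⟨b', b'.2, rfl⟩)).ge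

variable {P}

theorem le_jump_iff {i : ℕ} (hi : i < finrank ℂ M) {c : ℝ} :
    c ≤ P.jump i ↔ i < finrank ℂ (P.fil c) := by
  refine ⟨fun h => ?_, fun h => le_csSup (P.bddAbove_lt_finrank_fil i) h⟩
  obtain ⟨e, he, hfil⟩ := P.left_cont c
  have hne : {c | i < finrank ℂ (P.fil c)}.Nonempty :=
    ⟨0, by rwa [Set.mem_ofPred_eq, P.fil_zero, finrank_top]⟩
  obtain ⟨c', hc', hlt⟩ := exists_lt_of_lt_csSup hne ((sub_lt_self c he).trans_le h)
  rw [← hfil]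
  exact lt_of_lt_of_le hc' (Submodule.finrank_mono (P.antitone hlt.le))

theorem lt_jump_iff {i : ℕ} (hi : i < finrank ℂ M) {c : ℝ} :
    c < P.jump i ↔ i < finrank ℂ (P.filGT c) := by
  constructor
  · intro h
    exact ((le_jump_iff hi).1 le_rfl).trans_le (Submodule.finrank_mono (P.fil_le_filGT h))
  · intro h
    obtain ⟨b, hb, hfil⟩ := P.exists_filGT_eq_fil c
    rw [hfil] at h
    exact lt_of_lt_of_le hb ((le_jump_iff hi).2 h)

theorem mult_eq_card (c : ℝ) :
    P.mult c = ((Finset.range (finrank ℂ M)).filter fun i => P.jump i = c).card := by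
  have hIco : (Finset.range (finrank ℂ M)).filter (fun i => P.jump i = c) =
      Finset.Ico (finrank ℂ (P.filGT c)) (finrank ℂ (P.fil c)) := by
    ext i
    rw [Finset.mem_filter, Finset.mem_range, Finset.mem_Ico]
    constructor
    · rintro ⟨hi, rfl⟩
      exact ⟨not_lt.1 fun h => ((lt_jump_iff hi).2 h).false, (le_jump_iff hi).1 le_rfl⟩
    · rintro ⟨hGT, hfil⟩
      have hi := hfil.trans_le (P.fil c).finrank_le
      exact ⟨hi, le_antisymm (not_lt.1 fun h => ((lt_jump_iff hi).1 h).not_ge hGT)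
        ((le_jump_iff hi).2 hfil)⟩
  rw [hIco, Nat.card_Ico, mult]

theorem weight_eq_sum_jump : P.weight = ∑ i ∈ Finset.range (finrank ℂ M), P.jump i := by
  classical
  have himage : Function.support (fun c : ℝ => (P.mult c : ℝ) * c) ⊆
      (Finset.range (finrank ℂ M)).image P.jump := by
    intro c hc
    have hmult : P.mult c ≠ 0 := fun h => hc (by simp [h])
    rw [mult_eq_card, Finset.card_ne_zero] at hmult
    obtain ⟨i, hi⟩ := hmult
    rw [Finset.mem_filter] at hi
    exact Finset.mem_coe.2 (Finset.mem_image.2 ⟨i, hi⟩)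
  rw [weight, finsum_eq_sum_of_support_subset _ himage]
  simpa [mult_eq_card] using (Finset.sum_comp (s := Finset.range (finrank ℂ M)) id P.jump).symm

theorem mul_finrank_le_weight {c : ℝ} (hc : P.fil c = ⊤) : c * finrank ℂ M ≤ P.weight := by
  rw [weight_eq_sum_jump, mul_comm, ← nsmul_eq_mul]
  simpa using Finset.card_nsmul_le_sum (Finset.range (finrank ℂ M)) P.jump c fun i hi =>
    (le_jump_iff (Finset.mem_range.1 hi)).2 (by rw [hc, finrank_top]; exact Finset.mem_range.1 hi)

theorem mul_finrank_le_weight_induced {c : ℝ} (hc : P.fil c = ⊤) (N : Submodule ℂ M) :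
    c * finrank ℂ N ≤ (P.induced N).weight :=
  mul_finrank_le_weight (by simp [induced, hc])

theorem jump_add_le_jump_induced (N : Submodule ℂ M) {i : ℕ} (hi : i < finrank ℂ N) :
    P.jump (finrank ℂ M - finrank ℂ N + i) ≤ (P.induced N).jump i := by
  have hN := N.finrank_le
  rw [le_jump_iff hi]
  set c := P.jump (finrank ℂ M - finrank ℂ N + i)
  have hc : finrank ℂ M - finrank ℂ N + i < finrank ℂ (P.fil c) :=
    (le_jump_iff (by omega)).1 le_rfl
  have hind : finrank ℂ ((P.induced N).fil c) = finrank ℂ (N ⊓ P.fil c : Submodule ℂ M) := by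
    rw [← Submodule.map_comap_subtype, Submodule.finrank_map_subtype_eq]
    rfl
  have hdim := Submodule.finrank_sup_add_finrank_inf_eq N (P.fil c)
  have hsup := (N ⊔ P.fil c).finrank_le
  omega

theorem weight_sub_weight_induced_le {c : ℝ} (hc : P.filGT c = ⊥) (N : Submodule ℂ M) :
    P.weight - (P.induced N).weight ≤ c * (finrank ℂ M - finrank ℂ N) := by
  obtain ⟨l, hl⟩ := Nat.exists_eq_add_of_le' N.finrank_le
  have htop : ∑ i ∈ Finset.range l, P.jump i ≤ l * c := by
    have hjump : ∀ i ∈ Finset.range l, P.jump i ≤ c := fun i hi => by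
      have hi := Finset.mem_range.1 hi
      rw [← not_lt, lt_jump_iff (by omega), hc, finrank_bot]
      exact Nat.not_lt_zero i
    simpa using Finset.sum_le_card_nsmul (Finset.range l) P.jump c hjump
  have hind : ∑ i ∈ Finset.range (finrank ℂ N), P.jump (l + i) ≤ (P.induced N).weight := by
    rw [weight_eq_sum_jump]
    refine Finset.sum_le_sum fun i hi => ?_
    simpa [hl] using jump_add_le_jump_induced (P := P) N (Finset.mem_range.1 hi)
  rw [weight_eq_sum_jump, hl, Finset.sum_range_add]
  push_cast
  linarith

variable {n : ℕ} {α : Fin n → ℝ}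

theorem HasType.exists_eq_jump (h : P.HasType α) {i : ℕ} (hi : i < finrank ℂ M) :
    ∃ j, α j = P.jump i := by
  have hpos : 0 < P.mult (P.jump i) := by
    rw [mult_eq_card, Finset.card_pos]
    exact ⟨i, by simpa using hi⟩
  rw [h.2, Finset.card_pos] at hpos
  obtain ⟨j, hj⟩ := hpos
  exact ⟨j, (Finset.mem_filter.1 hj).2⟩

theorem HasType.fil_eq_top (h : P.HasType α) {c : ℝ} (hc : ∀ i, c ≤ α i) : P.fil c = ⊤ := by
  refine Submodule.eq_top_of_finrank_eq (le_antisymm (P.fil c).finrank_le (not_lt.1 fun hlt => ?_))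
  obtain ⟨j, hj⟩ := h.exists_eq_jump hlt
  exact ((le_jump_iff hlt).1 (hj ▸ hc j)).false

theorem HasType.filGT_eq_bot (h : P.HasType α) {c : ℝ} (hc : ∀ i, α i ≤ c) : P.filGT c = ⊥ := by
  refine Submodule.finrank_eq_zero.1 (Nat.eq_zero_of_not_pos fun hpos => ?_)
  have hM := hpos.trans_le (P.filGT c).finrank_le
  obtain ⟨j, hj⟩ := h.exists_eq_jump hM
  exact ((lt_jump_iff hM).2 hpos).not_ge (hj ▸ hc j)

end ParabolicStructure

/-! ### Vector fields on the Riemann sphere -/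

namespace RiemannSphere

instance : IsManifold 𝓘(ℂ) 1 (OnePoint ℂ) := IsManifold.of_le (n := ω) le_top

/-- The coordinate of a tangent vector at `y` in the chart at `a`. -/
noncomputable def tangentCoord (a y : OnePoint ℂ) : TangentSpace 𝓘(ℂ) y →ₗ[ℂ] ℂ :=
  (trivializationAt ℂ (TangentSpace 𝓘(ℂ)) a).linearMapAt ℂ y

/-- The coordinate vector field of the chart at `a`. -/
noncomputable def coordField (a y : OnePoint ℂ) : TangentSpace 𝓘(ℂ) y :=
  (trivializationAt ℂ (TangentSpace 𝓘(ℂ)) a).symmₗ ℂ y (1 : ℂ)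

theorem tangentCoord_smul_coordField {a y : OnePoint ℂ} (hy : y ∈ (chartAt ℂ a).source)
    (X : TangentSpace 𝓘(ℂ) y) : tangentCoord a y X • coordField a y = X := by
  rw [coordField, ← map_smul, smul_eq_mul, mul_one]
  exact (trivializationAt ℂ (TangentSpace 𝓘(ℂ)) a).symmₗ_linearMapAt hy X

theorem tangentCoord_coordField {a y : OnePoint ℂ} (hy : y ∈ (chartAt ℂ a).source) :
    tangentCoord a y (coordField a y) = 1 :=
  (trivializationAt ℂ (TangentSpace 𝓘(ℂ)) a).linearMapAt_symmₗ hy 1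

theorem holVectorFieldAt_smul_coordField {a : OnePoint ℂ} {f : OnePoint ℂ → ℂ} (hf : Hol f a) :
    HolVectorFieldAt (fun y => f y • coordField a y) a := by
  refine (contMDiffAt_section (F := ℂ) (E := TangentSpace 𝓘(ℂ)) (IB := 𝓘(ℂ)) a).2 ?_
  refine ContMDiffAt.congr_of_eventuallyEq hf ?_
  filter_upwards [(chartAt ℂ a).open_source.mem_nhds (mem_chart_source ℂ a)] with y hy
  have hcoord : tangentCoord a y (f y • coordField a y) = f y := by
    rw [map_smul, tangentCoord_coordField hy, smul_eq_mul, mul_one]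
  rwa [tangentCoord, Trivialization.coe_linearMapAt_of_mem _ hy] at hcoord

/-- The vector field `∂ / ∂z`, which has a double zero at infinity. -/
noncomputable def translationField (y : OnePoint ℂ) : TangentSpace 𝓘(ℂ) y :=
  y.elim (0 : ℂ) fun _ => (1 : ℂ)

theorem tangentCoord_apply {a y : OnePoint ℂ} (hy : y ∈ (chartAt ℂ a).source)
    (X : TangentSpace 𝓘(ℂ) y) :
    tangentCoord a y X =
      fderiv ℂ (fun z => chartAt ℂ a ((chartAt ℂ y).symm z)) (chartAt ℂ y y) X := by
  rw [tangentCoord, Trivialization.coe_linearMapAt_of_mem _ hy]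
  simp only [TangentBundle.trivializationAt_apply]
  simp only [mfld_simps, fderivWithin_univ]
  rfl

theorem tangentCoord_coe_translationField (z w : ℂ) :
    tangentCoord (z : OnePoint ℂ) w (translationField w) = 1 := by
  rw [tangentCoord_apply (by simp [chartAt_coe, affineChart_source])]
  simp only [chartAt_coe, affineChart_symm_apply, affineChart_coe]
  rw [fderiv_fun_id]
  rfl

theorem tangentCoord_infty_translationField {w : ℂ} (hw : w ≠ 0) :
    tangentCoord ∞ (w : OnePoint ℂ) (translationField w) = -(w⁻¹) ^ 2 := by
  rw [tangentCoord_apply (by simpa [chartAt_infty, inftyChart_source] using hw)]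
  simp only [chartAt_coe, affineChart_symm_apply, affineChart_coe, chartAt_infty]
  have hchart : (fun z : ℂ => inftyChart (z : OnePoint ℂ)) =ᶠ[𝓝 w] fun z => z⁻¹ := by
    filter_upwards [isOpen_ne.mem_nhds hw] with z hz
    exact inftyChart_coe hz
  rw [hchart.fderiv_eq, (hasDerivAt_inv hw).hasFDerivAt.fderiv]
  change (ContinuousLinearMap.toSpanSingleton ℂ (-(w ^ 2)⁻¹)) (1 : ℂ) = _
  simp

theorem hasOrderAt_translationField (a : OnePoint ℂ) :
    HasOrderAt (fun y => tangentCoord a y (translationField y)) a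
      (Finsupp.single (∞ : OnePoint ℂ) (2 : ℤ) a) := by
  induction a using OnePoint.rec with
  | coe z =>
    rw [Finsupp.single_eq_of_ne (by simp)]
    refine (HasOrderAt.of_hol (hol_const (1 : ℂ)) one_ne_zero).congr
      (eventually_nhdsWithin_of_eventually_nhds ?_)
    rw [OnePoint.nhds_coe_eq, eventually_map]
    exact Eventually.of_forall fun w => (tangentCoord_coe_translationField z w).symm
  | infty =>
    rw [Finsupp.single_eq_same]
    have hsq : HasOrderAt (fun y => -1 * (linearCoord 0 y)⁻¹ ^ 2) ∞ 2 := by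
      simpa using (HasOrderAt.of_hol (hol_const (-1 : ℂ)) (by simp)).mul
        (hasOrderAt_linearCoord_zero_infty.inv.pow 2)
    refine hsq.congr ?_
    filter_upwards [eventually_nhdsWithin_of_eventually_nhds (isOpen_ne.mem_nhds
      (OnePoint.infty_ne_coe (0 : ℂ))), eventually_mem_nhdsWithin] with y hy0 hy
    induction y using OnePoint.rec with
    | infty => exact absurd rfl hy
    | coe z =>
      rw [tangentCoord_infty_translationField (fun h => hy0 (by rw [h]))]
      simp [linearCoord]

end RiemannSphere

/-! ### The local normal form of a Higgs field -/

theorem eventually_notMem_range {ι X : Type*} [Finite ι] [TopologicalSpace X] [T1Space X]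
    (x : ι → X) (a : X) : ∀ᶠ y in 𝓝[≠] a, y ∉ Set.range x :=
  nhdsNE_le_cofinite a (Set.finite_range x).compl_mem_cofinite

namespace RiemannSphere

theorem tendsto_chart (a : OnePoint ℂ) : Tendsto (chartAt ℂ a) (𝓝 a) (𝓝 (chartAt ℂ a a)) :=
  (chartAt ℂ a).continuousAt (mem_chart_source ℂ a)

theorem eventually_mem_chart_source (a : OnePoint ℂ) : ∀ᶠ y in 𝓝 a, y ∈ (chartAt ℂ a).source :=
  (chartAt ℂ a).open_source.mem_nhds (mem_chart_source ℂ a)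

theorem eventually_chart_ne (a : OnePoint ℂ) :
    ∀ᶠ y in 𝓝[≠] a, chartAt ℂ a y ≠ chartAt ℂ a a := by
  filter_upwards [eventually_nhdsWithin_of_eventually_nhds (eventually_mem_chart_source a),
    self_mem_nhdsWithin] with y hy hya h
  exact hya ((chartAt ℂ a).injOn hy (mem_chart_source ℂ a) h)

end RiemannSphere

namespace HolVectorBundle

variable {n : ℕ} {E : HolVectorBundle n} {a y : OnePoint ℂ}

theorem HolAt.exists_eq_smul_of_eq_zero {v : ∀ y, E.Fib y} (hv : E.HolAt v a) (h0 : v a = 0) :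
    ∃ v', E.HolAt v' a ∧ ∀ᶠ y in 𝓝 a, v y = (chartAt ℂ a y - chartAt ℂ a a) • v' y := by
  set z₀ := chartAt ℂ a a
  set f : ℂ → Fin n → ℂ := fun z => E.coord a ((chartAt ℂ a).symm z) (v ((chartAt ℂ a).symm z))
  have hf : AnalyticAt ℂ f z₀ := hol_iff.1 ((holAt_iff (E.mem_base_self a)).1 hv)
  have hf_chart : ∀ y ∈ (chartAt ℂ a).source, f (chartAt ℂ a y) = E.coord a y (v y) := by
    intro y hy
    simp only [f]
    rw [(chartAt ℂ a).left_inv hy]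
  have hf0 : f z₀ = 0 := by rw [hf_chart a (mem_chart_source ℂ a), h0, map_zero]
  have hslope : AnalyticAt ℂ (dslope f z₀) z₀ := by
    obtain ⟨P, hP⟩ := hf
    exact ⟨_, hP.has_fpower_series_dslope_fslope⟩
  refine ⟨fun y => E.lift a y (dslope f z₀ (chartAt ℂ a y)),
    holAt_lift (E.mem_base_self a) (hol_comp_chart hslope), ?_⟩
  filter_upwards [E.base_mem_nhds a, eventually_mem_chart_source a] with y hyb hy
  rw [← map_smul, sub_smul_dslope, hf0, sub_zero, hf_chart y hy, lift_coord hyb]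

theorem linearIndependent_lift_col (hy : y ∈ E.base a) {P P' : Matrix (Fin n) (Fin n) ℂ}
    (h : P' * P = 1) : LinearIndependent ℂ fun j => E.lift a y fun i => P i j := by
  have hcol : LinearIndependent ℂ P.col :=
    Matrix.linearIndependent_cols_iff_isUnit.2 (IsUnit.of_mul_eq_one_right _ h)
  exact hcol.map' (E.lift a y) (LinearMap.ker_eq_bot.2 (coordEquiv hy).symm.injective)

theorem isFrameAt_full_lift_col {P P' : OnePoint ℂ → Matrix (Fin n) (Fin n) ℂ}
    (hP : ∀ i j, Hol (fun y => P y i j) a) (h : ∀ᶠ y in 𝓝 a, P' y * P y = 1) :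
    E.IsFrameAt E.full (fun j y => E.lift a y fun i => P y i j) a := by
  refine ⟨fun j => holAt_lift (E.mem_base_self a) (hol_pi_iff.2 fun i => hP i j), ?_⟩
  filter_upwards [h, E.base_mem_nhds a] with y hy hyb
  have hli := linearIndependent_lift_col hyb hy
  refine ⟨hli, hli.span_eq_top_of_card_eq_finrank' ?_⟩
  rw [finrank_fib, Fintype.card_fin]

variable (E)

theorem isSubbundle_full : E.IsSubbundle E.full n := fun _ =>
  ⟨_, isFrameAt_full_lift_col (P := 1) (P' := 1) (fun _ _ => hol_const _)
    (Eventually.of_forall fun _ => mul_one _)⟩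

end HolVectorBundle

namespace ParabolicBundle

variable {s : ℕ} {x : Fin s → OnePoint ℂ} {q p : ℕ} {E : ParabolicBundle x q}
  {F : ParabolicBundle x p}

/-- At every puncture some number separates the weights of `F` from those of `E`: the former are at
most, the latter at least that number. Strongly parabolic maps `E → F` then have residue zero. -/
def WeightsLE (F : ParabolicBundle x p) (E : ParabolicBundle x q) : Prop :=
  ∀ j, ∃ c, (F.par j).filGT c = ⊥ ∧ (E.par j).fil c = ⊤

namespace HiggsHom

variable {a : OnePoint ℂ} {r t : ℕ} {σ : Fin r ⊕ Fin t ≃ Fin q}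

/-- Contraction with `(z - z(a)) ∂/∂z` gives a section with value in `F.filGT c = ⊥` at `a`, so that
it can be divided by `z - z(a)`. -/
theorem exists_extension (θ : HiggsHom E F) (hFE : WeightsLE F E) {u : ∀ y, E.Fib y}
    (hu : E.HolAt u a) :
    ∃ v, F.HolAt v a ∧
      ∀ᶠ y in 𝓝 a, y ∉ Set.range x → v y = θ.toFun y (coordField a y) (u y) := by
  by_cases ha : a ∈ Set.range x
  · obtain ⟨j, rfl⟩ := ha
    set a := x j
    obtain ⟨c, hF, hE⟩ := hFE j
    obtain ⟨v, hv, hv_eq, hv_fil⟩ := θ.parabolic j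
      (fun y => (chartAt ℂ a y - chartAt ℂ a a) • coordField a y)
      (holVectorFieldAt_smul_coordField
        (hol_comp_chart (f := fun z => z - chartAt ℂ a a) (by fun_prop)))
      (by simp [a]) u hu
    have hva : v a = 0 := by
      simpa only [hF, Submodule.mem_bot] using hv_fil c (by rw [hE]; trivial)
    obtain ⟨v', hv', hvv'⟩ := hv.exists_eq_smul_of_eq_zero hva
    refine ⟨v', hv', ?_⟩
    filter_upwards [hvv', eventually_nhdsWithin_iff.1 (hv_eq.and (eventually_chart_ne a))]
      with y hy hya hyx
    obtain ⟨hθ, hne⟩ := hya fun h => hyx ⟨j, h.symm⟩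
    rw [hy, map_smul, LinearMap.smul_apply] at hθ
    exact smul_right_injective _ (sub_ne_zero.2 hne) hθ
  · refine ⟨fun y => θ.toFun y (coordField a y) (u y), ?_, Eventually.of_forall fun y _ => rfl⟩
    simpa only [one_smul] using
      θ.holomorphic a ha _ (holVectorFieldAt_smul_coordField (hol_const (1 : ℂ))) u hu

theorem exists_analytic_matrix (θ : HiggsHom E F) (hFE : WeightsLE F E) (a : OnePoint ℂ) :
    ∃ A : ℂ → Matrix (Fin p) (Fin q) ℂ,
      (∀ k i, AnalyticAt ℂ (fun z => A z k i) (chartAt ℂ a a)) ∧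
      ∀ᶠ y in 𝓝 a, y ∉ Set.range x → ∀ X (c : Fin q → ℂ),
        θ.toFun y X (E.lift a y c) =
          tangentCoord a y X • F.lift a y ((A (chartAt ℂ a y)).mulVec c) := by
  choose w hw hw_eq using fun i : Fin q => θ.exists_extension hFE (a := a)
    (u := fun y => E.lift a y (Pi.single i 1))
    (HolVectorBundle.holAt_lift (E.mem_base_self a) (hol_const _))
  refine ⟨fun z => Matrix.of fun k i =>
      F.coord a ((chartAt ℂ a).symm z) (w i ((chartAt ℂ a).symm z)) k,
    fun k i => hol_iff.1
      (hol_pi_iff.1 ((HolVectorBundle.holAt_iff (F.mem_base_self a)).1 (hw i)) k), ?_⟩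
  filter_upwards [eventually_all.2 hw_eq, eventually_mem_chart_source a, F.base_mem_nhds a]
    with y hy hys hyb hyx X c
  rw [(chartAt ℂ a).left_inv hys]
  nth_rw 1 [← tangentCoord_smul_coordField hys X]
  rw [map_smul, LinearMap.smul_apply]
  congr 1
  suffices h : θ.toFun y (coordField a y) ∘ₗ E.lift a y =
      F.lift a y ∘ₗ (Matrix.of fun k i => F.coord a y (w i y) k).mulVecLin from
    LinearMap.congr_fun h c
  refine LinearMap.pi_ext' fun i => LinearMap.ext_ring ?_
  have hcol : (Matrix.of fun k i => F.coord a y (w i y) k).mulVec (Pi.single i 1) =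
      F.coord a y (w i y) := Matrix.mulVec_single_one _ _
  simp only [LinearMap.comp_apply, LinearMap.coe_single, Matrix.mulVecLin_apply]
  rw [hcol, HolVectorBundle.lift_coord hyb, hy i hyx]

/-- Near `a`, in the frame `v` of `E`, the one-form `θ` is diagonal: it maps the first `r` vectors
to the multiples by `d` of the linearly independent vectors `u`, the other `t` vectors to zero. The
entries `d` have isolated zeros, so `u` spans the saturation of the image. -/
structure NormalForm (θ : HiggsHom E F) (a : OnePoint ℂ) {r t : ℕ} (σ : Fin r ⊕ Fin t ≃ Fin q) where
  v : Fin q → ∀ y, E.Fib y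
  u : Fin r → ∀ y, F.Fib y
  d : Fin r → OnePoint ℂ → ℂ
  frame : E.IsFrameAt E.full v a
  hol_u : ∀ i, F.HolAt (u i) a
  indep_u : ∀ᶠ y in 𝓝 a, LinearIndependent ℂ fun i => u i y
  hol_d : ∀ i, Hol (d i) a
  d_ne : ∀ i, ∀ᶠ y in 𝓝[≠] a, d i y ≠ 0
  apply_inl : ∀ᶠ y in 𝓝 a, y ∉ Set.range x → ∀ X i,
    θ.toFun y X (v (σ (Sum.inl i)) y) = (tangentCoord a y X * d i y) • u i y
  apply_inr : ∀ᶠ y in 𝓝 a, y ∉ Set.range x → ∀ X j, θ.toFun y X (v (σ (Sum.inr j)) y) = 0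

theorem exists_normalForm (θ : HiggsHom E F) (hFE : WeightsLE F E) (a : OnePoint ℂ) :
    ∃ (r t : ℕ) (σ : Fin r ⊕ Fin t ≃ Fin q), Nonempty (θ.NormalForm a σ) := by
  obtain ⟨A, hA, hθ⟩ := θ.exists_analytic_matrix hFE a
  obtain ⟨r, t, σ, f, P, P', Q, Q', d, hP, hQ, hd, hPP, hQQ, hd0, hinl, hinr⟩ :=
    exists_analytic_smithNormalForm hA
  have hframeQ : F.IsFrameAt F.full (fun j y => F.lift a y fun i => Q (chartAt ℂ a y) i j) a :=
    HolVectorBundle.isFrameAt_full_lift_col (fun i j => hol_comp_chart (hQ i j))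
      ((tendsto_chart a).eventually hQQ)
  refine ⟨r, t, σ, ⟨{
    v := fun j y => E.lift a y fun i => P (chartAt ℂ a y) i j
    u := fun j y => F.lift a y fun i => Q (chartAt ℂ a y) i (f j)
    d := fun i y => d i (chartAt ℂ a y)
    frame := HolVectorBundle.isFrameAt_full_lift_col (fun i j => hol_comp_chart (hP i j))
      ((tendsto_chart a).eventually hPP)
    hol_u := fun j => hframeQ.1 (f j)
    indep_u := hframeQ.2.mono fun y hy => hy.1.comp f f.injective
    hol_d := fun i => hol_comp_chart (hd i)
    d_ne := fun i => ?_
    apply_inl := ?_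
    apply_inr := ?_ }⟩⟩
  · rw [← eventually_chart_symm_nhdsNE]
    simpa only [chart_apply_symm] using hd0 i
  · filter_upwards [hθ, (tendsto_chart a).eventually hinl] with y hy hyi hyx X i
    have hcol : (A (chartAt ℂ a y)).mulVec (fun k => P (chartAt ℂ a y) k (σ (Sum.inl i))) =
        d i (chartAt ℂ a y) • fun k => Q (chartAt ℂ a y) k (f i) :=
      funext fun k => hyi i k
    rw [hy hyx, hcol, map_smul, smul_smul]
  · filter_upwards [hθ, (tendsto_chart a).eventually hinr] with y hy hyi hyx X j
    have hcol : (A (chartAt ℂ a y)).mulVec (fun k => P (chartAt ℂ a y) k (σ (Sum.inr j))) = 0 :=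
      funext fun k => hyi j k
    rw [hy hyx, hcol, map_zero, smul_zero]

namespace NormalForm

variable {θ : HiggsHom E F}

/-- The normal form with the frame of the source reordered. -/
def reindex (D : θ.NormalForm a σ) (σ' : Fin r ⊕ Fin t ≃ Fin q) : θ.NormalForm a σ' where
  v i := D.v (σ (σ'.symm i))
  u := D.u
  d := D.d
  frame := ⟨fun i => D.frame.1 _, by
    filter_upwards [D.frame.2] with y hy
    refine ⟨hy.1.comp _ (σ'.symm.trans σ).injective, ?_⟩
    rw [← hy.2, ← (σ'.symm.trans σ).surjective.range_comp fun i => D.v i y]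
    rfl⟩
  hol_u := D.hol_u
  indep_u := D.indep_u
  hol_d := D.hol_d
  d_ne := D.d_ne
  apply_inl := by simpa using D.apply_inl
  apply_inr := by simpa using D.apply_inr

theorem indep_inr (D : θ.NormalForm a σ) :
    ∀ᶠ y in 𝓝 a, LinearIndependent ℂ fun j => D.v (σ (Sum.inr j)) y := by
  filter_upwards [D.frame.2] with y hy
  exact hy.1.comp _ (σ.injective.comp Sum.inr_injective)

end NormalForm

end HiggsHom

end ParabolicBundle

/-! ### Linear maps and alternating forms in adapted frames -/

section AdaptedFrame

variable {K V U : Type*} [Field K] [AddCommGroup V] [Module K V] [AddCommGroup U] [Module K U]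
  {ι κ n : Type*}

theorem alternatingMap_sum_smul_eq_det_mul [Fintype ι] [DecidableEq ι] (w : V [⋀^ι]→ₗ[K] K)
    (s : ι → V) (M : Matrix ι ι K) : w (fun i => ∑ k, M k i • s k) = M.det * w s := by
  have hdet := congrArg (fun f => f fun i k => M k i)
    ((w.compLinearMap (Fintype.linearCombination K s)).eq_smul_basis_det (Pi.basisFun K ι))
  have hs : (fun i => Fintype.linearCombination K s (Pi.basisFun K ι i)) = s := by
    ext i
    simp [Fintype.linearCombination_apply_single]
  have htranspose : (Pi.basisFun K ι).det (fun i k => M k i) = M.det :=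
    ((Pi.basisFun_det_apply _).trans M.det_transpose :)
  simp only [AlternatingMap.smul_apply, htranspose, smul_eq_mul,
    AlternatingMap.compLinearMap_apply, hs] at hdet
  rw [mul_comm, ← hdet]
  rfl

/-- The quotient of a volume form on the source of `T` by the product of volume forms on the kernel
and the image does not depend on the adapted frame; multiplied out, this needs no nonvanishing. -/
theorem alternatingMap_mul_eq_of_adapted [Finite ι] [Finite κ]
    (T : V →ₗ[K] U) (σ : ι ⊕ κ ≃ n) {v v' : n → V} (hv : Submodule.span K (Set.range v) = ⊤)
    (hT : ∀ j, T (v (σ (Sum.inr j))) = 0)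
    (hv' : ∀ j, v' (σ (Sum.inr j)) ∈ Submodule.span K (Set.range fun j => v (σ (Sum.inr j))))
    (wV : V [⋀^n]→ₗ[K] K) (wK : V [⋀^κ]→ₗ[K] K) (wI : U [⋀^ι]→ₗ[K] K) :
    wV v' * (wK (fun j => v (σ (Sum.inr j))) * wI (fun i => T (v (σ (Sum.inl i))))) =
      wV v * (wK (fun j => v' (σ (Sum.inr j))) * wI (fun i => T (v' (σ (Sum.inl i))))) := by
  classical
  have := Fintype.ofFinite ι
  have := Fintype.ofFinite κ
  have := Fintype.ofEquiv _ σ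
  choose B hB using fun j => (Submodule.mem_span_range_iff_exists_fun K).1 (hv' j)
  choose A hA using fun i : ι => (Submodule.mem_span_range_iff_exists_fun K).1
    (hv ▸ Submodule.mem_top : v' (σ (Sum.inl i)) ∈ Submodule.span K (Set.range v))
  replace hA : ∀ i, ∑ k, A i (σ (Sum.inl k)) • v (σ (Sum.inl k)) +
      ∑ k, A i (σ (Sum.inr k)) • v (σ (Sum.inr k)) = v' (σ (Sum.inl i)) := fun i => by
    rw [← hA, ← σ.sum_comp, Fintype.sum_sum_type]
  set Mι : Matrix ι ι K := .of fun k i => A i (σ (Sum.inl k))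
  set Mκ : Matrix κ κ K := .of fun k j => B j k
  set M : Matrix (ι ⊕ κ) (ι ⊕ κ) K := .fromBlocks Mι 0 (.of fun k i => A i (σ (Sum.inr k))) Mκ
  have hsource : wV v' = M.det * wV v := by
    rw [← Matrix.det_reindex_self σ M, ← alternatingMap_sum_smul_eq_det_mul]
    congr 1
    ext i
    obtain ⟨i | j, rfl⟩ := σ.surjective i
    · simp [M, Mι, ← σ.sum_comp, Fintype.sum_sum_type, hA]
    · simp [M, Mκ, ← σ.sum_comp, Fintype.sum_sum_type, hB]
  have hker : wK (fun j => v' (σ (Sum.inr j))) = Mκ.det * wK fun j => v (σ (Sum.inr j)) := by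
    rw [← alternatingMap_sum_smul_eq_det_mul]
    simp [Mκ, hB]
  have himage : wI (fun i => T (v' (σ (Sum.inl i)))) =
      Mι.det * wI fun i => T (v (σ (Sum.inl i))) := by
    rw [← alternatingMap_sum_smul_eq_det_mul]
    simp [Mι, ← hA, hT]
  rw [hsource, hker, himage, Matrix.det_fromBlocks_zero₁₂]
  ring

variable {T : V →ₗ[K] U} {σ : ι ⊕ κ ≃ n} {v : n → V} {u : ι → U} {c : ι → K}

theorem range_le_span_of_adapted (hv : Submodule.span K (Set.range v) = ⊤)
    (hl : ∀ i, T (v (σ (Sum.inl i))) = c i • u i) (hr : ∀ j, T (v (σ (Sum.inr j))) = 0) :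
    LinearMap.range T ≤ Submodule.span K (Set.range u) := by
  rw [LinearMap.range_eq_map, ← hv, Submodule.map_span_le]
  rintro _ ⟨k, rfl⟩
  obtain ⟨k | k, rfl⟩ := σ.surjective k
  · rw [hl]
    exact Submodule.smul_mem _ _ (Submodule.subset_span ⟨k, rfl⟩)
  · rw [hr]
    exact Submodule.zero_mem _

theorem range_eq_span_of_adapted (hv : Submodule.span K (Set.range v) = ⊤)
    (hl : ∀ i, T (v (σ (Sum.inl i))) = c i • u i) (hr : ∀ j, T (v (σ (Sum.inr j))) = 0)
    (hc : ∀ i, c i ≠ 0) : LinearMap.range T = Submodule.span K (Set.range u) := by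
  refine (range_le_span_of_adapted hv hl hr).antisymm (Submodule.span_le.2 ?_)
  rintro _ ⟨i, rfl⟩
  exact ⟨(c i)⁻¹ • v (σ (Sum.inl i)), by rw [map_smul, hl, inv_smul_smul₀ (hc i)]⟩

theorem ker_eq_span_of_adapted [Finite ι] [Finite κ] (hv : Submodule.span K (Set.range v) = ⊤)
    (hu : LinearIndependent K u) (hl : ∀ i, T (v (σ (Sum.inl i))) = c i • u i)
    (hr : ∀ j, T (v (σ (Sum.inr j))) = 0) (hc : ∀ i, c i ≠ 0) :
    LinearMap.ker T = Submodule.span K (Set.range fun j => v (σ (Sum.inr j))) := by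
  refine le_antisymm (fun z hz => ?_) (Submodule.span_le.2 (Set.range_subset_iff.2 hr))
  have := Fintype.ofFinite ι
  have := Fintype.ofFinite κ
  have := Fintype.ofEquiv _ σ
  obtain ⟨b, rfl⟩ := (Submodule.mem_span_range_iff_exists_fun K).1
    (hv ▸ Submodule.mem_top : z ∈ Submodule.span K (Set.range v))
  rw [← σ.sum_comp, Fintype.sum_sum_type] at hz ⊢
  have hz0 : ∑ i, (b (σ (Sum.inl i)) * c i) • u i = 0 := by
    simpa [hl, hr, smul_smul] using hz
  have hb : ∀ i, b (σ (Sum.inl i)) = 0 := fun i =>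
    (mul_eq_zero.1 (Fintype.linearIndependent_iff.1 hu _ hz0 i)).resolve_right (hc i)
  simp only [hb, zero_smul, Finset.sum_const_zero, zero_add]
  exact Submodule.sum_mem _ fun j _ => Submodule.smul_mem _ _ (Submodule.subset_span ⟨j, rfl⟩)

end AdaptedFrame

/-! ### The kernel and the saturated image of a Higgs field -/

theorem isLocallyConstant_of_eventually_nhdsNE_eq {X Y : Type*} [TopologicalSpace X] [T1Space X]
    [∀ a : X, (𝓝[≠] a).NeBot] {f r : X → Y} (h : ∀ a, ∀ᶠ y in 𝓝[≠] a, f y = r a) :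
    IsLocallyConstant r := by
  rw [IsLocallyConstant.iff_eventually_eq]
  intro a
  filter_upwards [(eventually_nhdsWithin_iff.1 (h a)).eventually_nhds] with y hy
  by_cases hya : y = a
  · rw [hya]
  · obtain ⟨z, hzy, hza, hne⟩ := ((h y).and (eventually_nhdsWithin_of_eventually_nhds
      (hy.and (isOpen_ne.mem_nhds hya)))).exists
    exact hzy.symm.trans (hza hne)

theorem RiemannSphere.tangentCoord_coordField_ne_zero {a y : OnePoint ℂ}
    (hy : y ∈ (chartAt ℂ a).source) : tangentCoord a y (coordField y y) ≠ 0 := fun h0 => by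
  have hzero : coordField y y = 0 := by
    rw [← tangentCoord_smul_coordField hy (coordField y y), h0, zero_smul]
  simpa [hzero] using tangentCoord_coordField (mem_chart_source ℂ y)

namespace ParabolicBundle.HiggsHom

variable {s : ℕ} {x : Fin s → OnePoint ℂ} {q p : ℕ} {E : ParabolicBundle x q}
  {F : ParabolicBundle x p}

/-- The contraction of the one-form with a nonzero tangent vector at `y`. -/
noncomputable def fibMap (θ : HiggsHom E F) (y : OnePoint ℂ) : E.Fib y →ₗ[ℂ] F.Fib y :=
  θ.toFun y (coordField y y)

theorem toFun_eq_smul_fibMap (θ : HiggsHom E F) (y : OnePoint ℂ) (X : TangentSpace 𝓘(ℂ) y) :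
    θ.toFun y X = tangentCoord y y X • θ.fibMap y := by
  rw [fibMap, ← map_smul, tangentCoord_smul_coordField (mem_chart_source ℂ y)]

variable {θ : HiggsHom E F} {r t : ℕ} {σ : Fin r ⊕ Fin t ≃ Fin q} {a : OnePoint ℂ}

namespace NormalForm

theorem range_fibMap_le (D : θ.NormalForm a σ) (ha : a ∉ Set.range x) :
    LinearMap.range (θ.fibMap a) ≤ Submodule.span ℂ (Set.range fun i => D.u i a) :=
  range_le_span_of_adapted D.frame.2.self_of_nhds.2
    (D.apply_inl.self_of_nhds ha _) (D.apply_inr.self_of_nhds ha _)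

theorem span_le_ker_fibMap (D : θ.NormalForm a σ) (ha : a ∉ Set.range x) :
    Submodule.span ℂ (Set.range fun j => D.v (σ (Sum.inr j)) a) ≤ LinearMap.ker (θ.fibMap a) :=
  Submodule.span_le.2 (Set.range_subset_iff.2 (D.apply_inr.self_of_nhds ha _))

theorem eventually_range_fibMap_eq_and_ker_fibMap_eq (D : θ.NormalForm a σ) :
    ∀ᶠ y in 𝓝[≠] a,
      LinearMap.range (θ.fibMap y) = Submodule.span ℂ (Set.range fun i => D.u i y) ∧
      LinearMap.ker (θ.fibMap y) =
        Submodule.span ℂ (Set.range fun j => D.v (σ (Sum.inr j)) y) := by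
  have hnhds := (eventually_mem_chart_source a).and
    (D.frame.2.and (D.indep_u.and (D.apply_inl.and D.apply_inr)))
  filter_upwards [eventually_all.2 D.d_ne, eventually_notMem_range x a,
    eventually_nhdsWithin_of_eventually_nhds hnhds] with y hd hyx hall
  obtain ⟨hy, hv, hu, hl, hr⟩ := hall
  have hc (i : Fin r) : tangentCoord a y (coordField y y) * D.d i y ≠ 0 :=
    mul_ne_zero (tangentCoord_coordField_ne_zero hy) (hd i)
  have hl' := hl hyx (coordField y y)
  have hr' := hr hyx (coordField y y)
  have hrange := range_eq_span_of_adapted (T := θ.fibMap y) (σ := σ) (v := fun i => D.v i y)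
    (u := fun i => D.u i y) hv.2 hl' hr' hc
  have hker := ker_eq_span_of_adapted (T := θ.fibMap y) (σ := σ) (v := fun i => D.v i y)
    (u := fun i => D.u i y) hv.2 hu hl' hr' hc
  exact ⟨hrange, hker⟩

theorem eventually_finrank_range_fibMap (D : θ.NormalForm a σ) :
    ∀ᶠ y in 𝓝[≠] a, finrank ℂ (LinearMap.range (θ.fibMap y)) = r := by
  filter_upwards [D.eventually_range_fibMap_eq_and_ker_fibMap_eq,
    eventually_nhdsWithin_of_eventually_nhds D.indep_u] with y hy hu
  rw [hy.1, finrank_span_eq_card hu, Fintype.card_fin]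

theorem nonempty_of_rank_eq {r' t' : ℕ} (D : θ.NormalForm a σ) (h : r = r')
    (σ' : Fin r' ⊕ Fin t' ≃ Fin q) : Nonempty (θ.NormalForm a σ') := by
  subst h
  obtain rfl : t = t' := by
    simpa using Fintype.card_congr (σ.trans σ'.symm)
  exact ⟨D.reindex σ'⟩

end NormalForm

theorem exists_uniform_normalForm (θ : HiggsHom E F) (hFE : WeightsLE F E) :
    ∃ (r t : ℕ) (σ : Fin r ⊕ Fin t ≃ Fin q), ∀ a, Nonempty (θ.NormalForm a σ) := by
  choose r t σ D using θ.exists_normalForm hFE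
  have hr : IsLocallyConstant r :=
    isLocallyConstant_of_eventually_nhdsNE_eq fun a => (D a).some.eventually_finrank_range_fibMap
  exact ⟨r ∞, t ∞, σ ∞, fun a => (D a).some.nonempty_of_rank_eq
    (hr.apply_eq_of_isPreconnected isPreconnected_univ trivial trivial) _⟩

/-- The kernel of the one-form, extended over all points. -/
def kernelSub (D : ∀ a, θ.NormalForm a σ) (y : OnePoint ℂ) : Submodule ℂ (E.Fib y) :=
  Submodule.span ℂ (Set.range fun j => (D y).v (σ (Sum.inr j)) y)

/-- The saturation of the image of the one-form. -/
def imageSub (D : ∀ a, θ.NormalForm a σ) (y : OnePoint ℂ) : Submodule ℂ (F.Fib y) :=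
  Submodule.span ℂ (Set.range fun i => (D y).u i y)

variable (D : ∀ a, θ.NormalForm a σ)

theorem finrank_kernelSub (y : OnePoint ℂ) : finrank ℂ (kernelSub D y) = t := by
  rw [kernelSub, finrank_span_eq_card (D y).indep_inr.self_of_nhds, Fintype.card_fin]

theorem finrank_imageSub (y : OnePoint ℂ) : finrank ℂ (imageSub D y) = r := by
  rw [imageSub, finrank_span_eq_card (D y).indep_u.self_of_nhds, Fintype.card_fin]

theorem isFrameAt_kernelSub (a : OnePoint ℂ) :
    E.IsFrameAt (kernelSub D) (fun j => (D a).v (σ (Sum.inr j))) a := by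
  refine ⟨fun j => (D a).frame.1 _, (D a).indep_inr.and ?_⟩
  have hpunctured := eventually_nhdsWithin_iff.1
    ((D a).eventually_range_fibMap_eq_and_ker_fibMap_eq.and (eventually_notMem_range x a))
  filter_upwards [hpunctured, (D a).indep_inr] with y hy hi
  by_cases hya : y = a
  · subst hya; rfl
  · obtain ⟨⟨-, hker⟩, hyx⟩ := hy hya
    refine (Submodule.eq_of_le_of_finrank_eq
      (hker ▸ (D y).span_le_ker_fibMap hyx : kernelSub D y ≤ _) ?_).symm
    rw [finrank_kernelSub, finrank_span_eq_card hi, Fintype.card_fin]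

theorem isFrameAt_imageSub (a : OnePoint ℂ) : F.IsFrameAt (imageSub D) (D a).u a := by
  refine ⟨(D a).hol_u, (D a).indep_u.and ?_⟩
  have hpunctured := eventually_nhdsWithin_iff.1
    ((D a).eventually_range_fibMap_eq_and_ker_fibMap_eq.and (eventually_notMem_range x a))
  filter_upwards [hpunctured, (D a).indep_u] with y hy hi
  by_cases hya : y = a
  · subst hya; rfl
  · obtain ⟨⟨hrange, -⟩, hyx⟩ := hy hya
    refine Submodule.eq_of_le_of_finrank_eq
      (hrange ▸ (D y).range_fibMap_le hyx : _ ≤ imageSub D y) ?_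
    rw [finrank_imageSub, finrank_span_eq_card hi, Fintype.card_fin]

theorem isSubbundle_kernelSub : E.IsSubbundle (kernelSub D) t := fun a =>
  ⟨_, isFrameAt_kernelSub D a⟩

theorem isSubbundle_imageSub : F.IsSubbundle (imageSub D) r := fun a =>
  ⟨_, isFrameAt_imageSub D a⟩

theorem toFun_apply_of_mem_kernelSub {y : OnePoint ℂ} (hy : y ∉ Set.range x)
    (X : TangentSpace 𝓘(ℂ) y) {v : E.Fib y} (hv : v ∈ kernelSub D y) : θ.toFun y X v = 0 := by
  have hker : θ.fibMap y v = 0 := (D y).span_le_ker_fibMap hy hv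
  rw [toFun_eq_smul_fibMap, LinearMap.smul_apply, hker, smul_zero]

theorem toFun_apply_mem_imageSub {y : OnePoint ℂ} (hy : y ∉ Set.range x)
    (X : TangentSpace 𝓘(ℂ) y) (v : E.Fib y) : θ.toFun y X v ∈ imageSub D y := by
  rw [toFun_eq_smul_fibMap]
  exact Submodule.smul_mem _ _ ((D y).range_fibMap_le hy ⟨v, rfl⟩)

include D in
theorem toFun_eq_zero_of_rank_eq_zero (hr : r = 0) {y : OnePoint ℂ} (hy : y ∉ Set.range x)
    (X : TangentSpace 𝓘(ℂ) y) : θ.toFun y X = 0 := by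
  subst hr
  ext v
  simpa [imageSub] using toFun_apply_mem_imageSub D hy X v

end ParabolicBundle.HiggsHom

/-! ### Relations between degrees -/

theorem HasOrderAt.eventually_zero {f : OnePoint ℂ → ℂ} {a : OnePoint ℂ} {m : ℤ}
    (h : HasOrderAt f a m) : ∀ᶠ y in 𝓝[≠] a, HasOrderAt f y 0 := by
  rw [← eventually_chart_symm_nhdsNE]
  filter_upwards [h.1.eventually_analyticAt, eventually_chart_symm_nhdsNE.2 h.eventually_ne]
    with w hw hne
  exact HasOrderAt.of_hol ((hol_chart_symm_iff a w).2 hw) hne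

theorem finite_support_order {f : OnePoint ℂ → ℂ} {n : OnePoint ℂ → ℤ}
    (h : ∀ a, HasOrderAt f a (n a)) : (Function.support n).Finite := by
  by_contra hinf
  obtain ⟨a, ha⟩ := Set.Infinite.exists_accPt_principal hinf
  rw [accPt_iff_frequently_nhdsNE] at ha
  refine ha ?_
  filter_upwards [(h a).eventually_zero] with y hy
  simpa using (h y).unique hy

theorem exists_finsupp_eq_order {f : OnePoint ℂ → OnePoint ℂ → ℂ} {n : OnePoint ℂ → ℤ}
    (h : ∀ a, HasOrderAt (f a) a (n a)) (hglue : ∀ a, ∀ᶠ y in 𝓝[≠] a, f a y = f y y) :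
    ∃ m : OnePoint ℂ →₀ ℤ, ⇑m = n ∧ m.degree = 0 := by
  have hdiag (a) : HasOrderAt (fun y => f y y) a (n a) := (h a).congr (hglue a)
  exact ⟨Finsupp.ofSupportFinite n (finite_support_order hdiag), rfl,
    sum_order_eq_zero (m := Finsupp.ofSupportFinite n (finite_support_order hdiag)) hdiag⟩

namespace HolVectorBundle

variable {n : ℕ} (E : HolVectorBundle n)

theorem hasDegree_iff {N : ∀ y, Submodule ℂ (E.Fib y)} {r : ℕ} {d : ℤ} :
    E.HasDegree N r d ↔
      ∃ (w : ∀ y, E.Fib y [⋀^Fin r]→ₗ[ℂ] ℂ) (m : OnePoint ℂ →₀ ℤ),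
        (∀ a s, E.IsFrameAt N s a → HasOrderAt (fun y => w y (fun i => s i y)) a (m a)) ∧
        d = -m.degree :=
  Iff.rfl

theorem isFrameAt_bot (s : Fin 0 → ∀ y, E.Fib y) (a : OnePoint ℂ) :
    E.IsFrameAt (fun _ => ⊥) s a :=
  ⟨fun i => i.elim0, Eventually.of_forall fun y => ⟨linearIndependent_empty_type, by simp⟩⟩

theorem isSubbundle_bot : E.IsSubbundle (fun _ => ⊥) 0 := fun a =>
  ⟨fun i => i.elim0, E.isFrameAt_bot _ a⟩

theorem degree_bot : E.degree (fun _ => ⊥) 0 = 0 := by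
  obtain ⟨w, m, hw, hm⟩ := E.hasDegree_iff.1 E.isSubbundle_bot.hasDegree
  have hsum : m.degree = 0 := sum_order_eq_zero fun a => hw a _ (E.isFrameAt_bot Fin.elim0 a)
  rw [hm, hsum, neg_zero]

variable {m : ℕ} {U : HolVectorBundle m} {V : HolVectorBundle n} {r t : ℕ} {a : OnePoint ℂ}
  {M : ∀ y, Submodule ℂ (U.Fib y)} {N : ∀ y, Submodule ℂ (V.Fib y)}
  {u u' : Fin r → ∀ y, U.Fib y} {v v' : Fin t → ∀ y, V.Fib y}

theorem IsFrameAt.form₂_div_form_mul_form_eq (hu : U.IsFrameAt M u a) (hu' : U.IsFrameAt M u' a)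
    (hv : V.IsFrameAt N v a) (hv' : V.IsFrameAt N v' a)
    (w : U.Fib a [⋀^Fin r]→ₗ[ℂ] (V.Fib a [⋀^Fin t]→ₗ[ℂ] ℂ)) (wU : U.Fib a [⋀^Fin r]→ₗ[ℂ] ℂ)
    (wV : V.Fib a [⋀^Fin t]→ₗ[ℂ] ℂ) :
    w (fun i => u' i a) (fun i => v' i a) / (wU (fun i => u' i a) * wV (fun i => v' i a)) =
      w (fun i => u i a) (fun i => v i a) / (wU (fun i => u i a) * wV (fun i => v i a)) := by
  obtain ⟨C, hC, hCu⟩ := hu.exists_form_eq_mul hu'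
  obtain ⟨C', hC', hCv⟩ := hv.exists_form_eq_mul hv'
  let evalAt : (V.Fib a [⋀^Fin t]→ₗ[ℂ] ℂ) →ₗ[ℂ] ℂ :=
    { toFun := fun g => g fun i => v i a
      map_add' := fun _ _ => rfl
      map_smul' := fun _ _ => rfl }
  have hw : w (fun i => u' i a) (fun i => v i a) = C * w (fun i => u i a) (fun i => v i a) :=
    hCu (evalAt.compAlternatingMap w)
  rw [hCu, hCv, hCv, hw, ← mul_assoc, mul_mul_mul_comm, mul_comm C' C,
    mul_div_mul_left _ _ (mul_ne_zero hC hC')]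

end HolVectorBundle

namespace ParabolicBundle

variable {s : ℕ} {x : Fin s → OnePoint ℂ} {q p : ℕ}

namespace HiggsHom

variable {E : ParabolicBundle x q} {F : ParabolicBundle x p} {θ : HiggsHom E F} {r t : ℕ}
  {σ : Fin r ⊕ Fin t ≃ Fin q} {a : OnePoint ℂ}
  {wE : ∀ y, E.Fib y [⋀^Fin q]→ₗ[ℂ] ℂ} {wK : ∀ y, E.Fib y [⋀^Fin t]→ₗ[ℂ] ℂ}
  {wI : ∀ y, F.Fib y [⋀^Fin r]→ₗ[ℂ] ℂ}

/-- The isomorphism `det E → det (ker θ) ⊗ det (im θ)`, for the contraction of `θ` with `∂ / ∂z`,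
as the quotient of volume forms on the three bundles. It is computed in the frame `v` of the normal
form `D`, on which it does not depend. -/
noncomputable def NormalForm.volumeRatio (D : θ.NormalForm a σ)
    (wE : ∀ y, E.Fib y [⋀^Fin q]→ₗ[ℂ] ℂ) (wK : ∀ y, E.Fib y [⋀^Fin t]→ₗ[ℂ] ℂ)
    (wI : ∀ y, F.Fib y [⋀^Fin r]→ₗ[ℂ] ℂ) (y : OnePoint ℂ) : ℂ :=
  wE y (fun i => D.v i y) / (wK y (fun j => D.v (σ (Sum.inr j)) y) *
    wI y (fun i => θ.toFun y (translationField y) (D.v (σ (Sum.inl i)) y)))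

theorem NormalForm.hasOrderAt_image_form (D : θ.NormalForm a σ) {k : Fin r → ℤ} {mI : ℤ}
    (hk : ∀ i, HasOrderAt (D.d i) a (k i))
    (hI : HasOrderAt (fun y => wI y fun i => D.u i y) a mI) :
    HasOrderAt (fun y => wI y fun i => θ.toFun y (translationField y) (D.v (σ (Sum.inl i)) y)) a
      (∑ i, (Finsupp.single (∞ : OnePoint ℂ) (2 : ℤ) a + k i) + mI) := by
  refine ((HasOrderAt.prod (s := Finset.univ) fun i _ =>
    (hasOrderAt_translationField a).mul (hk i)).mul hI).congr ?_
  filter_upwards [eventually_nhdsWithin_of_eventually_nhds D.apply_inl,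
    eventually_notMem_range x a] with y hy hyx
  simp only [hy hyx]
  rw [AlternatingMap.map_smul_univ, smul_eq_mul]

theorem NormalForm.hasOrderAt_volumeRatio (D : θ.NormalForm a σ) {k : Fin r → ℤ}
    {mE mK mI : ℤ} (hk : ∀ i, HasOrderAt (D.d i) a (k i))
    (hE : HasOrderAt (fun y => wE y fun i => D.v i y) a mE)
    (hK : HasOrderAt (fun y => wK y fun j => D.v (σ (Sum.inr j)) y) a mK)
    (hI : HasOrderAt (fun y => wI y fun i => D.u i y) a mI) :
    HasOrderAt (D.volumeRatio wE wK wI) a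
      (mE - mK - mI - Finsupp.single (∞ : OnePoint ℂ) (2 * r : ℤ) a - ∑ i, k i) := by
  have hsingle : Finsupp.single (∞ : OnePoint ℂ) (2 * r : ℤ) a =
      r * Finsupp.single (∞ : OnePoint ℂ) (2 : ℤ) a := by
    rcases eq_or_ne a ∞ with rfl | ha
    · simp only [Finsupp.single_eq_same, mul_comm]
    · simp only [Finsupp.single_eq_of_ne ha, mul_zero]
  have hexponent : mE - mK - mI - Finsupp.single (∞ : OnePoint ℂ) (2 * r : ℤ) a - ∑ i, k i =
      mE - (mK + (∑ i, (Finsupp.single (∞ : OnePoint ℂ) (2 : ℤ) a + k i) + mI)) := by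
    rw [Finset.sum_add_distrib, Finset.sum_const, Finset.card_univ, Fintype.card_fin, nsmul_eq_mul,
      hsingle]
    ring
  rw [hexponent]
  exact hE.div (hK.mul (D.hasOrderAt_image_form hk hI))

variable (D : ∀ a, θ.NormalForm a σ)

theorem eventually_volumeRatio_eq {m : ℤ}
    (h : HasOrderAt ((D a).volumeRatio wE wK wI) a m) :
    ∀ᶠ y in 𝓝[≠] a, (D a).volumeRatio wE wK wI y = (D y).volumeRatio wE wK wI y := by
  filter_upwards [h.eventually_ne, eventually_notMem_range x a,
    eventually_nhdsWithin_of_eventually_nhds (D a).frame.eventually,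
    eventually_nhdsWithin_of_eventually_nhds (D a).apply_inr,
    eventually_nhdsWithin_of_eventually_nhds (isFrameAt_kernelSub D a).2]
    with y hne hyx hframe hr hK
  obtain ⟨hnum, hden⟩ := div_ne_zero_iff.1 hne
  have hker (j) : (D y).v (σ (Sum.inr j)) y ∈
      Submodule.span ℂ (Set.range fun j => (D a).v (σ (Sum.inr j)) y) := by
    rw [hK.2]
    exact Submodule.subset_span ⟨j, rfl⟩
  have hcross := alternatingMap_mul_eq_of_adapted (θ.toFun y (translationField y)) σ
    (v' := fun i => (D y).v i y) hframe.2.self_of_nhds.2 (hr hyx _) hker (wE y) (wK y) (wI y)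
  have hnum' : wE y (fun i => (D y).v i y) ≠ 0 := by
    obtain ⟨C, hC, hframes⟩ := hframe.exists_form_eq_mul (D y).frame
    rw [hframes]
    exact mul_ne_zero hC hnum
  have hden' := right_ne_zero_of_mul (hcross ▸ mul_ne_zero hnum' hden)
  exact (div_eq_div_iff hden hden').2 hcross.symm

/-- The determinant of `θ` is a nonzero section of `det (E / ker θ)⁻¹ ⊗ det (im θ) ⊗ Kʳ`, and `K`
has degree `-2`. -/
theorem degree_le {dE dK dI : ℤ} (hE : E.HasDegree E.full q dE)
    (hK : E.HasDegree (kernelSub D) t dK) (hI : F.HasDegree (imageSub D) r dI) :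
    dE ≤ dK + dI - 2 * r := by
  obtain ⟨wE, mE, hwE, rfl⟩ := E.hasDegree_iff.1 hE
  obtain ⟨wK, mK, hwK, rfl⟩ := E.hasDegree_iff.1 hK
  obtain ⟨wI, mI, hwI, rfl⟩ := F.hasDegree_iff.1 hI
  choose k hk_nonneg hk using fun a i =>
    HasOrderAt.exists_nonneg_of_hol ((D a).hol_d i) ((D a).d_ne i)
  have horder (a) := (D a).hasOrderAt_volumeRatio (hk a) (hwE a _ (D a).frame)
    (hwK a _ (isFrameAt_kernelSub D a)) (hwI a _ (isFrameAt_imageSub D a))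
  obtain ⟨m, hm, hm_degree⟩ := exists_finsupp_eq_order horder fun a =>
    eventually_volumeRatio_eq D (horder a)
  set κ : OnePoint ℂ →₀ ℤ := mE - mK - mI - Finsupp.single (∞ : OnePoint ℂ) (2 * r : ℤ) - m with hκ
  have hκ_apply (a) : κ a = ∑ i, k a i := by simp [hκ, hm]
  have hκ_degree : 0 ≤ κ.degree := Finset.sum_nonneg fun a _ =>
    hκ_apply a ▸ Finset.sum_nonneg fun i _ => hk_nonneg a i
  simp only [hκ, map_sub, Finsupp.degree_single, hm_degree] at hκ_degree
  linarith

end HiggsHom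

variable {U : ParabolicBundle x p} {V : ParabolicBundle x q}

theorem degree_add_degree_add_sum_eq_zero {k : Fin s → ℤ}
    {w : ∀ y, U.Fib y [⋀^Fin p]→ₗ[ℂ] (V.Fib y [⋀^Fin q]→ₗ[ℂ] ℂ)}
    (hw : ∀ (a : OnePoint ℂ) (u : Fin p → ∀ y, U.Fib y) (v : Fin q → ∀ y, V.Fib y),
      U.IsFrameAt U.full u a → V.IsFrameAt V.full v a →
      HasOrderAt (fun y => w y (fun i => u i y) (fun i => v i y)) a
        (∑ j, Finsupp.single (x j) (k j) a)) :
    U.degree U.full p + V.degree V.full q + ∑ j, k j = 0 := by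
  obtain ⟨wU, mU, hwU, hdU⟩ := U.hasDegree_iff.1 U.isSubbundle_full.hasDegree
  obtain ⟨wV, mV, hwV, hdV⟩ := V.hasDegree_iff.1 V.isSubbundle_full.hasDegree
  choose u hu using U.isSubbundle_full
  choose v hv using V.isSubbundle_full
  have horder (a) := (hw a _ _ (hu a) (hv a)).div ((hwU a _ (hu a)).mul (hwV a _ (hv a)))
  obtain ⟨m, hm, hm_degree⟩ := exists_finsupp_eq_order horder fun a => by
    refine eventually_nhdsWithin_of_eventually_nhds ?_
    filter_upwards [(hu a).eventually, (hv a).eventually] with y huy hvy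
    exact (hu y).form₂_div_form_mul_form_eq huy (hv y) hvy _ _ _
  have hm_eq : m = ∑ j, Finsupp.single (x j) (k j) - (mU + mV) := by
    ext a
    simp [hm]
  simp only [hm_eq, map_sub, map_add, map_sum, Finsupp.degree_single] at hm_degree
  linarith

theorem TrivialDet.parDegree_add_parDegree (h : TrivialDet U V) :
    U.parDegree + V.parDegree = 0 := by
  obtain ⟨k, hk, w, hw⟩ := h
  have hsum : ((U.degree U.full p + V.degree V.full q + ∑ j, k j : ℤ) : ℝ) = 0 :=
    Int.cast_eq_zero.2 (degree_add_degree_add_sum_eq_zero hw)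
  push_cast [hk, Finset.sum_add_distrib] at hsum
  rw [parDegree, parDegree]
  linarith

end ParabolicBundle

/-! ### Semistability -/

theorem ParabolicStructure.weight_induced_top {M : Type*} [AddCommGroup M] [Module ℂ M]
    [FiniteDimensional ℂ M] (P : ParabolicStructure M) : (P.induced ⊤).weight = P.weight := by
  have hfil (c : ℝ) : finrank ℂ ((P.induced ⊤).fil c) = finrank ℂ (P.fil c) :=
    (Submodule.comapSubtypeEquivOfLe le_top).finrank_eq
  simp only [weight_eq_sum_jump, jump, hfil, finrank_top]

theorem HolVectorBundle.IsSubbundle.finrank_eq {n r : ℕ} {E : HolVectorBundle n}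
    {N : ∀ y, Submodule ℂ (E.Fib y)} (hN : E.IsSubbundle N r) (y : OnePoint ℂ) :
    finrank ℂ (N y) = r := by
  obtain ⟨v, hv⟩ := hN y
  have hvy := hv.2.self_of_nhds
  rw [← hvy.2, finrank_span_eq_card hvy.1, Fintype.card_fin]

namespace ParabolicBundle

variable {s n r : ℕ} {x : Fin s → OnePoint ℂ} (E : ParabolicBundle x n)
  {N : ∀ y, Submodule ℂ (E.Fib y)} {c : Fin s → ℝ}

theorem parDegreeSub_bot : E.parDegreeSub (fun _ => ⊥) 0 = 0 := by
  simp [parDegreeSub, E.degree_bot, ParabolicStructure.weight_eq_sum_jump]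

theorem parDegreeSub_full : E.parDegreeSub E.full n = E.parDegree :=
  congrArg _ (Finset.sum_congr rfl fun j _ => (E.par j).weight_induced_top)

variable {E}

theorem degree_add_sum_mul_le_parDegreeSub (hN : E.IsSubbundle N r)
    (hc : ∀ j, (E.par j).fil (c j) = ⊤) :
    E.degree N r + (∑ j, c j) * r ≤ E.parDegreeSub N r := by
  rw [parDegreeSub, Finset.sum_mul]
  gcongr with j
  simpa only [hN.finrank_eq] using
    ParabolicStructure.mul_finrank_le_weight_induced (hc j) (N (x j))

theorem parDegree_sub_parDegreeSub_le (hN : E.IsSubbundle N r)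
    (hc : ∀ j, (E.par j).filGT (c j) = ⊥) :
    E.parDegree - E.parDegreeSub N r ≤
      E.degree E.full n - E.degree N r + (∑ j, c j) * (n - r) := by
  rw [parDegree, parDegreeSub, add_sub_add_comm, ← Finset.sum_sub_distrib, Finset.sum_mul]
  gcongr with j
  simpa only [hN.finrank_eq, HolVectorBundle.finrank_fib] using
    ParabolicStructure.weight_sub_weight_induced_le (hc j) (N (x j))

end ParabolicBundle

namespace SUHiggsBundle

open ParabolicBundle ParabolicBundle.HiggsHom

variable {s p q : ℕ} {x : Fin s → OnePoint ℂ} {H : SUHiggsBundle x p q} {r t : ℕ}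
  {σ : Fin r ⊕ Fin t ≃ Fin q} (D : ∀ a, H.δ.NormalForm a σ)

theorem invariant_bot_kernelSub : H.Invariant (fun _ => ⊥) (kernelSub D) := fun y hy X =>
  ⟨fun u hu => by
    rw [(Submodule.mem_bot ℂ).1 hu, map_zero]
    exact Submodule.zero_mem _, fun _ hv => toFun_apply_of_mem_kernelSub D hy X hv⟩

theorem invariant_imageSub_full : H.Invariant (imageSub D) H.V.full := fun _ hy X =>
  ⟨fun _ _ => trivial, fun v _ => toFun_apply_mem_imageSub D hy X v⟩

include D in
theorem Semistable.rank_mul_le (hss : H.Semistable) {a b : Fin s → ℝ}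
    (ha : ∀ j, (H.U.par j).fil (a j) = ⊤) (hb : ∀ j, (H.V.par j).filGT (b j) = ⊥) :
    r * (2 - ∑ j, (b j - a j)) ≤ H.U.parDegree - H.V.parDegree := by
  have hK := isSubbundle_kernelSub D
  have hI := isSubbundle_imageSub D
  have hrank : (q : ℝ) - t = r := by
    rw [sub_eq_iff_eq_add]
    exact_mod_cast (by simpa using (Fintype.card_congr σ).symm : q = r + t)
  have hss_K := hss _ _ 0 t H.U.isSubbundle_bot hK (invariant_bot_kernelSub D)
  have hss_I := hss _ _ r q hI H.V.isSubbundle_full (invariant_imageSub_full D)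
  rw [parDegreeSub_bot, zero_add] at hss_K
  rw [parDegreeSub_full] at hss_I
  have hdegree : (H.V.degree H.V.full q : ℝ) ≤
      H.V.degree (kernelSub D) t + H.U.degree (imageSub D) r - 2 * r := by
    exact_mod_cast degree_le D H.V.isSubbundle_full.hasDegree hK.hasDegree hI.hasDegree
  have hweight_I := degree_add_sum_mul_le_parDegreeSub hI ha
  have hweight_K := parDegree_sub_parDegreeSub_le hK hb
  have hdet := H.trivialDet.parDegree_add_parDegree
  rw [hrank] at hweight_K
  rw [Finset.sum_sub_distrib]
  linarith

end SUHiggsBundle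

theorem propositionp_general {s p q : ℕ} (hp : 0 < p) (hq : 0 < q) (x : Fin s → OnePoint ℂ)
    (α : Fin s → Fin p → ℝ) (β : Fin s → Fin q → ℝ)
    (h₁ : ∀ j, α j ⟨p - 1, Nat.sub_one_lt_of_lt hp⟩ ≤ β j ⟨0, hq⟩)
    (ε : ℝ) (hε : ε = ∑ j, (β j ⟨q - 1, Nat.sub_one_lt_of_lt hq⟩ - α j ⟨0, hp⟩))
    (h₂ : ε ≤ 2)
    (H : SUHiggsBundle x p q) (hH : H.HasType α β) (hss : H.Semistable)
    (hdeg : H.U.parDegree - H.V.parDegree < 2 - ε) :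
    ∀ y ∉ Set.range x, ∀ X : TangentSpace 𝓘(ℂ) y, H.δ.toFun y X = 0 := by
  have hα_min (j i) : α j ⟨0, hp⟩ ≤ α j i := (hH j).1.1 (Fin.mk_le_of_le_val (Nat.zero_le _))
  have hα_max (j i) : α j i ≤ β j ⟨0, hq⟩ :=
    ((hH j).1.1 (Fin.le_def.2 (Nat.le_sub_one_of_lt i.2))).trans (h₁ j)
  have hβ_min (j i) : β j ⟨0, hq⟩ ≤ β j i := (hH j).2.1 (Fin.mk_le_of_le_val (Nat.zero_le _))
  have hβ_max (j i) : β j i ≤ β j ⟨q - 1, Nat.sub_one_lt_of_lt hq⟩ :=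
    (hH j).2.1 (Fin.le_def.2 (Nat.le_sub_one_of_lt i.2))
  obtain ⟨r, t, σ, hD⟩ := H.δ.exists_uniform_normalForm fun j =>
    ⟨β j ⟨0, hq⟩, (hH j).1.filGT_eq_bot (hα_max j), (hH j).2.fil_eq_top (hβ_min j)⟩
  have D (a) := (hD a).some
  have hrank := hss.rank_mul_le D (fun j => (hH j).1.fil_eq_top (hα_min j))
    fun j => (hH j).2.filGT_eq_bot (hβ_max j)
  rw [← hε] at hrank
  have hr : r = 0 := by
    by_contra hr
    have hr_one : (1 : ℝ) ≤ r := by exact_mod_cast Nat.one_le_iff_ne_zero.2 hr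
    nlinarith
  exact fun y hy X => ParabolicBundle.HiggsHom.toFun_eq_zero_of_rank_eq_zero D hr hy X

theorem propositionp {s p q : ℕ} (hp : 0 < p) (hq : 0 < q)
    (x : Fin s → OnePoint ℂ) (hx : Function.Injective x)
    (α : Fin s → Fin p → ℝ) (β : Fin s → Fin q → ℝ) (hαβ : IsMultiweight α β)
    (h₁ : ∀ j, α j ⟨p - 1, Nat.sub_one_lt_of_lt hp⟩ < β j ⟨0, hq⟩)
    (ε : ℝ) (hε : ε = ∑ j, (β j ⟨q - 1, Nat.sub_one_lt_of_lt hq⟩ - α j ⟨0, hp⟩))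
    (h₂ : ε < 2)
    (H : SUHiggsBundle x p q) (hH : H.HasType α β) (hss : H.Semistable)
    (hdeg : H.U.parDegree - H.V.parDegree < 2 - ε) :
    ∀ y ∉ Set.range x, ∀ X : TangentSpace 𝓘(ℂ) y, H.δ.toFun y X = 0 :=
  propositionp_general hp hq x α β (fun j => (h₁ j).le) ε hε h₂.le H hH hss hdeg
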